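/- Let $(M,g)$ be a smooth Riemannian $7$-manifold with a parallel $G_2$-structure: a smooth $3$-form $\varphi$ on $M$ which, in a suitable orthonormal basis of each tangent space, is the standard $G_2$-form $$\varphi_0=e^{123}+e^{145}+e^{167}+e^{246}-e^{257}-e^{347}-e^{356},$$ and which satisfies $\nabla\varphi=0$ for the Levi-Civita connection $\nabla$ of $g$. (Such a $\varphi$ exists when the holonomy of $g$ is contained in $G_2$.) Let $R(w,z)=\nabla_w\nabla_z-\nabla_z\nabla_w-\nabla_{[w,z]}$ be the curvature tensor of $g$, and let $\times$ be the vector product on $TM$ given by $\langle u\times v,w\rangle=\varphi(u,v,w)$. Let $Y$ be an (immersed) associative submanifold of $M$, i.e. a smooth $3$-dimensional submanifold, possibly with boundary, whose tangent spaces are stable under $\times$. Let $\nu$ be its normal bundle, $\pi_\nu$ and $(\cdot)^\top$ the orthogonal projections of $TM|_Y$ onto $\nu$ and $TY$, and $\nabla^\perp=\pi_\nu\nabla$, $\nabla^\top=(\nabla)^\top$. For an orthonormal frame $(e_1,e_2,e_3)$ of $TY$ and smooth sections $\psi\in\Gamma(Y,\nu)$ define - $D\psi=\sum_{i=1}^3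 e_i\times\nabla^\perp_{e_i}\psi$; - $\nabla^{\perp*}\nabla^\perp\psi=-\sum_{i=1}^3\nabla^{\perp2}_{e_i,e_i}\psi$, where $\nabla^{\perp2}_{v,w}=\nabla^\perp_v\nabla^\perp_w-\nabla^\perp_{\nabla^\top_v w}$, which is tensorial in $v,w$; - $\mathcal R\psi=\pi_\nu\sum_{i=1}^3R(e_i,\psi)e_i$; - $\mathcal A\psi=A^t(A(\psi))$, where $A(\eta)\in\mathrm{End}(T_yY)$, $A(\eta)(u)=-\nabla^\top_u\eta$ for $\eta\in\nu_y$, $u\in T_yY$, is the second fundamental form, and $A^t$ is its transpose with respect to the inner product $\langle S,T\rangle=\sum_i\langle Se_i,Te_i\rangle$ on endomorphisms of $T_yY$. These operators do not depend on the choice of the frame. Then $D$ maps $\Gamma(Y,\nu)$ to itself, and on $\Gamma(Y,\nu)$ $$D^2=\nabla^{\perp*}\nabla^\perp+\mathcal R-\mathcal A .$$ -/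

import Mathlib

open scoped Manifold ContDiff Bundle
open Bundle

noncomputable section

namespace AssociativeSubmanifold

/-- The model space `ℝⁿ`. -/
abbrev Eu (n : ℕ) : Type := EuclideanSpace ℝ (Fin n)

/-- `∑ᵢ F(eᵢ)` for an orthonormal basis `(eᵢ)` of the subspace `T`. -/
def frameSum {V W : Type*} [NormedAddCommGroup V] [InnerProductSpace ℝ V] [FiniteDimensional ℝ V]
    [AddCommMonoid W] (T : Submodule ℝ V) (F : V → W) : W :=
  ∑ i, F (stdOrthonormalBasis ℝ T i : V)

/-- The orthogonal projection onto the subspace `T`. -/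
def orthoProj {V : Type*} [NormedAddCommGroup V] [InnerProductSpace ℝ V] [FiniteDimensional ℝ V]
    (T : Submodule ℝ V) (z : V) : V :=
  T.starProjection z

theorem orthoProj_mem {V : Type*} [NormedAddCommGroup V] [InnerProductSpace ℝ V]
    [FiniteDimensional ℝ V] (T : Submodule ℝ V) (z : V) : orthoProj T z ∈ T :=
  T.starProjection_apply_mem z

/-! ### Levi-Civita connection and curvature of a Riemannian manifold, in charts -/

section Riemannian

variable {n : ℕ} {M : Type*} [TopologicalSpace M] [ChartedSpace (Eu n) M]
  [IsManifold (𝓡 n) ∞ M]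

instance finiteDimensionalTangentSpace (x : M) :
    FiniteDimensional ℝ (TangentSpace (𝓡 n) x) :=
  inferInstanceAs (FiniteDimensional ℝ (Eu n))

/-- The `i`-th vector of the standard basis of `ℝⁿ`. -/
def stdVec (i : Fin n) : Eu n := EuclideanSpace.single i 1

/-- `fromCoords x₀ x a` is the tangent vector `∑ aᵢ ∂ᵢ` at `x`, where `∂ᵢ` are the coordinate
vector fields of the chart around `x₀` (for `x` in the domain of that chart). -/
def fromCoords (x₀ x : M) : Eu n →L[ℝ] TangentSpace (𝓡 n) x :=
  (trivializationAt (Eu n) (TangentSpace (𝓡 n) : M → Type _) x₀).symmL ℝ x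

/-- The components of a tangent vector at `x` in the chart around `x₀`. -/
def toCoords (x₀ x : M) : TangentSpace (𝓡 n) x →L[ℝ] Eu n :=
  (trivializationAt (Eu n) (TangentSpace (𝓡 n) : M → Type _) x₀).continuousLinearMapAt ℝ x

/-- The `i`-th partial derivative of a function on `ℝⁿ`. -/
def partialDeriv (i : Fin n) (h : Eu n → ℝ) (u : Eu n) : ℝ := fderiv ℝ h u (stdVec i)

variable [RiemannianBundle (fun x : M => TangentSpace (𝓡 n) x)]

/-- `gᵢⱼ(u)`: the components of the metric in the chart around `x₀`. -/
def metricCoeff (x₀ : M) (i j : Fin n) (u : Eu n) : ℝ :=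
  inner ℝ (fromCoords x₀ ((extChartAt (𝓡 n) x₀).symm u) (stdVec i))
    (fromCoords x₀ ((extChartAt (𝓡 n) x₀).symm u) (stdVec j))

/-- `gⁱʲ(u)`: the components of the inverse metric in the chart around `x₀`. -/
def metricInv (x₀ : M) (i j : Fin n) (u : Eu n) : ℝ :=
  (Matrix.of fun k l => metricCoeff x₀ k l u)⁻¹ i j

/-- The Christoffel symbol `Γᵏᵢⱼ(u)` of the Levi-Civita connection in the chart around `x₀`:
`∇_{∂ᵢ} ∂ⱼ = ∑ₖ Γᵏᵢⱼ ∂ₖ`. -/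
def christoffel (x₀ : M) (k i j : Fin n) (u : Eu n) : ℝ :=
  (1 / 2) * ∑ l, metricInv x₀ k l u *
    (partialDeriv i (metricCoeff x₀ j l) u + partialDeriv j (metricCoeff x₀ i l) u
      - partialDeriv l (metricCoeff x₀ i j) u)

/-- `Γ_x(a, b) = ∑ᵢⱼₖ Γᵏᵢⱼ aᵢ bⱼ ∂ₖ`, at the point `x`, in the chart around `x`. -/
def christoffelVec (x : M) (a b : Eu n) : Eu n :=
  ∑ k, (∑ i, ∑ j, christoffel x k i j (extChartAt (𝓡 n) x x) * a i * b j) • stdVec k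

/-- The components `Rˡᵢⱼₖ(u)` of the curvature tensor in the chart around `x₀`:
`R(∂ᵢ, ∂ⱼ) ∂ₖ = ∑ₗ Rˡᵢⱼₖ ∂ₗ`, with `R(w, z) = ∇_w ∇_z - ∇_z ∇_w - ∇_{[w, z]}`. -/
def curvatureCoeff (x₀ : M) (l i j k : Fin n) (u : Eu n) : ℝ :=
  partialDeriv i (christoffel x₀ l j k) u - partialDeriv j (christoffel x₀ l i k) u
    + ∑ m, (christoffel x₀ l i m u * christoffel x₀ m j k u
      - christoffel x₀ l j m u * christoffel x₀ m i k u)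

/-- The curvature tensor `R(a, b) c` of the Levi-Civita connection at `x`. -/
def curvature (x : M) (a b c : TangentSpace (𝓡 n) x) : TangentSpace (𝓡 n) x :=
  fromCoords x x (∑ l, (∑ i, ∑ j, ∑ k,
    curvatureCoeff x l i j k (extChartAt (𝓡 n) x x)
      * toCoords x x a i * toCoords x x b j * toCoords x x c k) • stdVec l)

/-! ### Parallel `G₂`-forms and the vector product -/

/-- `φ(a, b, c)` as a function of the chart coordinates around `x₀`, for vector fields `a, b, c`
with constant components in this chart. -/
def formCoeff (φ : ∀ x : M, TangentSpace (𝓡 n) x [⋀^Fin 3]→ₗ[ℝ] ℝ) (x₀ : M) (a b c : Eu n)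
    (u : Eu n) : ℝ :=
  φ ((extChartAt (𝓡 n) x₀).symm u)
    ![fromCoords x₀ ((extChartAt (𝓡 n) x₀).symm u) a,
      fromCoords x₀ ((extChartAt (𝓡 n) x₀).symm u) b,
      fromCoords x₀ ((extChartAt (𝓡 n) x₀).symm u) c]

/-- The covariant derivative `(∇_v φ)(a, b, c)` at the point `x`; the vectors `v, a, b, c` are
given by their components in the chart around `x`. -/
def covDerivForm (φ : ∀ x : M, TangentSpace (𝓡 n) x [⋀^Fin 3]→ₗ[ℝ] ℝ) (x : M)
    (v a b c : Eu n) : ℝ :=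
  fderiv ℝ (formCoeff φ x a b c) (extChartAt (𝓡 n) x x) v
    - formCoeff φ x (christoffelVec x v a) b c (extChartAt (𝓡 n) x x)
    - formCoeff φ x a (christoffelVec x v b) c (extChartAt (𝓡 n) x x)
    - formCoeff φ x a b (christoffelVec x v c) (extChartAt (𝓡 n) x x)

/-- The value on `(eᵢ, eⱼ, eₖ)` of `e^{abc} = e^a ∧ e^b ∧ e^c` on `ℝ⁷`. -/
def wedge3 (a b c i j k : Fin 7) : ℤ :=
  Matrix.det !![if a = i then 1 else 0, if a = j then 1 else 0, if a = k then 1 else 0;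
    if b = i then 1 else 0, if b = j then 1 else 0, if b = k then 1 else 0;
    if c = i then 1 else 0, if c = j then 1 else 0, if c = k then (1 : ℤ) else 0]

/-- The standard `G₂`-form on `ℝ⁷`, in indices `0, …, 6`:
`φ₀ = e^{012} + e^{034} + e^{056} + e^{135} - e^{146} - e^{236} - e^{245}`. -/
def stdG2Form (i j k : Fin 7) : ℤ :=
  wedge3 0 1 2 i j k + wedge3 0 3 4 i j k + wedge3 0 5 6 i j k + wedge3 1 3 5 i j k
    - wedge3 1 4 6 i j k - wedge3 2 3 6 i j k - wedge3 2 4 5 i j k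

end Riemannian

section G2

variable {M : Type*} [TopologicalSpace M] [ChartedSpace (Eu 7) M]
  [RiemannianBundle (fun x : M => TangentSpace (𝓡 7) x)]

/-- `φ` is a parallel `G₂`-form on the Riemannian `7`-manifold `M`: a smooth `3`-form that is the
standard `G₂`-form in a suitable orthonormal basis of each tangent space, with `∇φ = 0` for the
Levi-Civita connection of the given metric. -/
structure IsParallelG2Form [IsManifold (𝓡 7) ∞ M]
    (φ : ∀ x : M, TangentSpace (𝓡 7) x [⋀^Fin 3]→ₗ[ℝ] ℝ) : Prop where
  smooth : ∀ (x₀ : M) (a b c : Eu 7),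
    ContDiffOn ℝ ∞ (formCoeff φ x₀ a b c) (extChartAt (𝓡 7) x₀).target
  isG2 : ∀ x : M, ∃ b : OrthonormalBasis (Fin 7) ℝ (TangentSpace (𝓡 7) x),
    ∀ i j k, φ x ![b i, b j, b k] = stdG2Form i j k
  parallel : ∀ (x : M) (v a b c : Eu 7), covDerivForm φ x v a b c = 0

/-- The vector product of `M`, determined by `⟨u × v, w⟩ = φ(u, v, w)`. -/
def cross (φ : ∀ x : M, TangentSpace (𝓡 7) x [⋀^Fin 3]→ₗ[ℝ] ℝ) (x : M)
    (u v : TangentSpace (𝓡 7) x) : TangentSpace (𝓡 7) x :=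
  ∑ k, φ x ![u, v, stdOrthonormalBasis ℝ (TangentSpace (𝓡 7) x) k] •
    stdOrthonormalBasis ℝ (TangentSpace (𝓡 7) x) k

theorem inner_cross (φ : ∀ x : M, TangentSpace (𝓡 7) x [⋀^Fin 3]→ₗ[ℝ] ℝ) (x : M)
    (u v w : TangentSpace (𝓡 7) x) : inner ℝ (cross φ x u v) w = φ x ![u, v, w] := by
  have key : ∀ z : TangentSpace (𝓡 7) x,
      φ x ![u, v, z] = ((φ x).toMultilinearMap.toLinearMap ![u, v, 0] 2) z := by
    intro z
    simp only [MultilinearMap.toLinearMap_apply, AlternatingMap.coe_multilinearMap]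
    congr 1
    ext i
    fin_cases i <;> simp [Function.update]
  have hw := (stdOrthonormalBasis ℝ (TangentSpace (𝓡 7) x)).sum_repr' w
  rw [key w]
  conv_rhs => rw [← hw, map_sum]
  simp only [cross, sum_inner, inner_smul_left, map_smul, smul_eq_mul, key]
  exact Finset.sum_congr rfl fun k _ => mul_comm _ _

end G2

/-! ### Immersed submanifolds and their normal bundle -/

section Submanifold

variable {H : Type*} [TopologicalSpace H] {I : ModelWithCorners ℝ (Eu 3) H}
  {Y : Type*} [TopologicalSpace Y] [ChartedSpace H Y] [IsManifold I ∞ Y]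
  {n : ℕ} {M : Type*} [TopologicalSpace M] [ChartedSpace (Eu n) M] [IsManifold (𝓡 n) ∞ M]

variable (I) in
/-- `ψ` is a smooth vector field of `M` along `f : Y → M`, i.e. a smooth section of `f^* TM`. -/
def IsSmoothAlong (f : Y → M) (ψ : ∀ y : Y, TangentSpace (𝓡 n) (f y)) : Prop :=
  ContMDiff I (𝓡 n).tangent ∞ (fun y => (⟨f y, ψ y⟩ : TangentBundle (𝓡 n) M))

variable [RiemannianBundle (fun x : M => TangentSpace (𝓡 n) x)]

variable (I) in
/-- The covariant derivative `∇_v ψ` at `y` of a vector field `ψ` of `M` along `f : Y → M`, for the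
Levi-Civita connection of `M` (in the chart of `M` around `f y`: `dψ(v) + Γ(df(v), ψ)`). -/
def covDeriv (f : Y → M) (ψ : ∀ y : Y, TangentSpace (𝓡 n) (f y)) (y : Y)
    (v : TangentSpace I y) : TangentSpace (𝓡 n) (f y) :=
  fromCoords (f y) (f y)
    (mvfderiv I (fun y' : Y => toCoords (f y) (f y') (ψ y')) y v
      + christoffelVec (f y) (toCoords (f y) (f y) (mfderiv I (𝓡 n) f y v))
          (toCoords (f y) (f y) (ψ y)))

variable (I) in
/-- The tangent space of the submanifold at `y`, as a subspace of the ambient tangent space. -/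
def tangentSub (f : Y → M) (y : Y) : Submodule ℝ (TangentSpace (𝓡 n) (f y)) :=
  LinearMap.range (mfderiv I (𝓡 n) f y).toLinearMap

variable (I) in
/-- The normal space `ν_y`, the orthogonal complement of the tangent space. -/
def normalSub (f : Y → M) (y : Y) : Submodule ℝ (TangentSpace (𝓡 n) (f y)) :=
  (tangentSub I f y)ᗮ

variable (I) in
/-- The orthogonal projection onto the tangent space of the submanifold. -/
def projTan (f : Y → M) (y : Y) (z : TangentSpace (𝓡 n) (f y)) : TangentSpace (𝓡 n) (f y) :=
  orthoProj (V := TangentSpace (𝓡 n) (f y)) (tangentSub I f y) z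

variable (I) in
/-- The orthogonal projection `π_ν` onto the normal space. -/
def projNor (f : Y → M) (y : Y) (z : TangentSpace (𝓡 n) (f y)) : TangentSpace (𝓡 n) (f y) :=
  orthoProj (V := TangentSpace (𝓡 n) (f y)) (normalSub I f y) z

theorem exists_tangentPart (f : Y → M) (y : Y) (z : TangentSpace (𝓡 n) (f y)) :
    ∃ v : TangentSpace I y, mfderiv I (𝓡 n) f y v = projTan I f y z :=
  LinearMap.mem_range.1 (orthoProj_mem (V := TangentSpace (𝓡 n) (f y)) (tangentSub I f y) z)

variable (I) in
/-- The tangential part of `z` as an element of `T_y Y` (for an immersion `f`): the vector whose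
image under `df` is the orthogonal projection of `z` to the tangent space. -/
def tangentPart (f : Y → M) (y : Y) (z : TangentSpace (𝓡 n) (f y)) : TangentSpace I y :=
  (exists_tangentPart f y z).choose

theorem mfderiv_tangentPart (f : Y → M) (y : Y) (z : TangentSpace (𝓡 n) (f y)) :
    mfderiv I (𝓡 n) f y (tangentPart I f y z) = projTan I f y z :=
  (exists_tangentPart f y z).choose_spec

variable (I) in
/-- `ψ` is a smooth section of the normal bundle, `ψ ∈ Γ(Y, ν)`. -/
def IsNormalSection (f : Y → M) (ψ : ∀ y : Y, TangentSpace (𝓡 n) (f y)) : Prop :=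
  (∀ y, ψ y ∈ normalSub I f y) ∧ IsSmoothAlong I f ψ

variable (I) in
/-- The trace over `T_y Y`, for the induced metric, of a bilinear map `B` on `T_y Y`:
`∑ᵢ B(eᵢ, eᵢ)` for an orthonormal basis `(eᵢ)` of `T_y Y` (which does not depend on its choice). -/
def traceTan (f : Y → M) (y : Y)
    (B : TangentSpace I y → TangentSpace I y → TangentSpace (𝓡 n) (f y)) :
    TangentSpace (𝓡 n) (f y) :=
  frameSum (V := TangentSpace (𝓡 n) (f y)) (tangentSub I f y) fun e =>
    B (tangentPart I f y e) (tangentPart I f y e)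

variable (I) in
/-- The normal connection `∇^⊥_v ψ = π_ν ∇_v ψ`. -/
def normalDeriv (f : Y → M) (ψ : ∀ y : Y, TangentSpace (𝓡 n) (f y)) (y : Y)
    (v : TangentSpace I y) : TangentSpace (𝓡 n) (f y) :=
  projNor I f y (covDeriv I f ψ y v)

/-- `∇^⊤_v w` on `Y`: the tangential part of the ambient covariant derivative of `w`. -/
def tangentDeriv (f : Y → M) (w : ∀ y : Y, TangentSpace I y) (y : Y) (v : TangentSpace I y) :
    TangentSpace I y :=
  tangentPart I f y (covDeriv I f (fun y' => mfderiv I (𝓡 n) f y' (w y')) y v)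

/-- The second derivative `∇^{⊥2}_{v,w} ψ = ∇^⊥_v ∇^⊥_w ψ - ∇^⊥_{∇^⊤_v w} ψ` for vector fields
`v, w` on `Y`. -/
def normalHessian (f : Y → M) (v w : ∀ y : Y, TangentSpace I y)
    (ψ : ∀ y : Y, TangentSpace (𝓡 n) (f y)) (y : Y) : TangentSpace (𝓡 n) (f y) :=
  normalDeriv I f (fun y' => normalDeriv I f ψ y' (w y')) y (v y)
    - normalDeriv I f ψ y (tangentDeriv (n := n) f w y (v y))

variable (I) in
/-- `∇^{⊥*}∇^⊥ = - trace ∇^{⊥2}`. As `∇^{⊥2}_{v,w}` is tensorial in `v` and `w`, tangent vectors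
are extended to vector fields, smooth near `y`, by constant components in the chart around `y`. -/
def connLaplacian (f : Y → M) (ψ : ∀ y : Y, TangentSpace (𝓡 n) (f y)) (y : Y) :
    TangentSpace (𝓡 n) (f y) :=
  -traceTan I f y fun v w =>
    normalHessian f (FiberBundle.extend (Eu 3) v) (FiberBundle.extend (Eu 3) w) ψ y

variable (I) in
/-- The partial Ricci operator `ℛ(ψ) = π_ν ∑ᵢ R(eᵢ, ψ) eᵢ`. -/
def partialRicci (f : Y → M) (ψ : ∀ y : Y, TangentSpace (𝓡 n) (f y)) (y : Y) :
    TangentSpace (𝓡 n) (f y) :=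
  projNor I f y (traceTan I f y fun v w =>
    curvature (f y) (mfderiv I (𝓡 n) f y v) (ψ y) (mfderiv I (𝓡 n) f y w))

variable (I) in
/-- A local section of the normal bundle, smooth near `y`, with the value `η` at `y` if `η` is
normal: the normal projection of the extension of `η` by constant chart components. -/
def normalExtend (f : Y → M) (y : Y) (η : TangentSpace (𝓡 n) (f y)) (y' : Y) :
    TangentSpace (𝓡 n) (f y') :=
  projNor I f y' (fromCoords (f y) (f y') (toCoords (f y) (f y) η))

variable (I) in
/-- The second fundamental form `A(η)(u) = -∇^⊤_u η` for `η ∈ ν_y` and `u ∈ T_y Y`, as an element of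
`T_y Y`. It is tensorial in `η`, which is extended to a local section of the normal bundle. -/
def shape (f : Y → M) (y : Y) (η : TangentSpace (𝓡 n) (f y)) (u : TangentSpace I y) :
    TangentSpace I y :=
  -tangentPart I f y (covDeriv I f (normalExtend I f y η) y u)

/-- The inner product `⟨S, T⟩ = ∑ᵢ ⟨S eᵢ, T eᵢ⟩` of endomorphisms of `T_y Y`, for an orthonormal
basis `(eᵢ)` of `T_y Y` with the induced metric. -/
def endInner (f : Y → M) (y : Y) (S T : TangentSpace I y → TangentSpace I y) : ℝ :=
  frameSum (V := TangentSpace (𝓡 n) (f y)) (tangentSub I f y) fun e =>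
    inner ℝ (mfderiv I (𝓡 n) f y (S (tangentPart I f y e)))
      (mfderiv I (𝓡 n) f y (T (tangentPart I f y e)))

/-- The transpose `Aᵗ` of `A : ν_y → S_y Y`: `Aᵗ(S) = ∑ₖ ⟨S, A(ηₖ)⟩ ηₖ` for an orthonormal basis
`(ηₖ)` of `ν_y`, so that `⟨Aᵗ(S), η⟩ = ⟨S, A(η)⟩`. -/
def shapeTranspose (f : Y → M) (y : Y) (S : TangentSpace I y → TangentSpace I y) :
    TangentSpace (𝓡 n) (f y) :=
  frameSum (V := TangentSpace (𝓡 n) (f y)) (normalSub I f y) fun η =>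
    endInner (n := n) f y S (shape I f y η) • η

variable (I) in
/-- Simons' operator `𝒜 = Aᵗ ∘ A`. -/
def simonsOp (f : Y → M) (ψ : ∀ y : Y, TangentSpace (𝓡 n) (f y)) (y : Y) :
    TangentSpace (𝓡 n) (f y) :=
  shapeTranspose f y (shape I f y (ψ y))

end Submanifold

/-! ### Associative submanifolds and the deformation operator -/

section Associative

variable {H : Type*} [TopologicalSpace H] {I : ModelWithCorners ℝ (Eu 3) H}
  {Y : Type*} [TopologicalSpace Y] [ChartedSpace H Y] [IsManifold I ∞ Y]
  {M : Type*} [TopologicalSpace M] [ChartedSpace (Eu 7) M] [IsManifold (𝓡 7) ∞ M]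
  [RiemannianBundle (fun x : M => TangentSpace (𝓡 7) x)]

variable (I) in
/-- `f : Y → M` is an (immersed) associative submanifold: a smooth immersion of a `3`-manifold
such that the tangent spaces of its image are stable under the vector product. -/
def IsAssociative (φ : ∀ x : M, TangentSpace (𝓡 7) x [⋀^Fin 3]→ₗ[ℝ] ℝ) (f : Y → M) : Prop :=
  ContMDiff I (𝓡 7) ∞ f ∧ (∀ y, Function.Injective (mfderiv I (𝓡 7) f y)) ∧
    ∀ (y : Y) (u v : TangentSpace (𝓡 7) (f y)), u ∈ tangentSub I f y → v ∈ tangentSub I f y →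
      cross φ (f y) u v ∈ tangentSub I f y

variable (I) in
/-- The operator `D ψ = ∑ᵢ eᵢ × ∇^⊥_{eᵢ} ψ`. -/
def diracOp (φ : ∀ x : M, TangentSpace (𝓡 7) x [⋀^Fin 3]→ₗ[ℝ] ℝ) (f : Y → M)
    (ψ : ∀ y : Y, TangentSpace (𝓡 7) (f y)) (y : Y) : TangentSpace (𝓡 7) (f y) :=
  traceTan I f y fun v w => cross φ (f y) (mfderiv I (𝓡 7) f y v) (normalDeriv I f ψ y w)

end Associative

end AssociativeSubmanifold

end

/-!
The formula is a Weitzenböck formula, and it is proved pointwise. At a point `y₀`, choose an oriented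
orthonormal basis of the tangent space and extend it to vector fields `f₀, f₁, f₂` with constant
components in a chart of `Y`. These fields commute but are orthonormal at `y₀` only, so away from
`y₀` traces are taken with the inverse Gram matrix. Its derivatives cancel against the tangential
derivatives of the `fᵢ` (`AssociativeGerm.proj_cov_dirac`), and at `y₀` the operator `D²` is the sum
of `fₗ × (fᵢ × H(l, i))` over all `l, i`, where `H` is the normal Hessian of `ψ`.

By the identity `a × (a × b) = ⟨a, b⟩ a - ⟨a, a⟩ b` (`cross_cross`), tangent vectors act on normal
vectors by Clifford multiplication. The symmetric part of `H` therefore contributes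
`∇^{⊥*}∇^⊥ ψ`. The skew part `H(l, i) - H(i, l)` is the normal curvature, which by the Ricci equation
is `π_ν R(fₗ, fᵢ)ψ` plus terms quadratic in the second fundamental form `B`.

* The product is parallel, hence `R` acts on it by derivations (`IsParallelCross.curvature_cross`).
  With the first Bianchi identity this turns the curvature terms into the partial Ricci operator.
* Differentiating the condition that the tangent spaces are stable under the product gives
  `∑ₘ ⟨fₘ, fₖ × fᵢ⟩ B(l, m) = B(l, k) × fᵢ + fₖ × B(l, i)`
  (`AssociativeGerm.sum_secondForm_cross`), and this turns the quadratic terms into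
  `-∑ ⟨ψ, B(i, j)⟩ B(i, j)`, the value of `-𝒜` on `ψ` (`simonsOp_eq`).

This part of the argument is `IsAssociativeFrame.sum_cross_cross_hessian` and
`AssociativeGerm.dirac_dirac`. It takes place in charts, for maps between vector spaces; derivatives
are taken within the range of the model with corners, so that boundary points need no separate
treatment. Some care is needed since the covariant derivative along `f` and the condition `∇φ = 0`
refer, at each point, to the chart centred there. They have the same expression in any other
chart by the transformation law of the Christoffel symbols, which follows from the uniqueness of the
Levi-Civita connection in the form of the Koszul formula (`koszul_transform`,
`fderiv_cross_transform`, `covDeriv_chartField`).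
-/

noncomputable section

set_option linter.unusedSectionVars false
-- Needed for the instances on iterated spaces of continuous linear maps.
set_option maxSynthPendingDepth 3

namespace AssociativeSubmanifold

/-! ### The Koszul formula on a vector space -/

section Koszul

variable {n : ℕ}

theorem sum_smul_stdVec (a : Eu n) : ∑ i, a i • stdVec i = a := by
  ext j
  simp [stdVec, Finset.sum_apply, Pi.single_apply]

theorem stdVec_induction {P : Eu n → Prop} (hadd : ∀ a b, P a → P b → P (a + b))
    (hsmul : ∀ (r : ℝ) a, P a → P (r • a)) (h : ∀ i, P (stdVec i)) (h0 : P 0) (a : Eu n) : P a := by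
  rw [← sum_smul_stdVec a]
  exact Finset.sum_induction _ P hadd h0 fun i _ => hsmul _ _ (h i)

/-- The Koszul formula follows from its instances for the standard basis. -/
theorem koszul_of_stdVec (D : Eu n →L[ℝ] Eu n →L[ℝ] Eu n →L[ℝ] ℝ) (G : Eu n →L[ℝ] Eu n →L[ℝ] ℝ)
    (Γ : Eu n →L[ℝ] Eu n →L[ℝ] Eu n)
    (h : ∀ i j m, 2 * G (stdVec m) (Γ (stdVec i) (stdVec j)) = D (stdVec i) (stdVec j) (stdVec m)
      + D (stdVec j) (stdVec i) (stdVec m) - D (stdVec m) (stdVec i) (stdVec j)) (a b c : Eu n) :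
    2 * G c (Γ a b) = D a b c + D b a c - D c a b := by
  induction a using stdVec_induction with
  | h0 => simp
  | hadd a a' h h' => simp only [map_add, add_apply] at *; linarith
  | hsmul r a h =>
    simp only [map_smul, smul_apply, smul_eq_mul] at *
    linear_combination r * h
  | h i =>
    induction b using stdVec_induction with
    | h0 => simp
    | hadd a a' h h' => simp only [map_add, add_apply] at *; linarith
    | hsmul r a h =>
      simp only [map_smul, smul_apply, smul_eq_mul] at *
      linear_combination r * h
    | h j =>
      induction c using stdVec_induction with
      | h0 => simp
      | hadd a a' h h' => simp only [map_add, add_apply] at *; linarith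
      | hsmul r a h =>
        simp only [map_smul, smul_apply, smul_eq_mul] at *
        linear_combination r * h
      | h m => exact h i j m

variable {V W : Type*} [NormedAddCommGroup V] [NormedSpace ℝ V] [NormedAddCommGroup W]
  [NormedSpace ℝ W]

theorem fderiv_bilin_apply {G : V → V →L[ℝ] V →L[ℝ] W} {u : V} (hG : DifferentiableAt ℝ G u)
    (a b c : V) : fderiv ℝ (fun v => G v b c) u a = fderiv ℝ G u a b c := by
  have h := (hG.hasFDerivAt.clm_apply (hasFDerivAt_const b u)).clm_apply (hasFDerivAt_const c u)
  rw [h.fderiv]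
  simp

theorem eq_of_forall_bilin_eq {G : V →L[ℝ] V →L[ℝ] ℝ} (hpos : ∀ a, a ≠ 0 → 0 < G a a) {a b : V}
    (h : ∀ c, G c a = G c b) : a = b := by
  by_contra hne
  have := hpos (a - b) (sub_ne_zero.2 hne)
  rw [map_sub, h, sub_self] at this
  exact lt_irrefl _ this

/-- The Koszul connection is torsion-free. -/
theorem koszul_symm {D : V →L[ℝ] V →L[ℝ] V →L[ℝ] ℝ} {G : V →L[ℝ] V →L[ℝ] ℝ}
    {Γ : V →L[ℝ] V →L[ℝ] V} (hpos : ∀ a, a ≠ 0 → 0 < G a a) (hD : ∀ a b c, D a b c = D a c b)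
    (hK : ∀ a b c, 2 * G c (Γ a b) = D a b c + D b a c - D c a b) (a b : V) : Γ a b = Γ b a := by
  refine eq_of_forall_bilin_eq hpos fun c => ?_
  linarith [hK a b c, hK b a c, hD c a b]

/-- The Koszul connection is metric. -/
theorem koszul_metric {D : V →L[ℝ] V →L[ℝ] V →L[ℝ] ℝ} {G : V →L[ℝ] V →L[ℝ] ℝ}
    {Γ : V →L[ℝ] V →L[ℝ] V} (hG : ∀ a b, G a b = G b a) (hD : ∀ a b c, D a b c = D a c b)
    (hK : ∀ a b c, 2 * G c (Γ a b) = D a b c + D b a c - D c a b) (v a b : V) :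
    D v a b = G (Γ v a) b + G a (Γ v b) := by
  rw [hG (Γ v a) b]
  linarith [hK v a b, hK v b a, hD v a b, hD b a v, hD a v b, hD b v a]

/-- The transformation law of the Christoffel symbols under an isometric change of coordinates
`τ`: both sides are determined by the respective Koszul formulas. -/
theorem koszul_transform {G₀ : V → V →L[ℝ] V →L[ℝ] ℝ} {G₁ : W → W →L[ℝ] W →L[ℝ] ℝ} {τ : V → W}
    {u : V} {Γ₀ : V →L[ℝ] V →L[ℝ] V} {Γ₁ : W →L[ℝ] W →L[ℝ] W}
    (hτ : ContDiffAt ℝ 2 τ u) (hsurj : Function.Surjective (fderiv ℝ τ u))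
    (hG₀ : DifferentiableAt ℝ G₀ u) (hG₁ : DifferentiableAt ℝ G₁ (τ u))
    (hsymm : ∀ a b, G₁ (τ u) a b = G₁ (τ u) b a) (hpos : ∀ a, a ≠ 0 → 0 < G₁ (τ u) a a)
    (hG : ∀ᶠ v in nhds u, ∀ a b, G₀ v a b = G₁ (τ v) (fderiv ℝ τ v a) (fderiv ℝ τ v b))
    (hK₀ : ∀ a b c, 2 * G₀ u c (Γ₀ a b)
      = fderiv ℝ G₀ u a b c + fderiv ℝ G₀ u b a c - fderiv ℝ G₀ u c a b)
    (hK₁ : ∀ a b c, 2 * G₁ (τ u) c (Γ₁ a b)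
      = fderiv ℝ G₁ (τ u) a b c + fderiv ℝ G₁ (τ u) b a c - fderiv ℝ G₁ (τ u) c a b) (a b : V) :
    fderiv ℝ τ u (Γ₀ a b)
      = fderiv ℝ (fderiv ℝ τ) u a b + Γ₁ (fderiv ℝ τ u a) (fderiv ℝ τ u b) := by
  have hτ1 : DifferentiableAt ℝ τ u := hτ.differentiableAt (by simp)
  have hτ2 : DifferentiableAt ℝ (fderiv ℝ τ) u :=
    (hτ.fderiv_right (m := 1) (by norm_num)).differentiableAt (by simp)
  -- The derivative of `G₀ = τ^* G₁`, by the chain rule.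
  have hD : ∀ a b c, fderiv ℝ G₀ u a b c
      = fderiv ℝ G₁ (τ u) (fderiv ℝ τ u a) (fderiv ℝ τ u b) (fderiv ℝ τ u c)
        + G₁ (τ u) (fderiv ℝ (fderiv ℝ τ) u a b) (fderiv ℝ τ u c)
        + G₁ (τ u) (fderiv ℝ τ u b) (fderiv ℝ (fderiv ℝ τ) u a c) := by
    intro a b c
    rw [← fderiv_bilin_apply hG₀]
    have e : (fun v => G₀ v b c) =ᶠ[nhds u]
        fun v => G₁ (τ v) (fderiv ℝ τ v b) (fderiv ℝ τ v c) := by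
      filter_upwards [hG] with v hv using hv b c
    have h := ((hG₁.hasFDerivAt.comp u hτ1.hasFDerivAt).clm_apply
      (hτ2.hasFDerivAt.clm_apply (hasFDerivAt_const b u))).clm_apply
      (hτ2.hasFDerivAt.clm_apply (hasFDerivAt_const c u))
    rw [e.fderiv_eq]
    refine (DFunLike.congr_fun h.fderiv a).trans ?_
    simp
    ring
  have hsym2 : ∀ a b, fderiv ℝ (fderiv ℝ τ) u a b = fderiv ℝ (fderiv ℝ τ) u b a := fun a b =>
    (hτ.isSymmSndFDerivAt (by simp)).eq a b
  -- Since `dτ` is onto, it suffices to compare the scalar products with the vectors `dτ(c)`.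
  refine eq_of_forall_bilin_eq hpos fun c => ?_
  obtain ⟨c, rfl⟩ := hsurj c
  have h0 := hK₀ a b c
  rw [hD, hD, hD, hG.self_of_nhds] at h0
  rw [map_add]
  have h1 := hK₁ (fderiv ℝ τ u a) (fderiv ℝ τ u b) (fderiv ℝ τ u c)
  rw [hsym2 b a, hsym2 c a, hsym2 c b] at h0
  have e1 := hsymm (fderiv ℝ τ u a) (fderiv ℝ (fderiv ℝ τ) u b c)
  have e2 := hsymm (fderiv ℝ (fderiv ℝ τ) u a b) (fderiv ℝ τ u c)
  have e3 := hsymm (fderiv ℝ (fderiv ℝ τ) u a c) (fderiv ℝ τ u b)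
  linarith

end Koszul

/-! ### The Levi-Civita connection in charts -/

section Chart

variable {n : ℕ} {M : Type*} [TopologicalSpace M] [ChartedSpace (Eu n) M] [IsManifold (𝓡 n) ∞ M]

theorem toCoords_fromCoords {x₀ x : M} (hx : x ∈ (extChartAt (𝓡 n) x₀).source) (a : Eu n) :
    toCoords x₀ x (fromCoords x₀ x a) = a := by
  have h : x ∈ (trivializationAt (Eu n) (TangentSpace (𝓡 n) : M → Type _) x₀).baseSet := by
    simpa using hx
  exact Trivialization.continuousLinearMapAt_symmL _ h a

theorem fromCoords_toCoords {x₀ x : M} (hx : x ∈ (extChartAt (𝓡 n) x₀).source)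
    (v : TangentSpace (𝓡 n) x) : fromCoords x₀ x (toCoords x₀ x v) = v := by
  have h : x ∈ (trivializationAt (Eu n) (TangentSpace (𝓡 n) : M → Type _) x₀).baseSet := by
    simpa using hx
  exact Trivialization.symmL_continuousLinearMapAt _ h v

theorem fromCoords_injective {x₀ x : M} (hx : x ∈ (extChartAt (𝓡 n) x₀).source) :
    Function.Injective (fromCoords x₀ x : Eu n →L[ℝ] TangentSpace (𝓡 n) x) :=
  Function.LeftInverse.injective (g := toCoords x₀ x) (toCoords_fromCoords hx)

/-- Vector fields with constant components in a chart are smooth on its domain. -/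
theorem contMDiffOn_fromCoords (x₀ : M) (a : Eu n) : ContMDiffOn (𝓡 n) (𝓡 n).tangent ∞
    (fun x => (⟨x, fromCoords x₀ x a⟩ : TangentBundle (𝓡 n) M)) (extChartAt (𝓡 n) x₀).source := by
  have hs : (extChartAt (𝓡 n) x₀).source =
      (trivializationAt (Eu n) (TangentSpace (𝓡 n) : M → Type _) x₀).baseSet := by simp
  rw [hs]
  refine (Bundle.Trivialization.contMDiffOn_section_baseSet_iff
    (trivializationAt (Eu n) (TangentSpace (𝓡 n) : M → Type _) x₀)).2 ?_
  refine (contMDiffOn_const (c := a)).congr fun x hx => ?_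
  have := toCoords_fromCoords (x₀ := x₀) (x := x) (by rw [hs]; exact hx) a
  rw [toCoords, Trivialization.continuousLinearMapAt_apply,
    Trivialization.linearMapAt_apply, if_pos hx] at this
  exact this

/-- The transition map from the chart around `x₀` to the chart around `x₁`. -/
def transition (x₀ x₁ : M) : Eu n → Eu n := extChartAt (𝓡 n) x₁ ∘ (extChartAt (𝓡 n) x₀).symm

/-- The domain of the transition map between two charts. -/
def transitionDomain (x₀ x₁ : M) : Set (Eu n) :=
  (extChartAt (𝓡 n) x₀).target ∩
    (extChartAt (𝓡 n) x₀).symm ⁻¹' (extChartAt (𝓡 n) x₁).source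

theorem isOpen_transitionDomain (x₀ x₁ : M) :
    IsOpen (transitionDomain x₀ x₁ : Set (Eu n)) :=
  (continuousOn_extChartAt_symm x₀).isOpen_inter_preimage (isOpen_extChartAt_target x₀)
    (isOpen_extChartAt_source x₁)

theorem contDiffOn_transition (x₀ x₁ : M) :
    ContDiffOn ℝ ∞ (transition x₀ x₁) (transitionDomain x₀ x₁ : Set (Eu n)) := by
  have := contDiffOn_ext_coord_change (I := 𝓡 n) (n := ∞) x₁ x₀
  rwa [PartialEquiv.trans_source] at this

/-- Components of tangent vectors transform by the differential of the transition map. -/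
theorem toCoords_fromCoords_eq_fderiv {x₀ x₁ : M} {u : Eu n}
    (hu : u ∈ transitionDomain x₀ x₁) (a : Eu n) :
    toCoords x₁ ((extChartAt (𝓡 n) x₀).symm u) (fromCoords x₀ ((extChartAt (𝓡 n) x₀).symm u) a)
      = fderiv ℝ (transition x₀ x₁) u a := by
  set x := (extChartAt (𝓡 n) x₀).symm u with hx
  have h0 : x ∈ (extChartAt (𝓡 n) x₀).source := (extChartAt (𝓡 n) x₀).map_target hu.1
  have h1 : x ∈ (extChartAt (𝓡 n) x₁).source := hu.2
  have hux : extChartAt (𝓡 n) x₀ x = u := (extChartAt (𝓡 n) x₀).right_inv hu.1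
  have h2 := hasFDerivWithinAt_tangentCoordChange (I := 𝓡 n) ⟨h0, h1⟩
  rw [hux] at h2
  simp only [modelWithCornersSelf_coe, Set.range_id, hasFDerivWithinAt_univ] at h2
  rw [transition, h2.fderiv, toCoords, fromCoords,
    TangentBundle.continuousLinearMapAt_trivializationAt_eq_core (by simpa using h1),
    TangentBundle.symmL_trivializationAt_eq_core (by simpa using h0)]
  exact tangentCoordChange_comp (I := 𝓡 n) ⟨⟨h0, mem_extChartAt_source x⟩, h1⟩

variable [RiemannianBundle (fun x : M => TangentSpace (𝓡 n) x)]

/-- The metric in the chart around `x₀`, as a bilinear form depending on the chart point. -/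
def chartMetric (x₀ : M) (u : Eu n) : Eu n →L[ℝ] Eu n →L[ℝ] ℝ :=
  (innerSL ℝ (E := TangentSpace (𝓡 n) ((extChartAt (𝓡 n) x₀).symm u))).bilinearComp
    (fromCoords x₀ ((extChartAt (𝓡 n) x₀).symm u)) (fromCoords x₀ ((extChartAt (𝓡 n) x₀).symm u))

theorem chartMetric_apply (x₀ : M) (u a b : Eu n) :
    chartMetric x₀ u a b = inner ℝ (fromCoords x₀ ((extChartAt (𝓡 n) x₀).symm u) a)
      (fromCoords x₀ ((extChartAt (𝓡 n) x₀).symm u) b) := rfl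

theorem metricCoeff_eq (x₀ : M) (i j : Fin n) (u : Eu n) :
    metricCoeff x₀ i j u = chartMetric x₀ u (stdVec i) (stdVec j) := rfl

theorem chartMetric_symm (x₀ : M) (u a b : Eu n) : chartMetric x₀ u a b = chartMetric x₀ u b a := by
  simp only [chartMetric_apply]; exact real_inner_comm _ _

theorem chartMetric_pos {x₀ : M} {u : Eu n} (hu : u ∈ (extChartAt (𝓡 n) x₀).target) {a : Eu n}
    (ha : a ≠ 0) : 0 < chartMetric x₀ u a a := by
  rw [chartMetric_apply, real_inner_self_pos]
  intro h
  exact ha (fromCoords_injective ((extChartAt (𝓡 n) x₀).map_target hu) (by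
    simpa only [map_zero] using h))

variable [IsContMDiffRiemannianBundle (𝓡 n) ∞ (Eu n) (fun x : M => TangentSpace (𝓡 n) x)]

theorem contDiffOn_chartMetric (x₀ : M) :
    ContDiffOn ℝ ∞ (chartMetric x₀) (extChartAt (𝓡 n) x₀).target := by
  rw [contDiffOn_clm_apply]
  intro a
  rw [contDiffOn_clm_apply]
  intro b
  have h := (contMDiffOn_fromCoords x₀ a).inner_bundle (contMDiffOn_fromCoords x₀ b)
  have h2 := h.comp (contMDiffOn_extChartAt_symm x₀)
    (fun u hu => (extChartAt (𝓡 n) x₀).map_target hu)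
  exact contMDiffOn_iff_contDiffOn.1 h2

/-- The metric in two charts: the transition map is an isometry. -/
theorem chartMetric_eq_transition {x₀ x₁ : M} {u : Eu n} (hu : u ∈ transitionDomain x₀ x₁)
    (a b : Eu n) : chartMetric x₀ u a b = chartMetric x₁ (transition x₀ x₁ u)
      (fderiv ℝ (transition x₀ x₁) u a) (fderiv ℝ (transition x₀ x₁) u b) := by
  have h1 : (extChartAt (𝓡 n) x₁).symm (transition x₀ x₁ u) = (extChartAt (𝓡 n) x₀).symm u :=
    (extChartAt (𝓡 n) x₁).left_inv hu.2
  rw [chartMetric_apply, chartMetric_apply, h1, ← toCoords_fromCoords_eq_fderiv hu,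
    ← toCoords_fromCoords_eq_fderiv hu, fromCoords_toCoords hu.2, fromCoords_toCoords hu.2]

/-- The Christoffel symbols in the chart around `x₀`, as a bilinear map depending on the chart
point. -/
def chartChristoffel (x₀ : M) (u : Eu n) : Eu n →L[ℝ] Eu n →L[ℝ] Eu n :=
  ∑ k, ∑ i, ∑ j, christoffel x₀ k i j u •
    (EuclideanSpace.proj (𝕜 := ℝ) i).smulRight
      ((EuclideanSpace.proj (𝕜 := ℝ) j).smulRight (stdVec k))

theorem chartChristoffel_apply (x₀ : M) (u a b : Eu n) :
    chartChristoffel x₀ u a b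
      = ∑ k, (∑ i, ∑ j, christoffel x₀ k i j u * a i * b j) • stdVec k := by
  simp [chartChristoffel, Finset.sum_smul, smul_smul, mul_assoc]

theorem christoffelVec_eq (x : M) (a b : Eu n) :
    christoffelVec x a b = chartChristoffel x (extChartAt (𝓡 n) x x) a b :=
  (chartChristoffel_apply _ _ _ _).symm

theorem metricCoeff_matrix_isUnit {x₀ : M} {u : Eu n} (hu : u ∈ (extChartAt (𝓡 n) x₀).target) :
    IsUnit (Matrix.of fun k l => metricCoeff x₀ k l u).det := by
  rw [isUnit_iff_ne_zero]
  intro h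
  obtain ⟨v, hv, hv0⟩ := Matrix.exists_mulVec_eq_zero_iff.2 h
  have ha : (WithLp.toLp 2 v : Eu n) ≠ 0 := by
    intro h; apply hv; ext i; exact congrArg (fun w : Eu n => w i) h
  have := chartMetric_pos hu ha
  have e : chartMetric x₀ u (∑ i, v i • stdVec i) (∑ i, v i • stdVec i)
      = v ⬝ᵥ (Matrix.of fun k l => metricCoeff x₀ k l u).mulVec v := by
    simp only [map_sum, map_smul, sum_apply, smul_apply, smul_eq_mul, dotProduct, Matrix.mulVec,
      Matrix.of_apply, metricCoeff_eq, Finset.mul_sum]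
    refine Finset.sum_congr rfl fun i _ => Finset.sum_congr rfl fun j _ => ?_
    rw [chartMetric_symm]; ring
  have hs := sum_smul_stdVec (WithLp.toLp 2 v : Eu n)
  simp only at hs
  rw [hs] at e
  rw [e, hv0] at this
  simp at this

/-- The defining formula of the Christoffel symbols, with the inverse metric moved to the left. -/
theorem chartMetric_stdVec_chartChristoffel {x₀ : M} {u : Eu n}
    (hu : u ∈ (extChartAt (𝓡 n) x₀).target) (i j m : Fin n) :
    2 * chartMetric x₀ u (stdVec m) (chartChristoffel x₀ u (stdVec i) (stdVec j)) =
      (partialDeriv i (metricCoeff x₀ j m) u + partialDeriv j (metricCoeff x₀ i m) u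
      - partialDeriv m (metricCoeff x₀ i j) u) := by
  set A : Matrix (Fin n) (Fin n) ℝ := Matrix.of fun k l => metricCoeff x₀ k l u with hA
  set w : Fin n → ℝ := fun l => partialDeriv i (metricCoeff x₀ j l) u
    + partialDeriv j (metricCoeff x₀ i l) u - partialDeriv l (metricCoeff x₀ i j) u
  have h1 : chartChristoffel x₀ u (stdVec i) (stdVec j)
      = ∑ k, ((1 / 2 : ℝ) * (A⁻¹.mulVec w) k) • stdVec k := by
    rw [chartChristoffel_apply]
    refine Finset.sum_congr rfl fun k _ => ?_
    congr 1
    simp [stdVec, christoffel, Matrix.mulVec, dotProduct, metricInv, w, hA]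
  have h2 : A.mulVec (A⁻¹.mulVec w) = w := by
    rw [Matrix.mulVec_mulVec, Matrix.mul_nonsing_inv A (metricCoeff_matrix_isUnit hu),
      Matrix.one_mulVec]
  have h3 := congrFun h2 m
  rw [h1]
  simp only [map_sum, map_smul, smul_eq_mul, ← metricCoeff_eq]
  change _ = w m
  rw [← h3, Matrix.mulVec, dotProduct, Finset.mul_sum]
  exact Finset.sum_congr rfl fun k _ => by simp only [hA, Matrix.of_apply]; ring

theorem partialDeriv_metricCoeff {x₀ : M} {u : Eu n}
    (hu : u ∈ (extChartAt (𝓡 n) x₀).target) (i j l : Fin n) :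
    partialDeriv i (metricCoeff x₀ j l) u
      = fderiv ℝ (chartMetric x₀) u (stdVec i) (stdVec j) (stdVec l) := by
  have hd : DifferentiableAt ℝ (chartMetric x₀) u :=
    ((contDiffOn_chartMetric x₀).contDiffAt ((isOpen_extChartAt_target x₀).mem_nhds hu)
      ).differentiableAt (by simp)
  exact fderiv_bilin_apply hd _ _ _

/-- The Koszul formula in a chart. -/
theorem koszul_chart {x₀ : M} {u : Eu n} (hu : u ∈ (extChartAt (𝓡 n) x₀).target) (a b c : Eu n) :
    2 * chartMetric x₀ u c (chartChristoffel x₀ u a b) =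
      fderiv ℝ (chartMetric x₀) u a b c + fderiv ℝ (chartMetric x₀) u b a c
        - fderiv ℝ (chartMetric x₀) u c a b := by
  refine koszul_of_stdVec _ _ _ (fun i j m => ?_) a b c
  rw [chartMetric_stdVec_chartChristoffel hu, partialDeriv_metricCoeff hu,
    partialDeriv_metricCoeff hu, partialDeriv_metricCoeff hu]

theorem contDiffOn_metricCoeff (x₀ : M) (i j : Fin n) :
    ContDiffOn ℝ ∞ (metricCoeff x₀ i j) (extChartAt (𝓡 n) x₀).target :=
  ((contDiffOn_chartMetric x₀).clm_apply contDiffOn_const).clm_apply contDiffOn_const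

theorem differentiableAt_chartMetric {x₀ : M} {u : Eu n}
    (hu : u ∈ (extChartAt (𝓡 n) x₀).target) : DifferentiableAt ℝ (chartMetric x₀) u :=
  ((contDiffOn_chartMetric x₀).contDiffAt ((isOpen_extChartAt_target x₀).mem_nhds hu)
    ).differentiableAt (by simp)

theorem fderiv_chartMetric_symm {x₀ : M} {u : Eu n} (hu : u ∈ (extChartAt (𝓡 n) x₀).target)
    (a b c : Eu n) :
    fderiv ℝ (chartMetric x₀) u a b c = fderiv ℝ (chartMetric x₀) u a c b := by
  rw [← fderiv_bilin_apply (differentiableAt_chartMetric hu),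
    ← fderiv_bilin_apply (differentiableAt_chartMetric hu)]
  simp only [fun v => chartMetric_symm x₀ v b c]

/-- The connection of a chart is torsion-free. -/
theorem chartChristoffel_symm {x₀ : M} {u : Eu n} (hu : u ∈ (extChartAt (𝓡 n) x₀).target)
    (a b : Eu n) : chartChristoffel x₀ u a b = chartChristoffel x₀ u b a :=
  koszul_symm (fun _ h => chartMetric_pos hu h) (fderiv_chartMetric_symm hu) (koszul_chart hu) a b

/-- The connection of a chart is metric. -/
theorem fderiv_chartMetric {x₀ : M} {u : Eu n} (hu : u ∈ (extChartAt (𝓡 n) x₀).target)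
    (v a b : Eu n) : fderiv ℝ (chartMetric x₀) u v a b
      = chartMetric x₀ u (chartChristoffel x₀ u v a) b
        + chartMetric x₀ u a (chartChristoffel x₀ u v b) :=
  koszul_metric (chartMetric_symm x₀ u) (fderiv_chartMetric_symm hu) (koszul_chart hu) v a b

theorem contDiffWithinAt_matrix_inv {ι : Type*} [Fintype ι] [DecidableEq ι] {E : Type*}
    [NormedAddCommGroup E] [NormedSpace ℝ E] {s : Set E} {x : E} {A : E → Matrix ι ι ℝ}
    (hA : ∀ i j, ContDiffWithinAt ℝ ∞ (fun u => A u i j) s x) (hdet : (A x).det ≠ 0) (i j : ι) :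
    ContDiffWithinAt ℝ ∞ (fun u => (A u)⁻¹ i j) s x := by
  have hd : ∀ B : E → Matrix ι ι ℝ, (∀ i j, ContDiffWithinAt ℝ ∞ (fun u => B u i j) s x) →
      ContDiffWithinAt ℝ ∞ (fun u => (B u).det) s x := by
    intro B hB
    simp only [Matrix.det_apply]
    exact ContDiffWithinAt.sum fun σ _ =>
      (contDiffWithinAt_prod fun k _ => hB _ _).const_smul _
  simp only [Matrix.inv_def, Matrix.smul_apply, Ring.inverse_eq_inv', smul_eq_mul,
    Matrix.adjugate_apply]
  refine ((hd A hA).inv hdet).mul (hd _ fun k l => ?_)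
  by_cases hk : k = j
  · subst hk
    simpa using contDiffWithinAt_const
  · simpa [Matrix.updateRow_ne hk] using hA k l

theorem contDiffOn_metricInv (x₀ : M) (i j : Fin n) :
    ContDiffOn ℝ ∞ (metricInv x₀ i j) (extChartAt (𝓡 n) x₀).target :=
  fun u hu => contDiffWithinAt_matrix_inv (A := fun u => Matrix.of fun k l => metricCoeff x₀ k l u)
    (fun i j => contDiffOn_metricCoeff x₀ i j u hu) (metricCoeff_matrix_isUnit hu).ne_zero i j

theorem contDiffOn_partialDeriv {s : Set (Eu n)} (hs : IsOpen s) {h : Eu n → ℝ}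
    (hh : ContDiffOn ℝ ∞ h s) (i : Fin n) : ContDiffOn ℝ ∞ (partialDeriv i h) s :=
  (hh.fderiv_of_isOpen hs (by simp)).clm_apply contDiffOn_const

theorem contDiffOn_christoffel (x₀ : M) (k i j : Fin n) :
    ContDiffOn ℝ ∞ (christoffel x₀ k i j) (extChartAt (𝓡 n) x₀).target := by
  have hp := fun i j l => contDiffOn_partialDeriv (isOpen_extChartAt_target (I := 𝓡 n) x₀)
    (contDiffOn_metricCoeff x₀ j l) i
  exact contDiffOn_const.mul (ContDiffOn.sum fun l _ => (contDiffOn_metricInv x₀ k l).mul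
    (((hp i j l).add (hp j i l)).sub (hp l i j)))

theorem contDiffOn_chartChristoffel (x₀ : M) :
    ContDiffOn ℝ ∞ (chartChristoffel x₀) (extChartAt (𝓡 n) x₀).target :=
  ContDiffOn.sum fun k _ => ContDiffOn.sum fun i _ => ContDiffOn.sum fun j _ =>
    (contDiffOn_christoffel x₀ k i j).smul contDiffOn_const

theorem contDiffAt_transition {x₀ x₁ : M} {u : Eu n} (hu : u ∈ transitionDomain x₀ x₁) :
    ContDiffAt ℝ ∞ (transition x₀ x₁ : Eu n → Eu n) u :=
  (contDiffOn_transition x₀ x₁).contDiffAt ((isOpen_transitionDomain x₀ x₁).mem_nhds hu)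

theorem fderiv_transition_surjective {x₀ x₁ : M} {u : Eu n} (hu : u ∈ transitionDomain x₀ x₁) :
    Function.Surjective (fderiv ℝ (transition x₀ x₁ : Eu n → Eu n) u) := by
  intro b
  refine ⟨toCoords x₀ ((extChartAt (𝓡 n) x₀).symm u)
    (fromCoords x₁ ((extChartAt (𝓡 n) x₀).symm u) b), ?_⟩
  rw [← toCoords_fromCoords_eq_fderiv hu,
    fromCoords_toCoords ((extChartAt (𝓡 n) x₀).map_target hu.1), toCoords_fromCoords hu.2]

/-- The transformation law of the Christoffel symbols under a change of charts. -/
theorem fderiv_transition_chartChristoffel {x₀ x₁ : M} {u : Eu n}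
    (hu : u ∈ transitionDomain x₀ x₁) (a b : Eu n) :
    fderiv ℝ (transition x₀ x₁) u (chartChristoffel x₀ u a b)
      = fderiv ℝ (fderiv ℝ (transition x₀ x₁)) u a b
        + chartChristoffel x₁ (transition x₀ x₁ u) (fderiv ℝ (transition x₀ x₁) u a)
          (fderiv ℝ (transition x₀ x₁) u b) := by
  have h1 : transition x₀ x₁ u ∈ (extChartAt (𝓡 n) x₁).target :=
    (extChartAt (𝓡 n) x₁).map_source hu.2
  refine koszul_transform (G₀ := chartMetric x₀) (G₁ := chartMetric x₁)
    ((contDiffAt_transition hu).of_le (WithTop.coe_le_coe.2 le_top))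
    (fderiv_transition_surjective hu)
    (differentiableAt_chartMetric hu.1) (differentiableAt_chartMetric h1)
    (chartMetric_symm x₁ _) (fun _ h => chartMetric_pos h1 h) ?_ (koszul_chart hu.1)
    (koszul_chart h1) a b
  filter_upwards [(isOpen_transitionDomain x₀ x₁).mem_nhds hu] with v hv a b
  exact chartMetric_eq_transition hv a b

end Chart

/-! ### Parallel vector products on an open subset of a vector space -/

section ParallelCross

variable {E V W : Type*} [NormedAddCommGroup E] [NormedSpace ℝ E]
  [NormedAddCommGroup V] [NormedSpace ℝ V] [NormedAddCommGroup W] [NormedSpace ℝ W]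
  {X : Type*} [NormedAddCommGroup X] [NormedSpace ℝ X]

theorem two_le_infty : (2 : ℕ∞ω) ≤ ∞ := WithTop.coe_le_coe.2 le_top

theorem one_add_one_le_infty : (1 + 1 : ℕ∞ω) ≤ ∞ := one_add_one_eq_two (R := ℕ∞ω) ▸ two_le_infty

theorem fderivWithin_bilin {S : Set E} {e : E} {B : E → V →L[ℝ] W →L[ℝ] X} {P : E → V}
    {Q : E → W} (hB : DifferentiableWithinAt ℝ B S e) (hP : DifferentiableWithinAt ℝ P S e)
    (hQ : DifferentiableWithinAt ℝ Q S e) (hS : UniqueDiffWithinAt ℝ S e) (v : E) :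
    fderivWithin ℝ (fun x => B x (P x) (Q x)) S e v
      = fderivWithin ℝ B S e v (P e) (Q e) + B e (fderivWithin ℝ P S e v) (Q e)
        + B e (P e) (fderivWithin ℝ Q S e v) := by
  have h := (hB.hasFDerivWithinAt.clm_apply hP.hasFDerivWithinAt).clm_apply hQ.hasFDerivWithinAt
  rw [h.fderivWithin hS]
  simp only [add_apply, ContinuousLinearMap.comp_apply, ContinuousLinearMap.flip_apply]
  abel

theorem fderiv_bilin {e : E} {B : E → V →L[ℝ] W →L[ℝ] X} {P : E → V}
    {Q : E → W} (hB : DifferentiableAt ℝ B e) (hP : DifferentiableAt ℝ P e)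
    (hQ : DifferentiableAt ℝ Q e) (v : E) :
    fderiv ℝ (fun x => B x (P x) (Q x)) e v
      = fderiv ℝ B e v (P e) (Q e) + B e (fderiv ℝ P e v) (Q e)
        + B e (P e) (fderiv ℝ Q e v) := by
  simp only [← fderivWithin_univ, ← differentiableWithinAt_univ] at *
  exact fderivWithin_bilin hB hP hQ uniqueDiffWithinAt_univ v

/-- If the three-form `Φ(a, b, c) = ⟨a × b, c⟩` is parallel for a metric connection, then so is the
product. -/
theorem fderiv_cross_of_form {G : V → V →L[ℝ] V →L[ℝ] ℝ} {C : V → V →L[ℝ] V →L[ℝ] V} {u : V}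
    {Γ : V →L[ℝ] V →L[ℝ] V} (hG : DifferentiableAt ℝ G u) (hC : DifferentiableAt ℝ C u)
    (hsymm : ∀ a b, G u a b = G u b a) (hpos : ∀ a, a ≠ 0 → 0 < G u a a)
    (hmet : ∀ v a b, fderiv ℝ G u v a b = G u (Γ v a) b + G u a (Γ v b))
    (hpar : ∀ v a b c, fderiv ℝ (fun w => G w (C w a b) c) u v
      = G u (C u (Γ v a) b) c + G u (C u a (Γ v b)) c + G u (C u a b) (Γ v c)) (v a b : V) :
    fderiv ℝ C u v a b = C u (Γ v a) b + C u a (Γ v b) - Γ v (C u a b) := by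
  refine eq_of_forall_bilin_eq hpos fun c => ?_
  have hCab : DifferentiableAt ℝ (fun w => C w a b) u :=
    (hC.clm_apply (differentiableAt_const a)).clm_apply (differentiableAt_const b)
  have h := hpar v a b c
  rw [fderiv_bilin hG hCab (differentiableAt_const c), hmet, fderiv_bilin_apply hC] at h
  simp only [fderiv_fun_const, Pi.zero_apply, zero_apply, map_zero, add_zero] at h
  rw [map_sub, map_add, hsymm c, hsymm c, hsymm c, hsymm c]
  linarith

/-- The condition that a product is parallel does not depend on the coordinates. -/
theorem fderiv_cross_transform {C₀ : V → V →L[ℝ] V →L[ℝ] V} {C₁ : W → W →L[ℝ] W →L[ℝ] W}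
    {τ : V → W} {u : V} {Γ₀ : V →L[ℝ] V →L[ℝ] V} {Γ₁ : W →L[ℝ] W →L[ℝ] W}
    (hτ : ContDiffAt ℝ 2 τ u) (hinj : Function.Injective (fderiv ℝ τ u))
    (hC₀ : DifferentiableAt ℝ C₀ u) (hC₁ : DifferentiableAt ℝ C₁ (τ u))
    (hC : ∀ᶠ v in nhds u, ∀ a b,
      fderiv ℝ τ v (C₀ v a b) = C₁ (τ v) (fderiv ℝ τ v a) (fderiv ℝ τ v b))
    (hΓ : ∀ a b, fderiv ℝ τ u (Γ₀ a b)
      = fderiv ℝ (fderiv ℝ τ) u a b + Γ₁ (fderiv ℝ τ u a) (fderiv ℝ τ u b))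
    (hpar : ∀ v a b, fderiv ℝ C₁ (τ u) v a b
      = C₁ (τ u) (Γ₁ v a) b + C₁ (τ u) a (Γ₁ v b) - Γ₁ v (C₁ (τ u) a b)) (v a b : V) :
    fderiv ℝ C₀ u v a b = C₀ u (Γ₀ v a) b + C₀ u a (Γ₀ v b) - Γ₀ v (C₀ u a b) := by
  have hτ1 : DifferentiableAt ℝ τ u := hτ.differentiableAt (by simp)
  have hτ2 : DifferentiableAt ℝ (fderiv ℝ τ) u :=
    (hτ.fderiv_right (m := 1) (by norm_num)).differentiableAt (by simp)
  have hd : ∀ (a w : V), fderiv ℝ (fun v => fderiv ℝ τ v a) u w = fderiv ℝ (fderiv ℝ τ) u w a := by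
    intro a w
    rw [fderiv_clm_apply hτ2 (differentiableAt_const a)]
    simp
  have hda : ∀ a : V, DifferentiableAt ℝ (fun v => fderiv ℝ τ v a) u := fun a =>
    hτ2.clm_apply (differentiableAt_const a)
  have hCab : DifferentiableAt ℝ (fun w => C₀ w a b) u :=
    (hC₀.clm_apply (differentiableAt_const a)).clm_apply (differentiableAt_const b)
  have e : (fun v => fderiv ℝ τ v (C₀ v a b)) =ᶠ[nhds u]
      fun v => (C₁ ∘ τ) v (fderiv ℝ τ v a) (fderiv ℝ τ v b) := by
    filter_upwards [hC] with v hv using hv a b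
  have h := DFunLike.congr_fun (e.fderiv_eq (𝕜 := ℝ)) v
  have hC₁τ : DifferentiableAt ℝ (C₁ ∘ τ) u := hC₁.comp u hτ1
  rw [fderiv_bilin hC₁τ (hda a) (hda b), fderiv_clm_apply hτ2 hCab,
    fderiv_comp u hC₁ hτ1] at h
  simp only [add_apply, ContinuousLinearMap.comp_apply, ContinuousLinearMap.flip_apply, hd,
    Function.comp_apply, fderiv_bilin_apply hC₀, hpar] at h
  apply hinj
  have h0 := hC.self_of_nhds
  rw [map_sub, map_add, h0, h0, hΓ, hΓ, hΓ, h0, map_add, map_add, add_apply, ← sub_eq_zero]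
  rw [← sub_eq_zero] at h
  rw [← h]
  abel

/-- The curvature of the connection `d + Γ` on an open subset of a vector space. -/
def coordCurvature (Γ : V → V →L[ℝ] V →L[ℝ] V) (u a b c : V) : V :=
  fderiv ℝ Γ u a b c - fderiv ℝ Γ u b a c + (Γ u a (Γ u b c) - Γ u b (Γ u a c))

/-- A vector product which is parallel for the Levi-Civita connection `d + Γ` of a metric `G`, on
an open subset `Ω` of a vector space. -/
structure IsParallelCross (Ω : Set V) (G : V → V →L[ℝ] V →L[ℝ] ℝ)
    (Γ C : V → V →L[ℝ] V →L[ℝ] V) : Prop where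
  isOpen : IsOpen Ω
  contDiffOn_metric : ContDiffOn ℝ ∞ G Ω
  contDiffOn_conn : ContDiffOn ℝ ∞ Γ Ω
  contDiffOn_cross : ContDiffOn ℝ ∞ C Ω
  metric_symm : ∀ u ∈ Ω, ∀ a b, G u a b = G u b a
  metric_pos : ∀ u ∈ Ω, ∀ a, a ≠ 0 → 0 < G u a a
  fderiv_metric : ∀ u ∈ Ω, ∀ v a b, fderiv ℝ G u v a b = G u (Γ u v a) b + G u a (Γ u v b)
  conn_symm : ∀ u ∈ Ω, ∀ a b, Γ u a b = Γ u b a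
  cross_skew : ∀ u ∈ Ω, ∀ a b, C u a b = -C u b a
  metric_cross : ∀ u ∈ Ω, ∀ a b c, G u (C u a b) c = -G u b (C u a c)
  cross_cross : ∀ u ∈ Ω, ∀ a b, C u a (C u a b) = G u a b • a - G u a a • b
  fderiv_cross : ∀ u ∈ Ω, ∀ v a b,
    fderiv ℝ C u v a b = C u (Γ u v a) b + C u a (Γ u v b) - Γ u v (C u a b)

namespace IsParallelCross

variable {Ω : Set V} {G : V → V →L[ℝ] V →L[ℝ] ℝ} {Γ C : V → V →L[ℝ] V →L[ℝ] V}
  (h : IsParallelCross Ω G Γ C) {u : V} (hu : u ∈ Ω)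
include h hu

theorem contDiffAt_metric : ContDiffAt ℝ ∞ G u :=
  h.contDiffOn_metric.contDiffAt (h.isOpen.mem_nhds hu)

theorem contDiffAt_conn : ContDiffAt ℝ ∞ Γ u :=
  h.contDiffOn_conn.contDiffAt (h.isOpen.mem_nhds hu)

theorem contDiffAt_cross : ContDiffAt ℝ ∞ C u :=
  h.contDiffOn_cross.contDiffAt (h.isOpen.mem_nhds hu)

theorem fderiv_conn_symm (v a b : V) : fderiv ℝ Γ u v a b = fderiv ℝ Γ u v b a := by
  have hd := (h.contDiffAt_conn hu).differentiableAt (by simp)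
  rw [← fderiv_bilin_apply hd, ← fderiv_bilin_apply hd]
  have e : (fun w => Γ w a b) =ᶠ[nhds u] fun w => Γ w b a := by
    filter_upwards [h.isOpen.mem_nhds hu] with w hw using h.conn_symm w hw a b
  rw [e.fderiv_eq]

/-- The first Bianchi identity. -/
theorem bianchi (a b c : V) :
    coordCurvature Γ u a b c = coordCurvature Γ u a c b - coordCurvature Γ u b c a := by
  simp only [coordCurvature]
  rw [h.fderiv_conn_symm hu a c b, h.fderiv_conn_symm hu b c a, h.fderiv_conn_symm hu c b a,
    h.conn_symm u hu c b, h.conn_symm u hu c a, h.conn_symm u hu b a]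
  abel

/-- The curvature acts on the vector product by derivations: this is the symmetry of the second
derivative of `C`, where the first derivative is expressed by the connection. -/
theorem curvature_cross (w v a b : V) : coordCurvature Γ u w v (C u a b)
    = C u (coordCurvature Γ u w v a) b + C u a (coordCurvature Γ u w v b) := by
  have hCd := (h.contDiffAt_cross hu).differentiableAt (by simp)
  have hΓd := (h.contDiffAt_conn hu).differentiableAt (by simp)
  have hC2 : DifferentiableAt ℝ (fderiv ℝ C) u :=
    ((h.contDiffAt_cross hu).fderiv_right (m := 1) one_add_one_le_infty).differentiableAt (by simp)
  have hΓa : ∀ x y : V, DifferentiableAt ℝ (fun z => Γ z x y) u := fun x y =>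
    (hΓd.clm_apply (differentiableAt_const x)).clm_apply (differentiableAt_const y)
  have hCa : ∀ x y : V, DifferentiableAt ℝ (fun z => C z x y) u := fun x y =>
    (hCd.clm_apply (differentiableAt_const x)).clm_apply (differentiableAt_const y)
  have key : ∀ w v : V, fderiv ℝ (fderiv ℝ C) u w v a b
      = fderiv ℝ C u w (Γ u v a) b + C u (fderiv ℝ Γ u w v a) b
        + (fderiv ℝ C u w a (Γ u v b) + C u a (fderiv ℝ Γ u w v b))
        - (fderiv ℝ Γ u w v (C u a b) + Γ u v (fderiv ℝ C u w a b)) := by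
    intro w v
    have e : (fun z => fderiv ℝ C z v a b) =ᶠ[nhds u]
        fun z => C z (Γ z v a) b + C z a (Γ z v b) - Γ z v (C z a b) := by
      filter_upwards [h.isOpen.mem_nhds hu] with z hz using h.fderiv_cross z hz v a b
    have e2 := DFunLike.congr_fun (e.fderiv_eq (𝕜 := ℝ)) w
    have hl : fderiv ℝ (fun z => fderiv ℝ C z v a b) u w = fderiv ℝ (fderiv ℝ C) u w v a b := by
      have hv : DifferentiableAt ℝ (fun z => fderiv ℝ C z v) u :=
        hC2.clm_apply (differentiableAt_const v)
      rw [fderiv_bilin_apply hv, fderiv_clm_apply hC2 (differentiableAt_const v)]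
      simp
    have d1 : DifferentiableAt ℝ (fun z => C z (Γ z v a) b) u :=
      (hCd.clm_apply (hΓa v a)).clm_apply (differentiableAt_const b)
    have d2 : DifferentiableAt ℝ (fun z => C z a (Γ z v b)) u :=
      (hCd.clm_apply (differentiableAt_const a)).clm_apply (hΓa v b)
    have d3 : DifferentiableAt ℝ (fun z => Γ z v (C z a b)) u :=
      (hΓd.clm_apply (differentiableAt_const v)).clm_apply (hCa a b)
    rw [hl, fderiv_fun_sub (d1.fun_add d2) d3, fderiv_fun_add d1 d2] at e2
    rw [sub_apply, add_apply,
      fderiv_bilin hCd (hΓa v a) (differentiableAt_const b),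
      fderiv_bilin hCd (differentiableAt_const a) (hΓa v b),
      fderiv_bilin hΓd (differentiableAt_const v) (hCa a b),
      fderiv_bilin_apply hΓd, fderiv_bilin_apply hΓd, fderiv_bilin_apply hCd] at e2
    simpa using e2
  have hs : fderiv ℝ (fderiv ℝ C) u w v a b = fderiv ℝ (fderiv ℝ C) u v w a b := by
    rw [((h.contDiffAt_cross hu).isSymmSndFDerivAt (by simpa using two_le_infty)).eq]
  rw [key, key, ← sub_eq_zero] at hs
  simp only [h.fderiv_cross u hu, map_sub, map_add] at hs
  rw [← sub_eq_zero]
  simp only [coordCurvature, map_sub, map_add, sub_apply, add_apply]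
  rw [← neg_eq_zero, ← hs]
  abel

end IsParallelCross

end ParallelCross

/-! ### The vector product of a G₂-form -/

/-- The minors defining `e^{abc}`, expanded. -/
theorem wedge3_eq (a b c i j k : Fin 7) : wedge3 a b c i j k =
    (if a = i then if b = j then if c = k then 1 else 0 else 0 else 0)
    - (if a = i then if b = k then if c = j then 1 else 0 else 0 else 0)
    - (if a = j then if b = i then if c = k then 1 else 0 else 0 else 0)
    + (if a = j then if b = k then if c = i then 1 else 0 else 0 else 0)
    + (if a = k then if b = i then if c = j then 1 else 0 else 0 else 0)
    - (if a = k then if b = j then if c = i then 1 else 0 else 0 else 0) := by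
  rw [wedge3, Matrix.det_fin_three]
  simp only [Matrix.of_apply, Matrix.cons_val', Matrix.cons_val_zero, Matrix.cons_val_one,
    Matrix.cons_val]
  split_ifs <;> simp

/-- The contraction identity of the standard `G₂`-form. It is the polarized form of
`eᵢ × (eᵢ × v) = ⟨eᵢ, v⟩ eᵢ - v`, on basis vectors; these are finitely many identities between
integers. -/
theorem stdG2Form_contract : ∀ i j m p : Fin 7,
    (∑ k, (stdG2Form j m k * stdG2Form i k p + stdG2Form i m k * stdG2Form j k p) : ℤ)
      = (if i = m then if j = p then 1 else 0 else 0)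
        + (if j = m then if i = p then 1 else 0 else 0)
        - 2 * (if i = j then if m = p then 1 else 0 else 0) := by
  simp only [stdG2Form, wedge3_eq]
  decide +kernel

section Alternating

variable {V : Type*} [AddCommGroup V] [Module ℝ V] (α : V [⋀^Fin 3]→ₗ[ℝ] ℝ)

theorem alternating_swap_left (a b c : V) : α ![b, a, c] = -α ![a, b, c] := by
  have h := α.map_swap ![a, b, c] (i := 0) (j := 1) (by decide)
  rw [← h]
  congr 1
  ext i
  fin_cases i <;> rfl

theorem alternating_swap_right (a b c : V) : α ![a, c, b] = -α ![a, b, c] := by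
  have h := α.map_swap ![a, b, c] (i := 1) (j := 2) (by decide)
  rw [← h]
  congr 1
  ext i
  fin_cases i <;> rfl

theorem alternating_add_left (a a' b c : V) :
    α ![a + a', b, c] = α ![a, b, c] + α ![a', b, c] :=
  α.map_vecCons_add ![b, c] a a'

theorem alternating_smul_left (r : ℝ) (a b c : V) : α ![r • a, b, c] = r * α ![a, b, c] :=
  α.map_vecCons_smul ![b, c] r a

end Alternating

section PointwiseG2

variable {M : Type*} [TopologicalSpace M] [ChartedSpace (Eu 7) M] [IsManifold (𝓡 7) ∞ M]
  [RiemannianBundle (fun x : M => TangentSpace (𝓡 7) x)]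
  (φ : ∀ x : M, TangentSpace (𝓡 7) x [⋀^Fin 3]→ₗ[ℝ] ℝ) (x : M)

theorem cross_skew (a b : TangentSpace (𝓡 7) x) : cross φ x a b = -cross φ x b a := by
  refine ext_inner_right ℝ fun c => ?_
  rw [inner_neg_left, inner_cross, inner_cross, alternating_swap_left]

theorem cross_add_left (a a' b : TangentSpace (𝓡 7) x) :
    cross φ x (a + a') b = cross φ x a b + cross φ x a' b := by
  refine ext_inner_right ℝ fun c => ?_
  rw [inner_add_left, inner_cross, inner_cross, inner_cross, alternating_add_left]

theorem cross_smul_left (r : ℝ) (a b : TangentSpace (𝓡 7) x) :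
    cross φ x (r • a) b = r • cross φ x a b := by
  refine ext_inner_right ℝ fun c => ?_
  rw [real_inner_smul_left, inner_cross, inner_cross, alternating_smul_left]

/-- The vector product as a bilinear map. -/
def crossBilin : TangentSpace (𝓡 7) x →ₗ[ℝ] TangentSpace (𝓡 7) x →ₗ[ℝ] TangentSpace (𝓡 7) x :=
  LinearMap.mk₂ ℝ (cross φ x) (cross_add_left φ x) (cross_smul_left φ x)
    (fun a b b' => by
      rw [cross_skew, cross_add_left, neg_add, ← cross_skew, ← cross_skew])
    (fun r a b => by
      rw [cross_skew, cross_smul_left, ← smul_neg, ← cross_skew])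

theorem crossBilin_apply (a b : TangentSpace (𝓡 7) x) :
    crossBilin φ x a b = cross φ x a b := rfl

theorem inner_cross_skew (a b c : TangentSpace (𝓡 7) x) :
    inner ℝ (cross φ x a b) c = -inner ℝ b (cross φ x a c) := by
  rw [real_inner_comm (cross φ x a c) b, inner_cross, inner_cross, alternating_swap_right]

theorem basis_induction {V ι : Type*} [Fintype ι] [NormedAddCommGroup V] [InnerProductSpace ℝ V]
    (b : OrthonormalBasis ι ℝ V) {P : V → Prop} (hadd : ∀ a b, P a → P b → P (a + b))
    (hsmul : ∀ (r : ℝ) a, P a → P (r • a)) (h : ∀ i, P (b i)) (h0 : P 0) (a : V) : P a := by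
  rw [← b.sum_repr a]
  exact Finset.sum_induction _ P hadd h0 fun i _ => hsmul _ _ (h i)

/-- The double product `a × (b × c)`, symmetrized in `a` and `b`. Both sides are trilinear, and on a
basis in which the form is standard the identity is `stdG2Form_contract`. -/
theorem cross_cross_polarized {φ : ∀ x : M, TangentSpace (𝓡 7) x [⋀^Fin 3]→ₗ[ℝ] ℝ}
    (hφ : IsParallelG2Form φ) (x : M) (a b c : TangentSpace (𝓡 7) x) :
    cross φ x a (cross φ x b c) + cross φ x b (cross φ x a c)
      = inner ℝ a c • b + inner ℝ b c • a - (2 * inner ℝ a b) • c := by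
  obtain ⟨e, he⟩ := hφ.isG2 x
  have hc : ∀ i j, cross φ x (e i) (e j) = ∑ k, (stdG2Form i j k : ℝ) • e k := by
    intro i j
    rw [← e.sum_repr' (cross φ x (e i) (e j))]
    refine Finset.sum_congr rfl fun k _ => ?_
    rw [real_inner_comm, inner_cross, he]
  simp only [← crossBilin_apply] at hc ⊢
  induction a using basis_induction e with
  | h0 => simp
  | hadd a a' h h' =>
    have := congrArg₂ (· + ·) h h'
    simp only [map_add, LinearMap.add_apply, inner_add_left, add_smul, smul_add,
      mul_add] at this ⊢
    rw [← sub_eq_zero] at this ⊢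
    rw [← this]; abel
  | hsmul r a h =>
    have := congrArg (r • ·) h
    simp only [map_smul, LinearMap.smul_apply, real_inner_smul_left] at this ⊢
    rw [← smul_add, this]; module
  | h i =>
    induction b using basis_induction e with
    | h0 => simp
    | hadd a a' h h' =>
      have := congrArg₂ (· + ·) h h'
      simp only [map_add, LinearMap.add_apply, inner_add_left, inner_add_right, add_smul, smul_add,
        mul_add] at this ⊢
      rw [← sub_eq_zero] at this ⊢
      rw [← this]; abel
    | hsmul r a h =>
      have := congrArg (r • ·) h
      simp only [map_smul, LinearMap.smul_apply, real_inner_smul_left,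
        real_inner_smul_right] at this ⊢
      rw [← smul_add, this]; module
    | h j =>
      induction c using basis_induction e with
      | h0 => simp
      | hadd a a' h h' =>
        have := congrArg₂ (· + ·) h h'
        simp only [map_add, inner_add_right, add_smul, smul_add] at this ⊢
        rw [← sub_eq_zero] at this ⊢
        rw [← this]; abel
      | hsmul r a h =>
        have := congrArg (r • ·) h
        simp only [map_smul, real_inner_smul_right] at this ⊢
        rw [← smul_add, this]; module
      | h m =>
        have hin : ∀ k l, inner ℝ (e k) (e l) = if k = l then (1 : ℝ) else 0 :=
          orthonormal_iff_ite.1 e.orthonormal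
        simp only [hc, map_sum, map_smul, hin]
        have h1 : ∀ i j : Fin 7, ∑ k, (stdG2Form j m k : ℝ) • ∑ p, (stdG2Form i k p : ℝ) • e p
            = ∑ p, (∑ k, (stdG2Form j m k : ℝ) * stdG2Form i k p) • e p := by
          intro i j
          simp only [Finset.smul_sum, smul_smul, Finset.sum_smul]
          exact Finset.sum_comm
        have h2 : ∀ (r : ℝ) (j : Fin 7), r • e j = ∑ p, (if j = p then r else 0) • e p := by
          intro r j
          simp
        rw [h1, h1, h2 _ j, h2 _ i, h2 _ m, ← Finset.sum_add_distrib, ← Finset.sum_add_distrib,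
          ← Finset.sum_sub_distrib]
        refine Finset.sum_congr rfl fun p _ => ?_
        rw [← add_smul, ← add_smul, ← sub_smul]
        congr 1
        have := congrArg (Int.cast (R := ℝ)) (stdG2Form_contract i j m p)
        push_cast at this
        rw [← Finset.sum_add_distrib, this]
        split_ifs <;> norm_num

/-- Together with its skew-symmetry, the only pointwise property of the vector product that the
Weitzenböck formula depends on. -/
theorem cross_cross {φ : ∀ x : M, TangentSpace (𝓡 7) x [⋀^Fin 3]→ₗ[ℝ] ℝ}
    (hφ : IsParallelG2Form φ) (x : M) (a b : TangentSpace (𝓡 7) x) :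
    cross φ x a (cross φ x a b) = inner ℝ a b • a - inner ℝ a a • b := by
  have h := cross_cross_polarized hφ x a a b
  rw [← two_smul ℝ, ← two_smul ℝ, ← smul_smul, ← smul_sub] at h
  exact smul_right_injective _ (two_ne_zero' ℝ) h

end PointwiseG2

section ChartG2

variable {M : Type*} [TopologicalSpace M] [ChartedSpace (Eu 7) M] [IsManifold (𝓡 7) ∞ M]
  [RiemannianBundle (fun x : M => TangentSpace (𝓡 7) x)]

/-- The vector product in the chart around `x₀`, depending on the chart point. -/
def chartCross (φ : ∀ x : M, TangentSpace (𝓡 7) x [⋀^Fin 3]→ₗ[ℝ] ℝ) (x₀ : M) (u : Eu 7) :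
    Eu 7 →L[ℝ] Eu 7 →L[ℝ] Eu 7 :=
  (((crossBilin φ ((extChartAt (𝓡 7) x₀).symm u)).compl₁₂
    (fromCoords x₀ ((extChartAt (𝓡 7) x₀).symm u)).toLinearMap
    (fromCoords x₀ ((extChartAt (𝓡 7) x₀).symm u)).toLinearMap).compr₂
    (toCoords x₀ ((extChartAt (𝓡 7) x₀).symm u)).toLinearMap).toContinuousBilinearMap

theorem chartCross_apply (φ : ∀ x : M, TangentSpace (𝓡 7) x [⋀^Fin 3]→ₗ[ℝ] ℝ) (x₀ : M)
    (u a b : Eu 7) : chartCross φ x₀ u a b = toCoords x₀ ((extChartAt (𝓡 7) x₀).symm u)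
      (cross φ ((extChartAt (𝓡 7) x₀).symm u) (fromCoords x₀ ((extChartAt (𝓡 7) x₀).symm u) a)
        (fromCoords x₀ ((extChartAt (𝓡 7) x₀).symm u) b)) := rfl

variable {φ : ∀ x : M, TangentSpace (𝓡 7) x [⋀^Fin 3]→ₗ[ℝ] ℝ} {x₀ : M} {u : Eu 7}

theorem fromCoords_chartCross (hu : u ∈ (extChartAt (𝓡 7) x₀).target) (a b : Eu 7) :
    fromCoords x₀ ((extChartAt (𝓡 7) x₀).symm u) (chartCross φ x₀ u a b) =
      cross φ ((extChartAt (𝓡 7) x₀).symm u) (fromCoords x₀ ((extChartAt (𝓡 7) x₀).symm u) a)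
        (fromCoords x₀ ((extChartAt (𝓡 7) x₀).symm u) b) := by
  rw [chartCross_apply, fromCoords_toCoords ((extChartAt (𝓡 7) x₀).map_target hu)]

theorem chartMetric_chartCross (hu : u ∈ (extChartAt (𝓡 7) x₀).target) (a b c : Eu 7) :
    chartMetric x₀ u (chartCross φ x₀ u a b) c = formCoeff φ x₀ a b c u := by
  rw [chartMetric_apply, fromCoords_chartCross hu, inner_cross]
  rfl

/-- The vector product in two charts. -/
theorem fderiv_transition_chartCross {x₁ : M} (hu : u ∈ transitionDomain x₀ x₁) (a b : Eu 7) :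
    fderiv ℝ (transition x₀ x₁) u (chartCross φ x₀ u a b)
      = chartCross φ x₁ (transition x₀ x₁ u) (fderiv ℝ (transition x₀ x₁) u a)
          (fderiv ℝ (transition x₀ x₁) u b) := by
  have h1 : (extChartAt (𝓡 7) x₁).symm (transition x₀ x₁ u) = (extChartAt (𝓡 7) x₀).symm u :=
    (extChartAt (𝓡 7) x₁).left_inv hu.2
  rw [chartCross_apply φ x₁, h1, ← toCoords_fromCoords_eq_fderiv hu,
    ← toCoords_fromCoords_eq_fderiv hu, ← toCoords_fromCoords_eq_fderiv hu,
    fromCoords_toCoords hu.2, fromCoords_toCoords hu.2, fromCoords_chartCross hu.1]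

variable [IsContMDiffRiemannianBundle (𝓡 7) ∞ (Eu 7) (fun x : M => TangentSpace (𝓡 7) x)]

/-- Raising an index: a vector is recovered from its scalar products with the coordinate fields. -/
theorem apply_eq_sum_metricInv {n : ℕ} {M : Type*} [TopologicalSpace M] [ChartedSpace (Eu n) M]
    [IsManifold (𝓡 n) ∞ M] [RiemannianBundle (fun x : M => TangentSpace (𝓡 n) x)]
    [IsContMDiffRiemannianBundle (𝓡 n) ∞ (Eu n) (fun x : M => TangentSpace (𝓡 n) x)]
    {x₀ : M} {u : Eu n} (hu : u ∈ (extChartAt (𝓡 n) x₀).target) (w : Eu n) (k : Fin n) :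
    w k = ∑ l, metricInv x₀ k l u * chartMetric x₀ u w (stdVec l) := by
  set A : Matrix (Fin n) (Fin n) ℝ := Matrix.of fun k l => metricCoeff x₀ k l u with hA
  have h1 : A.mulVec w.ofLp = fun l => chartMetric x₀ u w (stdVec l) := by
    ext l
    conv_rhs => rw [chartMetric_symm, ← sum_smul_stdVec w]
    simp only [Matrix.mulVec, dotProduct, hA, Matrix.of_apply, metricCoeff_eq, map_sum, map_smul,
      smul_eq_mul]
    exact Finset.sum_congr rfl fun i _ => mul_comm _ _
  have h2 : (A⁻¹.mulVec (A.mulVec w.ofLp)) k = w k := by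
    rw [Matrix.mulVec_mulVec, Matrix.nonsing_inv_mul A (metricCoeff_matrix_isUnit hu),
      Matrix.one_mulVec]
  rw [← h2, h1]
  rfl

theorem contDiffOn_chartCross (hφ : IsParallelG2Form φ) (x₀ : M) :
    ContDiffOn ℝ ∞ (chartCross φ x₀) (extChartAt (𝓡 7) x₀).target := by
  rw [contDiffOn_clm_apply]
  intro a
  rw [contDiffOn_clm_apply]
  intro b
  rw [contDiffOn_euclidean]
  intro k
  have h : ContDiffOn ℝ ∞ (fun u => ∑ l, metricInv x₀ k l u * formCoeff φ x₀ a b (stdVec l) u)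
      (extChartAt (𝓡 7) x₀).target :=
    ContDiffOn.sum fun l _ => (contDiffOn_metricInv x₀ k l).mul (hφ.smooth x₀ a b _)
  refine h.congr fun u hu => ?_
  rw [apply_eq_sum_metricInv hu]
  simp only [chartMetric_chartCross hu]

theorem differentiableAt_chartCross (hφ : IsParallelG2Form φ)
    (hu : u ∈ (extChartAt (𝓡 7) x₀).target) : DifferentiableAt ℝ (chartCross φ x₀) u :=
  ((contDiffOn_chartCross hφ x₀).contDiffAt ((isOpen_extChartAt_target x₀).mem_nhds hu)
    ).differentiableAt (by simp)

/-- The vector product is parallel at the centre of a chart. -/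
theorem fderiv_chartCross_center (hφ : IsParallelG2Form φ) (x : M) (v a b : Eu 7) :
    fderiv ℝ (chartCross φ x) (extChartAt (𝓡 7) x x) v a b
      = chartCross φ x (extChartAt (𝓡 7) x x)
          (chartChristoffel x (extChartAt (𝓡 7) x x) v a) b
        + chartCross φ x (extChartAt (𝓡 7) x x) a
          (chartChristoffel x (extChartAt (𝓡 7) x x) v b)
        - chartChristoffel x (extChartAt (𝓡 7) x x) v
          (chartCross φ x (extChartAt (𝓡 7) x x) a b) := by
  have hu : extChartAt (𝓡 7) x x ∈ (extChartAt (𝓡 7) x).target := mem_extChartAt_target x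
  refine fderiv_cross_of_form (differentiableAt_chartMetric hu) (differentiableAt_chartCross hφ hu)
    (chartMetric_symm x _) (fun _ h => chartMetric_pos hu h) (fderiv_chartMetric hu) ?_ v a b
  intro v a b c
  have e : (fun w => chartMetric x w (chartCross φ x w a b) c)
      =ᶠ[nhds (extChartAt (𝓡 7) x x)] formCoeff φ x a b c := by
    filter_upwards [(isOpen_extChartAt_target x).mem_nhds hu] with w hw
      using chartMetric_chartCross hw a b c
  have h := hφ.parallel x v a b c
  rw [covDerivForm, christoffelVec_eq, christoffelVec_eq, christoffelVec_eq] at h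
  rw [e.fderiv_eq, chartMetric_chartCross hu, chartMetric_chartCross hu, chartMetric_chartCross hu]
  linarith

theorem fderiv_transition_injective {x₁ : M} (hu : u ∈ transitionDomain x₀ x₁) :
    Function.Injective (fderiv ℝ (transition x₀ x₁ : Eu 7 → Eu 7) u) := by
  intro a b h
  rw [← toCoords_fromCoords_eq_fderiv hu, ← toCoords_fromCoords_eq_fderiv hu] at h
  have h2 := congrArg (fromCoords x₁ ((extChartAt (𝓡 7) x₀).symm u)) h
  rw [fromCoords_toCoords hu.2, fromCoords_toCoords hu.2] at h2
  exact fromCoords_injective ((extChartAt (𝓡 7) x₀).map_target hu.1) h2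

/-- The vector product is parallel at every point of a chart, by the change to the chart centred at
that point. -/
theorem fderiv_chartCross (hφ : IsParallelG2Form φ)
    (hu : u ∈ (extChartAt (𝓡 7) x₀).target) (v a b : Eu 7) :
    fderiv ℝ (chartCross φ x₀) u v a b
      = chartCross φ x₀ u (chartChristoffel x₀ u v a) b
        + chartCross φ x₀ u a (chartChristoffel x₀ u v b)
        - chartChristoffel x₀ u v (chartCross φ x₀ u a b) := by
  obtain ⟨p, hp⟩ : ∃ p, p = (extChartAt (𝓡 7) x₀).symm u := ⟨_, rfl⟩
  have hup : u ∈ transitionDomain x₀ p := ⟨hu, by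
    rw [Set.mem_preimage, ← hp]; exact mem_extChartAt_source p⟩
  have hτ : transition x₀ p u = extChartAt (𝓡 7) p p := by rw [transition, Function.comp, ← hp]
  have hup1 : transition x₀ p u ∈ (extChartAt (𝓡 7) p).target := by
    rw [hτ]; exact mem_extChartAt_target p
  have hC : ∀ᶠ v in nhds u, ∀ a b, fderiv ℝ (transition x₀ p) v (chartCross φ x₀ v a b)
      = chartCross φ p (transition x₀ p v) (fderiv ℝ (transition x₀ p) v a)
          (fderiv ℝ (transition x₀ p) v b) := by
    filter_upwards [(isOpen_transitionDomain x₀ p).mem_nhds hup] with v hv a b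
      using fderiv_transition_chartCross hv a b
  have hpar := fderiv_chartCross_center hφ p
  rw [← hτ] at hpar
  exact fderiv_cross_transform ((contDiffAt_transition hup).of_le two_le_infty)
    (fderiv_transition_injective hup) (differentiableAt_chartCross hφ hu)
    (differentiableAt_chartCross hφ hup1) hC (fderiv_transition_chartChristoffel hup) hpar v a b

/-- The vector product of a parallel `G₂`-form in a chart is parallel. -/
theorem isParallelCross_chart (hφ : IsParallelG2Form φ) (x₀ : M) :
    IsParallelCross (extChartAt (𝓡 7) x₀).target (chartMetric x₀) (chartChristoffel x₀)
      (chartCross φ x₀) where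
  isOpen := isOpen_extChartAt_target x₀
  contDiffOn_metric := contDiffOn_chartMetric x₀
  contDiffOn_conn := contDiffOn_chartChristoffel x₀
  contDiffOn_cross := contDiffOn_chartCross hφ x₀
  metric_symm u _ := chartMetric_symm x₀ u
  metric_pos u hu _ := chartMetric_pos hu
  fderiv_metric u hu := fderiv_chartMetric hu
  conn_symm u hu := chartChristoffel_symm hu
  cross_skew u hu a b := by rw [chartCross_apply, cross_skew, map_neg, ← chartCross_apply]
  metric_cross u hu a b c := by
    rw [chartMetric_apply, fromCoords_chartCross hu, inner_cross_skew, chartMetric_apply,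
      fromCoords_chartCross hu]
  cross_cross u hu a b := by
    rw [chartCross_apply, fromCoords_chartCross hu, cross_cross hφ, map_sub, map_smul, map_smul,
      toCoords_fromCoords ((extChartAt (𝓡 7) x₀).map_target hu),
      toCoords_fromCoords ((extChartAt (𝓡 7) x₀).map_target hu)]
    rfl
  fderiv_cross u hu := fderiv_chartCross hφ hu

end ChartG2

/-! ### Algebra of an associative subspace -/

section AssociativeFrame

variable {V : Type*} [NormedAddCommGroup V] [NormedSpace ℝ V]

/-- An orthonormal frame `(f₀, f₁, f₀ × f₁)` for a vector product `c` on a `7`-dimensional space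
with scalar product `g`; it spans an associative subspace `T`. -/
structure IsAssociativeFrame (g : V →L[ℝ] V →L[ℝ] ℝ) (c : V →L[ℝ] V →L[ℝ] V) (f : Fin 3 → V) :
    Prop where
  finrank_eq : Module.finrank ℝ V = 7
  symm : ∀ a b, g a b = g b a
  pos : ∀ a, a ≠ 0 → 0 < g a a
  skew : ∀ a b, c a b = -c b a
  metric_cross : ∀ a b d, g (c a b) d = -g b (c a d)
  cross_cross : ∀ a b, c a (c a b) = g a b • a - g a a • b
  ortho : ∀ i j, g (f i) (f j) = if i = j then 1 else 0
  cross_zero_one : c (f 0) (f 1) = f 2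

/-- The projection onto the orthogonal complement of the span of an orthonormal frame `f`. -/
def normalProj (g : V →L[ℝ] V →L[ℝ] ℝ) (f : Fin 3 → V) : V →L[ℝ] V :=
  ContinuousLinearMap.id ℝ V - ∑ j, (g (f j)).smulRight (f j)

theorem normalProj_apply (g : V →L[ℝ] V →L[ℝ] ℝ) (f : Fin 3 → V) (z : V) :
    normalProj g f z = z - ∑ j, g (f j) z • f j := by
  simp [normalProj]

theorem normalProj_of_normal {g : V →L[ℝ] V →L[ℝ] ℝ} {f : Fin 3 → V} {z : V}
    (hz : ∀ i, g (f i) z = 0) : normalProj g f z = z := by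
  simp [normalProj_apply, hz]

namespace IsAssociativeFrame

variable {g : V →L[ℝ] V →L[ℝ] ℝ} {c : V →L[ℝ] V →L[ℝ] V} {f : Fin 3 → V}
  (h : IsAssociativeFrame g c f)
include h

theorem normalProj_frame (i : Fin 3) : normalProj g f (f i) = 0 := by
  simp [normalProj_apply, h.ortho]

theorem frame_normalProj (i : Fin 3) (z : V) : g (f i) (normalProj g f z) = 0 := by
  simp [normalProj_apply, h.ortho]

theorem cross_self (a : V) : c a a = 0 := by
  have := h.skew a a
  rw [← sub_eq_zero, sub_neg_eq_add, ← two_smul ℝ] at this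
  simpa using this

theorem cross_one_two : c (f 1) (f 2) = f 0 := by
  have := h.cross_cross (f 1) (f 0)
  rw [h.skew (f 1) (f 0), h.cross_zero_one, map_neg, h.ortho, h.ortho] at this
  simpa using this

theorem cross_two_zero : c (f 2) (f 0) = f 1 := by
  have := h.cross_cross (f 0) (f 1)
  rw [h.cross_zero_one, h.ortho, h.ortho, h.skew] at this
  simpa using this

theorem cross_one_zero : c (f 1) (f 0) = -f 2 := by rw [h.skew, h.cross_zero_one]

theorem cross_two_one : c (f 2) (f 1) = -f 0 := by rw [h.skew, h.cross_one_two]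

theorem cross_zero_two : c (f 0) (f 2) = -f 1 := by rw [h.skew, h.cross_two_zero]

theorem normalProj_cross_frame (i j : Fin 3) : normalProj g f (c (f i) (f j)) = 0 := by
  fin_cases i <;> fin_cases j <;>
    simp [h.cross_self, h.cross_zero_one, h.cross_one_two, h.cross_two_zero, h.cross_one_zero,
      h.cross_two_one, h.cross_zero_two, h.normalProj_frame]

/-- The product of a tangent and a normal vector is normal. -/
theorem frame_cross_normal {z : V} (hz : ∀ i, g (f i) z = 0) (i j : Fin 3) :
    g (f i) (c (f j) z) = 0 := by
  have := h.metric_cross (f j) (f i) z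
  rw [eq_comm, neg_eq_iff_eq_neg] at this
  rw [this]
  fin_cases i <;> fin_cases j <;>
    simp [h.cross_self, h.cross_zero_one, h.cross_one_two, h.cross_two_zero, h.cross_one_zero,
      h.cross_two_one, h.cross_zero_two, hz]

/-- Multiplication by a tangent vector commutes with the normal projection. -/
theorem cross_normalProj (i : Fin 3) (z : V) :
    c (f i) (normalProj g f z) = normalProj g f (c (f i) z) := by
  have h1 : normalProj g f (c (f i) (normalProj g f z)) = c (f i) (normalProj g f z) :=
    normalProj_of_normal fun j => h.frame_cross_normal (fun k => h.frame_normalProj k z) j i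
  rw [← h1, normalProj_apply g f z, map_sub, map_sub, map_sum, map_sum]
  simp [h.normalProj_cross_frame]

theorem cross_cross_polarized (a b d : V) :
    c a (c b d) = -c b (c a d) + g a d • b + g b d • a - (2 * g a b) • d := by
  have h1 := h.cross_cross (a + b) d
  simp only [map_add, add_apply, add_smul, smul_add, h.cross_cross, h.symm b a] at h1
  rw [← sub_eq_zero] at h1 ⊢
  rw [← h1]
  module

/-- The Clifford relation for tangent vectors acting on normal vectors. -/
theorem cross_cross_normal {z : V} (hz : ∀ i, g (f i) z = 0) (i j : Fin 3) :
    c (f i) (c (f j) z) = -c (c (f i) (f j)) z - (if i = j then (1 : ℝ) else 0) • z := by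
  rw [h.skew (f j) z, map_neg, h.cross_cross_polarized (f i) z (f j), h.skew z (c (f i) (f j)),
    h.ortho, h.symm z, hz, hz]
  module

theorem cross_metric_self (a z : V) : g z (c a z) = 0 := by
  have := h.metric_cross a z z
  rw [h.symm] at this
  linarith

/-- The product of two normal vectors is tangent. By dimension, a normal vector `η ≠ 0` and its
products with the frame span the normal space. -/
theorem normalProj_cross_normal {η ζ : V} (hη : ∀ i, g (f i) η = 0) (hζ : ∀ i, g (f i) ζ = 0) :
    normalProj g f (c η ζ) = 0 := by
  by_cases h0 : η = 0
  · simp [h0]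
  -- The vectors `fᵢ`, `η`, `fᵢ × η` are orthogonal, hence a basis of the `7`-dimensional space.
  have hpos := h.pos η h0
  set v : Fin 3 ⊕ (Unit ⊕ Fin 3) → V := Sum.elim f (Sum.elim (fun _ => η) fun i => c (f i) η)
  have hcη : ∀ i j, g (c (f i) η) (c (f j) η) = if i = j then g η η else 0 := by
    intro i j
    rw [h.metric_cross, h.cross_cross_normal hη, map_sub, map_neg, h.cross_metric_self]
    split_ifs <;> simp
  have hli : LinearIndependent ℝ v := by
    refine LinearMap.linearIndependent_of_isOrthoᵢ (B := g.toLinearMap₁₂) ?_ ?_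
    · rw [LinearMap.isOrthoᵢ_def]
      rintro (i | u | i) (j | u' | j) hij
      · have : i ≠ j := fun e => hij (by rw [e])
        simpa [v, this] using h.ortho i j
      · exact hη i
      · exact h.frame_cross_normal hη i j
      · exact (h.symm _ _).trans (hη j)
      · exact absurd rfl hij
      · exact h.cross_metric_self _ _
      · exact (h.symm _ _).trans (h.frame_cross_normal hη j i)
      · exact (h.symm _ _).trans (h.cross_metric_self _ _)
      · have : i ≠ j := fun e => hij (by rw [e])
        simpa [v, this] using hcη i j
    · rintro (i | u | i)
      · simp [v, h.ortho]
      · exact hpos.ne'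
      · simpa [v, hcη] using hpos.ne'
  have hcard : Fintype.card (Fin 3 ⊕ (Unit ⊕ Fin 3)) = Module.finrank ℝ V := by
    rw [h.finrank_eq]; rfl
  let b := basisOfLinearIndependentOfCardEqFinrank hli hcard
  have hb : ∀ i, b i = v i := fun i => by simp [b]
  have hL : (normalProj g f ∘L c η ∘L normalProj g f).toLinearMap = 0 := by
    refine b.ext fun i => ?_
    rw [hb]
    rcases i with i | u | i
    · simp [v, h.normalProj_frame]
    · simp [v, normalProj_of_normal hη, h.cross_self]
    · simp only [v, Sum.elim_inr, ContinuousLinearMap.coe_coe, ContinuousLinearMap.comp_apply,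
        LinearMap.zero_apply, normalProj_of_normal (h.frame_cross_normal hη · i)]
      rw [h.skew (f i) η, map_neg, h.cross_cross, h.symm, hη]
      simp [h.normalProj_frame]
  have := LinearMap.congr_fun hL ζ
  simpa [normalProj_of_normal hζ] using this

/-- The normal part of the product of any vector with a normal vector comes from its tangential
part. -/
theorem normalProj_cross_of_normal {η : V} (hη : ∀ i, g (f i) η = 0) (z : V) :
    normalProj g f (c z η) = ∑ j, g (f j) z • c (f j) η := by
  have hz : z = normalProj g f z + ∑ j, g (f j) z • f j := by
    rw [normalProj_apply]; abel
  conv_lhs => rw [hz]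
  rw [map_add, add_apply, map_add,
    h.normalProj_cross_normal (h.frame_normalProj · z) hη, zero_add, map_sum, sum_apply, map_sum]
  refine Finset.sum_congr rfl fun j _ => ?_
  rw [map_smul, smul_apply, map_smul,
    normalProj_of_normal (h.frame_cross_normal hη · j)]

/-- The algebra behind the square of the Dirac operator: `H` is the normal Hessian, `K` the
curvature term of its skew part, `B` the second fundamental form, and `β = ⟨ψ, B⟩`. -/
theorem sum_cross_cross_hessian {H B : Fin 3 → Fin 3 → V} {K : Fin 3 → V → V}
    {p : Fin 3 → Fin 3 → V} {β : Fin 3 → Fin 3 → ℝ} (hH : ∀ i j k, g (f k) (H i j) = 0)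
    (hskew : ∀ l i, H l i - H i l = normalProj g f (p l i)
      + ∑ j, (β i j • B l j - β l j • B i j))
    (hbianchi : ∀ l i, p l i = K l (f i) - K i (f l))
    (hder : ∀ l i j, K l (c (f i) (f j)) = c (K l (f i)) (f j) + c (f i) (K l (f j)))
    (hB : ∀ i j, B i j = B j i)
    (hB0 : ∀ l, B l 0 = c (B l 1) (f 2) + c (f 1) (B l 2))
    (hB1 : ∀ l, B l 1 = c (B l 2) (f 0) + c (f 2) (B l 0))
    (hB2 : ∀ l, B l 2 = c (B l 0) (f 1) + c (f 0) (B l 1)) :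
    ∑ l, c (f l) (∑ i, c (f i) (H l i)) = -∑ i, H i i + normalProj g f (∑ i, K i (f i))
      - ∑ i, ∑ j, β i j • B i j := by
  -- The Clifford relation splits the double sum into a trace and the skew part of `H`.
  have h1 : ∑ l, c (f l) (∑ i, c (f i) (H l i)) = -∑ i, H i i
      - (c (f 2) (H 0 1 - H 1 0) + c (f 0) (H 1 2 - H 2 1) + c (f 1) (H 2 0 - H 0 2)) := by
    simp only [map_sum, fun l i => h.cross_cross_normal (hH l i)]
    simp only [Fin.sum_univ_three, h.cross_self, h.cross_zero_one, h.cross_one_two,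
      h.cross_two_zero, h.cross_one_zero, h.cross_two_one, h.cross_zero_two]
    simp
    abel
  -- The Bianchi identity and the derivation property turn the curvature of the skew part into the
  -- Ricci-type sum.
  have h2 : c (f 2) (p 0 1) + c (f 0) (p 1 2) + c (f 1) (p 2 0) = -∑ i, K i (f i) := by
    have k0 := hder 0 1 2
    have k1 := hder 1 2 0
    have k2 := hder 2 0 1
    rw [h.cross_one_two, h.skew (K 0 (f 1))] at k0
    rw [h.cross_two_zero, h.skew (K 1 (f 2))] at k1
    rw [h.cross_zero_one, h.skew (K 2 (f 0))] at k2
    rw [Fin.sum_univ_three, k0, k1, k2, hbianchi, hbianchi, hbianchi]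
    simp only [map_sub]
    abel
  -- The quadratic terms in the second fundamental form, by its compatibility with the product.
  have h3 : c (f 2) (∑ j, (β 1 j • B 0 j - β 0 j • B 1 j))
      + c (f 0) (∑ j, (β 2 j • B 1 j - β 1 j • B 2 j))
      + c (f 1) (∑ j, (β 0 j • B 2 j - β 2 j • B 0 j)) = ∑ i, ∑ j, β i j • B i j := by
    have b0 : ∀ j, B 0 j = -c (f 2) (B 1 j) + c (f 1) (B 2 j) := fun j => by
      rw [hB 0 j, hB0 j, h.skew (B j 1), hB j 1, hB j 2]
    have b1 : ∀ j, B 1 j = -c (f 0) (B 2 j) + c (f 2) (B 0 j) := fun j => by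
      rw [hB 1 j, hB1 j, h.skew (B j 2), hB j 2, hB j 0]
    have b2 : ∀ j, B 2 j = -c (f 1) (B 0 j) + c (f 0) (B 1 j) := fun j => by
      rw [hB 2 j, hB2 j, h.skew (B j 0), hB j 0, hB j 1]
    have e0 : ∑ j, β 0 j • B 0 j = ∑ j, β 0 j • (-c (f 2) (B 1 j) + c (f 1) (B 2 j)) :=
      Finset.sum_congr rfl fun j _ => by rw [← b0]
    have e1 : ∑ j, β 1 j • B 1 j = ∑ j, β 1 j • (-c (f 0) (B 2 j) + c (f 2) (B 0 j)) :=
      Finset.sum_congr rfl fun j _ => by rw [← b1]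
    have e2 : ∑ j, β 2 j • B 2 j = ∑ j, β 2 j • (-c (f 1) (B 0 j) + c (f 0) (B 1 j)) :=
      Finset.sum_congr rfl fun j _ => by rw [← b2]
    rw [Fin.sum_univ_three (fun i => ∑ j, β i j • B i j), e0, e1, e2]
    simp only [map_sum, map_sub, map_smul, ← Finset.sum_add_distrib]
    refine Finset.sum_congr rfl fun j _ => ?_
    module
  rw [h1, hskew, hskew, hskew, map_add, map_add, map_add, h.cross_normalProj, h.cross_normalProj,
    h.cross_normalProj, ← h3]
  have h4 := congrArg (normalProj g f) h2
  simp only [map_add, map_neg] at h4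
  rw [← sub_eq_zero] at h4 ⊢
  rw [← neg_eq_zero, ← h4]
  abel

end IsAssociativeFrame

end AssociativeFrame

/-! ### Calculus along an associative immersion, in coordinates -/

section Germ

variable (E V : Type*) [NormedAddCommGroup E] [NormedSpace ℝ E]
  [NormedAddCommGroup V] [NormedSpace ℝ V]

/-- The germ at `e₀` of an associative immersion `F` of a domain `S` (possibly with boundary) into
an open subset `Ω` of a `7`-dimensional vector space with a parallel vector product. The vectors
`b i` are such that the tangent vectors `∂F/∂(b i)` are orthonormal and oriented at `e₀` itself; away
from `e₀` they just form a frame. -/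
structure AssociativeGerm where
  /-- the domain of the chart of the target -/
  Ω : Set V
  /-- the metric -/
  G : V → V →L[ℝ] V →L[ℝ] ℝ
  /-- the Christoffel symbols -/
  Γ : V → V →L[ℝ] V →L[ℝ] V
  /-- the vector product -/
  C : V → V →L[ℝ] V →L[ℝ] V
  /-- the domain of the immersion -/
  S : Set E
  /-- the immersion -/
  F : E → V
  /-- the base point -/
  e₀ : E
  /-- constant vector fields which are orthonormal for the induced metric at the base point -/
  b : Fin 3 → E
  isParallelCross : IsParallelCross Ω G Γ C
  finrank_eq : Module.finrank ℝ V = 7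
  uniqueDiffOn : UniqueDiffOn ℝ S
  /-- with `uniqueDiffOn`, this makes second derivatives symmetric at boundary points -/
  mem_closure : e₀ ∈ closure (interior S)
  mem : e₀ ∈ S
  contDiffWithinAt : ContDiffWithinAt ℝ ∞ F S e₀
  map_mem : F e₀ ∈ Ω
  ortho : ∀ i j, G (F e₀) (fderivWithin ℝ F S e₀ (b i)) (fderivWithin ℝ F S e₀ (b j))
    = if i = j then 1 else 0
  cross_zero_one : C (F e₀) (fderivWithin ℝ F S e₀ (b 0)) (fderivWithin ℝ F S e₀ (b 1))
    = fderivWithin ℝ F S e₀ (b 2)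
  cross_mem : ∀ᶠ e in nhdsWithin e₀ S, ∀ i j,
    C (F e) (fderivWithin ℝ F S e (b i)) (fderivWithin ℝ F S e (b j))
      ∈ Submodule.span ℝ (Set.range fun k => fderivWithin ℝ F S e (b k))

namespace AssociativeGerm

variable {E V} (D : AssociativeGerm E V)

/-- The coordinate tangent vector fields of the immersion. -/
def frame (i : Fin 3) (e : E) : V := fderivWithin ℝ D.F D.S e (D.b i)

/-- The covariant derivative along the immersion, in the direction of a constant vector `v`. -/
def cov (v : E) (P : E → V) (e : E) : V :=
  fderivWithin ℝ P D.S e v + D.Γ (D.F e) (fderivWithin ℝ D.F D.S e v) (P e)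

/-- The Gram matrix of the coordinate frame. -/
def gram (e : E) : Matrix (Fin 3) (Fin 3) ℝ :=
  Matrix.of fun i j => D.G (D.F e) (D.frame i e) (D.frame j e)

/-- The components, in the coordinate frame, of the tangential part of a vector. -/
def tangentCoeff (j : Fin 3) (Z : E → V) (e : E) : ℝ :=
  ∑ i, (D.gram e)⁻¹ j i * D.G (D.F e) (D.frame i e) (Z e)

/-- The normal part of a vector field along the immersion. It is the orthogonal projection to the
normal space wherever the Gram matrix is invertible, hence near the base point. -/
def normalPart (Z : E → V) (e : E) : V := Z e - ∑ j, D.tangentCoeff j Z e • D.frame j e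

/-- The Dirac operator in terms of the coordinate frame. -/
def dirac (P : E → V) (e : E) : V :=
  ∑ i, ∑ j, (D.gram e)⁻¹ i j • D.C (D.F e) (D.frame i e) (D.normalPart (D.cov (D.b j) P) e)

/-- Smooth germs at the base point. -/
def Smooth {W : Type*} [NormedAddCommGroup W] [NormedSpace ℝ W] (P : E → W) : Prop :=
  ContDiffWithinAt ℝ ∞ P D.S D.e₀

theorem uniqueDiffWithinAt : UniqueDiffWithinAt ℝ D.S D.e₀ := D.uniqueDiffOn _ D.mem

variable {D}

theorem Smooth.differentiableWithinAt {W : Type*} [NormedAddCommGroup W] [NormedSpace ℝ W]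
    {P : E → W} (hP : D.Smooth P) : DifferentiableWithinAt ℝ P D.S D.e₀ :=
  ContDiffWithinAt.differentiableWithinAt hP (by simp)

theorem Smooth.fderivWithin {W : Type*} [NormedAddCommGroup W] [NormedSpace ℝ W]
    {P : E → W} (hP : D.Smooth P) : D.Smooth (fderivWithin ℝ P D.S) :=
  ContDiffWithinAt.fderivWithin_right hP D.uniqueDiffOn (by simp) D.mem

theorem Smooth.fderivWithin_apply {W : Type*} [NormedAddCommGroup W] [NormedSpace ℝ W]
    {P : E → W} (hP : D.Smooth P) (v : E) : D.Smooth fun e => _root_.fderivWithin ℝ P D.S e v :=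
  ContDiffWithinAt.clm_apply hP.fderivWithin contDiffWithinAt_const

theorem Smooth.congr {W : Type*} [NormedAddCommGroup W] [NormedSpace ℝ W]
    {P Q : E → W} (hP : D.Smooth P) (h : Q =ᶠ[nhdsWithin D.e₀ D.S] P) : D.Smooth Q :=
  ContDiffWithinAt.congr_of_eventuallyEq hP h (h.self_of_nhdsWithin D.mem)

variable (D)

theorem smooth_map : D.Smooth D.F := D.contDiffWithinAt

theorem smooth_metric : D.Smooth fun e => D.G (D.F e) :=
  (D.isParallelCross.contDiffAt_metric D.map_mem).comp_contDiffWithinAt _ D.smooth_map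

theorem smooth_conn : D.Smooth fun e => D.Γ (D.F e) :=
  (D.isParallelCross.contDiffAt_conn D.map_mem).comp_contDiffWithinAt _ D.smooth_map

theorem smooth_cross : D.Smooth fun e => D.C (D.F e) :=
  (D.isParallelCross.contDiffAt_cross D.map_mem).comp_contDiffWithinAt _ D.smooth_map

theorem smooth_frame (i : Fin 3) : D.Smooth (D.frame i) := D.smooth_map.fderivWithin_apply _

variable {D}

theorem Smooth.bilin {W : Type*} [NormedAddCommGroup W] [NormedSpace ℝ W]
    {B : E → V →L[ℝ] V →L[ℝ] W} {P Q : E → V} (hB : D.Smooth B) (hP : D.Smooth P)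
    (hQ : D.Smooth Q) : D.Smooth fun e => B e (P e) (Q e) :=
  ContDiffWithinAt.clm_apply (ContDiffWithinAt.clm_apply hB hP) hQ

theorem Smooth.cov {P : E → V} (hP : D.Smooth P) (v : E) : D.Smooth (D.cov v P) :=
  ContDiffWithinAt.add (hP.fderivWithin_apply v)
    (D.smooth_conn.bilin (D.smooth_map.fderivWithin_apply v) hP)

variable (D)

theorem gram_base : D.gram D.e₀ = 1 := by
  ext i j
  rw [gram, Matrix.of_apply, Matrix.one_apply]
  exact D.ortho i j

theorem smooth_gram (i j : Fin 3) : D.Smooth fun e => D.gram e i j :=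
  D.smooth_metric.bilin (D.smooth_frame i) (D.smooth_frame j)

theorem smooth_gram_inv (i j : Fin 3) : D.Smooth fun e => (D.gram e)⁻¹ i j :=
  contDiffWithinAt_matrix_inv D.smooth_gram (by rw [gram_base]; simp) i j

theorem smooth_tangentCoeff (j : Fin 3) {Z : E → V} (hZ : D.Smooth Z) :
    D.Smooth (D.tangentCoeff j Z) :=
  ContDiffWithinAt.sum fun i _ => ContDiffWithinAt.mul (D.smooth_gram_inv j i)
    (D.smooth_metric.bilin (D.smooth_frame i) hZ)

theorem smooth_normalPart {Z : E → V} (hZ : D.Smooth Z) : D.Smooth (D.normalPart Z) :=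
  ContDiffWithinAt.sub hZ (ContDiffWithinAt.sum fun j _ =>
    ContDiffWithinAt.smul (D.smooth_tangentCoeff j hZ) (D.smooth_frame j))

theorem smooth_dirac {P : E → V} (hP : D.Smooth P) : D.Smooth (D.dirac P) :=
  ContDiffWithinAt.sum fun i _ => ContDiffWithinAt.sum fun j _ =>
    ContDiffWithinAt.smul (D.smooth_gram_inv i j)
      (D.smooth_cross.bilin (D.smooth_frame i) (D.smooth_normalPart (hP.cov _)))

theorem eventually_det_ne_zero : ∀ᶠ e in nhdsWithin D.e₀ D.S, (D.gram e).det ≠ 0 := by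
  have hc : ContinuousWithinAt (fun e => (D.gram e).det) D.S D.e₀ := by
    simp only [Matrix.det_fin_three]
    have h := fun i j => (D.smooth_gram i j).continuousWithinAt
    have h3 : ∀ i j k l m n : Fin 3, ContinuousWithinAt
        (fun e => D.gram e i j * D.gram e k l * D.gram e m n) D.S D.e₀ := fun i j k l m n =>
      ((h i j).mul (h k l)).mul (h m n)
    exact (((((h3 _ _ _ _ _ _).sub (h3 _ _ _ _ _ _)).sub (h3 _ _ _ _ _ _)).add
      (h3 _ _ _ _ _ _)).add (h3 _ _ _ _ _ _)).sub (h3 _ _ _ _ _ _)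
  have h1 : (D.gram D.e₀).det ≠ 0 := by rw [gram_base]; simp
  exact hc.eventually_ne h1

/-- The product rule for a bilinear form depending on the point of the target. -/
theorem fderivWithin_comp_bilin {W : Type*} [NormedAddCommGroup W] [NormedSpace ℝ W]
    {B : V → V →L[ℝ] V →L[ℝ] W} (hB : ContDiffAt ℝ ∞ B (D.F D.e₀)) {P Q : E → V}
    (hP : D.Smooth P) (hQ : D.Smooth Q) (v : E) :
    fderivWithin ℝ (fun e => B (D.F e) (P e) (Q e)) D.S D.e₀ v
      = fderiv ℝ B (D.F D.e₀) (fderivWithin ℝ D.F D.S D.e₀ v) (P D.e₀) (Q D.e₀)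
        + B (D.F D.e₀) (fderivWithin ℝ P D.S D.e₀ v) (Q D.e₀)
        + B (D.F D.e₀) (P D.e₀) (fderivWithin ℝ Q D.S D.e₀ v) := by
  have hBd := hB.differentiableAt (by simp)
  rw [fderivWithin_bilin (B := fun e => B (D.F e))
    (hBd.comp_differentiableWithinAt _ D.smooth_map.differentiableWithinAt)
    hP.differentiableWithinAt hQ.differentiableWithinAt D.uniqueDiffWithinAt]
  have := fderiv_comp_fderivWithin D.e₀ hBd D.smooth_map.differentiableWithinAt
    D.uniqueDiffWithinAt
  rw [Function.comp_def] at this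
  rw [this]
  rfl

theorem fderivWithin_metric {P Q : E → V} (hP : D.Smooth P) (hQ : D.Smooth Q) (v : E) :
    fderivWithin ℝ (fun e => D.G (D.F e) (P e) (Q e)) D.S D.e₀ v
      = D.G (D.F D.e₀) (D.cov v P D.e₀) (Q D.e₀) + D.G (D.F D.e₀) (P D.e₀) (D.cov v Q D.e₀) := by
  rw [D.fderivWithin_comp_bilin (D.isParallelCross.contDiffAt_metric D.map_mem) hP hQ,
    D.isParallelCross.fderiv_metric _ D.map_mem]
  simp only [cov, map_add, add_apply]
  ring

theorem cov_cross {P Q : E → V} (hP : D.Smooth P) (hQ : D.Smooth Q) (v : E) :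
    D.cov v (fun e => D.C (D.F e) (P e) (Q e)) D.e₀
      = D.C (D.F D.e₀) (D.cov v P D.e₀) (Q D.e₀) + D.C (D.F D.e₀) (P D.e₀) (D.cov v Q D.e₀) := by
  rw [cov, D.fderivWithin_comp_bilin (D.isParallelCross.contDiffAt_cross D.map_mem) hP hQ,
    D.isParallelCross.fderiv_cross _ D.map_mem]
  simp only [cov, map_add, add_apply]
  abel

theorem cov_congr {P Q : E → V} (h : P =ᶠ[nhdsWithin D.e₀ D.S] Q) (v : E) :
    D.cov v P D.e₀ = D.cov v Q D.e₀ := by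
  rw [cov, cov, h.fderivWithin_eq (h.self_of_nhdsWithin D.mem), h.self_of_nhdsWithin D.mem]

theorem cov_smul {s : E → ℝ} {P : E → V} (hs : D.Smooth s) (hP : D.Smooth P) (v : E) :
    D.cov v (fun e => s e • P e) D.e₀
      = fderivWithin ℝ s D.S D.e₀ v • P D.e₀ + s D.e₀ • D.cov v P D.e₀ := by
  rw [cov, fderivWithin_fun_smul D.uniqueDiffWithinAt hs.differentiableWithinAt
    hP.differentiableWithinAt, cov]
  simp only [add_apply, smul_apply, ContinuousLinearMap.smulRight_apply, map_smul, smul_add]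
  abel

theorem cov_sum {ι : Type*} (t : Finset ι) {P : ι → E → V} (hP : ∀ i ∈ t, D.Smooth (P i)) (v : E) :
    D.cov v (fun e => ∑ i ∈ t, P i e) D.e₀ = ∑ i ∈ t, D.cov v (P i) D.e₀ := by
  rw [cov, fderivWithin_fun_sum D.uniqueDiffWithinAt
    fun i hi => (hP i hi).differentiableWithinAt]
  simp [cov, Finset.sum_add_distrib]

theorem cov_sub {P Q : E → V} (hP : D.Smooth P) (hQ : D.Smooth Q) (v : E) :
    D.cov v (fun e => P e - Q e) D.e₀ = D.cov v P D.e₀ - D.cov v Q D.e₀ := by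
  rw [cov, fderivWithin_fun_sub D.uniqueDiffWithinAt hP.differentiableWithinAt
    hQ.differentiableWithinAt]
  simp only [cov, sub_apply, map_sub]
  abel

/-- The second derivatives of a smooth germ commute, also at the boundary. -/
theorem fderivWithin_comm {P : E → V} (hP : D.Smooth P) (v w : E) :
    fderivWithin ℝ (fun e => fderivWithin ℝ P D.S e v) D.S D.e₀ w
      = fderivWithin ℝ (fun e => fderivWithin ℝ P D.S e w) D.S D.e₀ v := by
  have h : ∀ v w, fderivWithin ℝ (fun e => fderivWithin ℝ P D.S e v) D.S D.e₀ w
      = fderivWithin ℝ (fderivWithin ℝ P D.S) D.S D.e₀ w v := by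
    intro v w
    rw [fderivWithin_clm_apply D.uniqueDiffWithinAt hP.fderivWithin.differentiableWithinAt
      (differentiableWithinAt_const v)]
    simp
  rw [h, h]
  exact ContDiffWithinAt.isSymmSndFDerivWithinAt hP (by simpa using two_le_infty) D.uniqueDiffOn
    D.mem_closure D.mem w v

/-- The connection along the immersion is torsion-free. -/
theorem cov_frame_comm (i j : Fin 3) :
    D.cov (D.b i) (D.frame j) D.e₀ = D.cov (D.b j) (D.frame i) D.e₀ := by
  exact congrArg₂ (· + ·) (D.fderivWithin_comm D.smooth_map (D.b j) (D.b i))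
    (D.isParallelCross.conn_symm _ D.map_mem _ _)

/-- The curvature is the commutator of covariant derivatives along the immersion. -/
theorem cov_cov_sub {P : E → V} (hP : D.Smooth P) (v w : E) :
    D.cov v (D.cov w P) D.e₀ - D.cov w (D.cov v P) D.e₀
      = coordCurvature D.Γ (D.F D.e₀) (fderivWithin ℝ D.F D.S D.e₀ v)
          (fderivWithin ℝ D.F D.S D.e₀ w) (P D.e₀) := by
  have h : ∀ v w, D.cov v (D.cov w P) D.e₀
      = fderivWithin ℝ (fun e => fderivWithin ℝ P D.S e w) D.S D.e₀ v
        + (fderiv ℝ D.Γ (D.F D.e₀) (fderivWithin ℝ D.F D.S D.e₀ v)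
            (fderivWithin ℝ D.F D.S D.e₀ w) (P D.e₀)
          + D.Γ (D.F D.e₀) (fderivWithin ℝ (fun e => fderivWithin ℝ D.F D.S e w) D.S D.e₀ v)
            (P D.e₀)
          + D.Γ (D.F D.e₀) (fderivWithin ℝ D.F D.S D.e₀ w) (fderivWithin ℝ P D.S D.e₀ v))
        + D.Γ (D.F D.e₀) (fderivWithin ℝ D.F D.S D.e₀ v) (D.cov w P D.e₀) := by
    intro v w
    have hF := D.smooth_map.fderivWithin_apply w
    have e : D.cov w P = fun e => fderivWithin ℝ P D.S e w
      + D.Γ (D.F e) (fderivWithin ℝ D.F D.S e w) (P e) := rfl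
    rw [cov, ← D.fderivWithin_comp_bilin (D.isParallelCross.contDiffAt_conn D.map_mem) hF hP v]
    nth_rewrite 1 [e]
    rw [fderivWithin_fun_add D.uniqueDiffWithinAt
      (hP.fderivWithin_apply w).differentiableWithinAt
      (D.smooth_conn.bilin hF hP).differentiableWithinAt]
    rfl
  rw [h, h, D.fderivWithin_comm hP w v, D.fderivWithin_comm D.smooth_map w v, coordCurvature]
  simp only [cov, map_add]
  abel

end AssociativeGerm
end Germ

/-! ### The Weitzenböck formula in coordinates -/

namespace AssociativeGerm

variable {E V : Type*} [NormedAddCommGroup E] [NormedSpace ℝ E]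
  [NormedAddCommGroup V] [NormedSpace ℝ V] (D : AssociativeGerm E V)

theorem isAssociativeFrame :
    IsAssociativeFrame (D.G (D.F D.e₀)) (D.C (D.F D.e₀)) fun i => D.frame i D.e₀ where
  finrank_eq := D.finrank_eq
  symm := D.isParallelCross.metric_symm _ D.map_mem
  pos := D.isParallelCross.metric_pos _ D.map_mem
  skew := D.isParallelCross.cross_skew _ D.map_mem
  metric_cross := D.isParallelCross.metric_cross _ D.map_mem
  cross_cross := D.isParallelCross.cross_cross _ D.map_mem
  ortho := D.ortho
  cross_zero_one := D.cross_zero_one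

/-- The normal projection at the base point. -/
def proj : V →L[ℝ] V := normalProj (D.G (D.F D.e₀)) fun i => D.frame i D.e₀

theorem gram_inv_base (i j : Fin 3) : (D.gram D.e₀)⁻¹ i j = if i = j then 1 else 0 := by
  rw [gram_base, inv_one, Matrix.one_apply]

theorem tangentCoeff_base (j : Fin 3) (Z : E → V) :
    D.tangentCoeff j Z D.e₀ = D.G (D.F D.e₀) (D.frame j D.e₀) (Z D.e₀) := by
  simp [tangentCoeff, gram_inv_base]

theorem normalPart_base (Z : E → V) : D.normalPart Z D.e₀ = D.proj (Z D.e₀) := by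
  simp [normalPart, proj, normalProj_apply, tangentCoeff_base]

theorem proj_frame (i : Fin 3) : D.proj (D.frame i D.e₀) = 0 :=
  D.isAssociativeFrame.normalProj_frame i

theorem frame_proj (i : Fin 3) (z : V) : D.G (D.F D.e₀) (D.frame i D.e₀) (D.proj z) = 0 :=
  D.isAssociativeFrame.frame_normalProj i z

theorem proj_of_normal {z : V} (hz : ∀ i, D.G (D.F D.e₀) (D.frame i D.e₀) z = 0) :
    D.proj z = z :=
  normalProj_of_normal hz

theorem tangentCoeff_of_eq_sum {e : E} (he : (D.gram e).det ≠ 0) {Z : E → V} {a : Fin 3 → ℝ}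
    (hZ : Z e = ∑ k, a k • D.frame k e) (j : Fin 3) : D.tangentCoeff j Z e = a j := by
  have h1 : (fun i => D.G (D.F e) (D.frame i e) (Z e)) = (D.gram e).mulVec a := by
    ext i
    simp [hZ, Matrix.mulVec, dotProduct, gram, mul_comm]
  have h2 : D.tangentCoeff j Z e = ((D.gram e)⁻¹.mulVec ((D.gram e).mulVec a)) j := by
    rw [← h1]; rfl
  rw [h2, Matrix.mulVec_mulVec, Matrix.nonsing_inv_mul _ (isUnit_iff_ne_zero.2 he),
    Matrix.one_mulVec]

theorem normalPart_of_mem_span {e : E} (he : (D.gram e).det ≠ 0) {Z : E → V}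
    (hZ : Z e ∈ Submodule.span ℝ (Set.range fun k => D.frame k e)) : D.normalPart Z e = 0 := by
  obtain ⟨a, ha⟩ := (Submodule.mem_span_range_iff_exists_fun ℝ).1 hZ
  simp only [normalPart, D.tangentCoeff_of_eq_sum he ha.symm]
  rw [ha, sub_self]

/-- The second fundamental form, on the coordinate frame. -/
def secondForm (i j : Fin 3) : V := D.proj (D.cov (D.b i) (D.frame j) D.e₀)

theorem secondForm_comm (i j : Fin 3) : D.secondForm i j = D.secondForm j i := by
  rw [secondForm, D.cov_frame_comm, secondForm]

theorem proj_cov_sum_frame {s : Fin 3 → E → ℝ} (hs : ∀ j, D.Smooth (s j)) (i : Fin 3) :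
    D.proj (D.cov (D.b i) (fun e => ∑ j, s j e • D.frame j e) D.e₀)
      = ∑ j, s j D.e₀ • D.secondForm i j := by
  have h : ∀ j ∈ Finset.univ, D.Smooth fun e => s j e • D.frame j e := fun j _ =>
    ContDiffWithinAt.smul (hs j) (D.smooth_frame j)
  rw [D.cov_sum _ h, map_sum]
  refine Finset.sum_congr rfl fun j _ => ?_
  rw [D.cov_smul (hs j) (D.smooth_frame j), map_add, map_smul, map_smul, proj_frame, smul_zero,
    zero_add, secondForm]

/-- The normal derivative of the normal part of a vector field. -/
theorem proj_cov_normalPart {Z : E → V} (hZ : D.Smooth Z) (i : Fin 3) :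
    D.proj (D.cov (D.b i) (D.normalPart Z) D.e₀) = D.proj (D.cov (D.b i) Z D.e₀)
      - ∑ j, D.G (D.F D.e₀) (D.frame j D.e₀) (Z D.e₀) • D.secondForm i j := by
  have hs := fun j => D.smooth_tangentCoeff j hZ
  have h : D.Smooth fun e => ∑ j, D.tangentCoeff j Z e • D.frame j e :=
    ContDiffWithinAt.sum fun j _ => ContDiffWithinAt.smul (hs j) (D.smooth_frame j)
  have e : D.normalPart Z = fun e => Z e - ∑ j, D.tangentCoeff j Z e • D.frame j e := rfl
  rw [e, D.cov_sub hZ h, map_sub, D.proj_cov_sum_frame hs]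
  simp only [tangentCoeff_base]

/-- The second fundamental form is compatible with the vector product, as the tangent spaces are
stable under it. -/
theorem sum_secondForm_cross (l k i : Fin 3) :
    ∑ m, D.G (D.F D.e₀) (D.frame m D.e₀)
        (D.C (D.F D.e₀) (D.frame k D.e₀) (D.frame i D.e₀)) • D.secondForm l m
      = D.C (D.F D.e₀) (D.secondForm l k) (D.frame i D.e₀)
        + D.C (D.F D.e₀) (D.frame k D.e₀) (D.secondForm l i) := by
  have hsm : D.Smooth fun e => D.C (D.F e) (D.frame k e) (D.frame i e) :=
    D.smooth_cross.bilin (D.smooth_frame k) (D.smooth_frame i)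
  have e : (D.normalPart fun e => D.C (D.F e) (D.frame k e) (D.frame i e))
      =ᶠ[nhdsWithin D.e₀ D.S] fun _ => 0 := by
    filter_upwards [D.cross_mem, D.eventually_det_ne_zero] with e he hd
    exact D.normalPart_of_mem_span hd (he k i)
  have h := D.proj_cov_normalPart hsm l
  have h0 : D.cov (D.b l) (fun _ => (0 : V)) D.e₀ = 0 := by simp [cov]
  rw [D.cov_congr e, h0, map_zero, eq_comm, sub_eq_zero,
    D.cov_cross (D.smooth_frame k) (D.smooth_frame i), map_add] at h
  rw [← h]
  congr 1
  · rw [D.isAssociativeFrame.skew, map_neg, D.isAssociativeFrame.skew (D.secondForm l k)]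
    exact congrArg Neg.neg (D.isAssociativeFrame.cross_normalProj i _).symm
  · exact (D.isAssociativeFrame.cross_normalProj k _).symm

/-- The normal Hessian of a normal field, on the coordinate frame. -/
def hessian (P : E → V) (l i : Fin 3) : V :=
  D.proj (D.cov (D.b l) (D.normalPart (D.cov (D.b i) P)) D.e₀)
    - ∑ k, D.G (D.F D.e₀) (D.frame k D.e₀) (D.cov (D.b l) (D.frame i) D.e₀) •
      D.proj (D.cov (D.b k) P D.e₀)

theorem frame_hessian (P : E → V) (l i k : Fin 3) :
    D.G (D.F D.e₀) (D.frame k D.e₀) (D.hessian P l i) = 0 := by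
  simp [hessian, frame_proj]

/-- The derivative of the inverse Gram matrix at the base point, where the Gram matrix is `1`. -/
theorem fderivWithin_gram_inv (i j : Fin 3) (v : E) :
    fderivWithin ℝ (fun e => (D.gram e)⁻¹ i j) D.S D.e₀ v
      = -(D.G (D.F D.e₀) (D.frame j D.e₀) (D.cov v (D.frame i) D.e₀)
        + D.G (D.F D.e₀) (D.frame i D.e₀) (D.cov v (D.frame j) D.e₀)) := by
  have e : (fun e => ∑ k, D.gram e i k * (D.gram e)⁻¹ k j)
      =ᶠ[nhdsWithin D.e₀ D.S] fun _ => (1 : Matrix (Fin 3) (Fin 3) ℝ) i j := by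
    filter_upwards [D.eventually_det_ne_zero] with e he
    rw [← Matrix.mul_nonsing_inv (D.gram e) (isUnit_iff_ne_zero.2 he)]
    rfl
  have h := DFunLike.congr_fun (e.fderivWithin_eq (𝕜 := ℝ) (e.self_of_nhdsWithin D.mem)) v
  rw [fderivWithin_fun_sum D.uniqueDiffWithinAt fun k _ =>
    (ContDiffWithinAt.mul (D.smooth_gram i k) (D.smooth_gram_inv k j)).differentiableWithinAt
      (by simp)] at h
  simp only [sum_apply, fderivWithin_fun_const, Pi.zero_apply, zero_apply] at h
  have hk : ∀ k, fderivWithin ℝ (fun e => D.gram e i k * (D.gram e)⁻¹ k j) D.S D.e₀ v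
      = (1 : Matrix (Fin 3) (Fin 3) ℝ) i k
          * fderivWithin ℝ (fun e => (D.gram e)⁻¹ k j) D.S D.e₀ v
        + (1 : Matrix (Fin 3) (Fin 3) ℝ) k j
          * fderivWithin ℝ (fun e => D.gram e i k) D.S D.e₀ v := by
    intro k
    rw [fderivWithin_fun_mul D.uniqueDiffWithinAt (D.smooth_gram i k).differentiableWithinAt
      (D.smooth_gram_inv k j).differentiableWithinAt]
    simp [gram_base]
  simp only [hk, Finset.sum_add_distrib, Matrix.one_apply, ite_mul, one_mul, zero_mul,
    Finset.sum_ite_eq, Finset.sum_ite_eq', Finset.mem_univ, if_true] at h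
  have hg : fderivWithin ℝ (fun e => D.gram e i j) D.S D.e₀ v = _ :=
    D.fderivWithin_metric (D.smooth_frame i) (D.smooth_frame j) v
  rw [hg, D.isAssociativeFrame.symm (D.cov v (D.frame i) D.e₀)] at h
  linarith

/-- The normal derivative of the Dirac operator. The derivatives of the inverse Gram matrix cancel
against the tangential derivatives of the coordinate frame. -/
theorem proj_cov_dirac {P : E → V} (hP : D.Smooth P) (l : Fin 3) :
    D.proj (D.cov (D.b l) (D.dirac P) D.e₀)
      = ∑ i, D.C (D.F D.e₀) (D.frame i D.e₀) (D.hessian P l i) := by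
  have hN := fun j => D.smooth_normalPart (hP.cov (D.b j))
  have hC := fun i j => D.smooth_cross.bilin (D.smooth_frame i) (hN j)
  have hCs : ∀ i j, D.Smooth fun e => (D.gram e)⁻¹ i j • D.C (D.F e) (D.frame i e)
      (D.normalPart (D.cov (D.b j) P) e) := fun i j =>
    ContDiffWithinAt.smul (D.smooth_gram_inv i j) (hC i j)
  have e : D.dirac P = fun e => ∑ i, ∑ j, (D.gram e)⁻¹ i j • D.C (D.F e) (D.frame i e)
    (D.normalPart (D.cov (D.b j) P) e) := rfl
  have hfr := D.isAssociativeFrame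
  have hnor : ∀ i j, D.G (D.F D.e₀) (D.frame i D.e₀) (D.proj (D.cov (D.b j) P D.e₀)) = 0 :=
    fun i j => D.frame_proj i _
  have h1 : ∀ i z, D.proj (D.C (D.F D.e₀) (D.frame i D.e₀) z)
      = D.C (D.F D.e₀) (D.frame i D.e₀) (D.proj z) := fun i z => (hfr.cross_normalProj i z).symm
  have h2 : ∀ j z, D.proj (D.C (D.F D.e₀) z (D.proj (D.cov (D.b j) P D.e₀)))
      = ∑ k, D.G (D.F D.e₀) (D.frame k D.e₀) z •
        D.C (D.F D.e₀) (D.frame k D.e₀) (D.proj (D.cov (D.b j) P D.e₀)) := fun j z =>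
    hfr.normalProj_cross_of_normal (hnor · j) z
  have h3 : ∀ j, D.proj (D.proj (D.cov (D.b j) P D.e₀)) = D.proj (D.cov (D.b j) P D.e₀) :=
    fun j => D.proj_of_normal (hnor · j)
  rw [e, D.cov_sum _ fun i _ => ContDiffWithinAt.sum fun j _ => hCs i j]
  simp only [D.cov_sum _ fun j _ => hCs _ j, D.cov_smul (D.smooth_gram_inv _ _) (hC _ _),
    D.cov_cross (D.smooth_frame _) (hN _), D.fderivWithin_gram_inv, D.normalPart_base,
    D.gram_inv_base, map_sum, map_add, map_neg, map_smul, h1, h2, h3, hessian, map_sub, ite_smul,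
    one_smul, zero_smul, Finset.sum_add_distrib, Finset.sum_ite_eq, Finset.mem_univ, if_true,
    Finset.sum_sub_distrib, neg_smul, Finset.sum_neg_distrib, add_smul]
  rw [Finset.sum_comm (f := fun x y => D.G (D.F D.e₀) (D.frame y D.e₀)
    (D.cov (D.b l) (D.frame x) D.e₀) • D.C (D.F D.e₀) (D.frame y D.e₀)
      (D.proj (D.cov (D.b x) P D.e₀)))]
  abel

/-- The shape operator of a normal field is adjoint to the second fundamental form. -/
theorem frame_cov_of_normal {P : E → V} (hP : D.Smooth P)
    (hn : ∀ᶠ e in nhdsWithin D.e₀ D.S, ∀ i, D.G (D.F e) (D.frame i e) (P e) = 0) (i j : Fin 3) :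
    D.G (D.F D.e₀) (D.frame j D.e₀) (D.cov (D.b i) P D.e₀)
      = -D.G (D.F D.e₀) (P D.e₀) (D.secondForm i j) := by
  have hfr := D.isAssociativeFrame
  have hP0 : ∀ i, D.G (D.F D.e₀) (D.frame i D.e₀) (P D.e₀) = 0 := hn.self_of_nhdsWithin D.mem
  have e : (fun e => D.G (D.F e) (D.frame j e) (P e)) =ᶠ[nhdsWithin D.e₀ D.S] fun _ => 0 := by
    filter_upwards [hn] with e he using he j
  have h := D.fderivWithin_metric (D.smooth_frame j) hP (D.b i)
  rw [e.fderivWithin_eq (e.self_of_nhdsWithin D.mem)] at h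
  simp only [fderivWithin_fun_const, Pi.zero_apply, zero_apply] at h
  have h2 : D.G (D.F D.e₀) (P D.e₀) (D.secondForm i j)
      = D.G (D.F D.e₀) (D.cov (D.b i) (D.frame j) D.e₀) (P D.e₀) := by
    rw [secondForm, proj, normalProj_apply, map_sub, map_sum, hfr.symm]
    simp [hfr.symm (P D.e₀), hP0]
  linarith

theorem dirac_congr {P Q : E → V} (h : P =ᶠ[nhdsWithin D.e₀ D.S] Q) :
    D.dirac P D.e₀ = D.dirac Q D.e₀ := by
  simp only [dirac, D.normalPart_base, D.cov_congr h]

/-- The Weitzenböck formula in coordinates. -/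
theorem dirac_dirac {P : E → V} (hP : D.Smooth P)
    (hn : ∀ᶠ e in nhdsWithin D.e₀ D.S, ∀ i, D.G (D.F e) (D.frame i e) (P e) = 0) :
    D.dirac (D.dirac P) D.e₀ = -∑ i, D.hessian P i i
      + D.proj (∑ i, coordCurvature D.Γ (D.F D.e₀) (D.frame i D.e₀) (P D.e₀) (D.frame i D.e₀))
      - ∑ i, ∑ j, D.G (D.F D.e₀) (P D.e₀) (D.secondForm i j) • D.secondForm i j := by
  have hfr := D.isAssociativeFrame
  have h0 : D.dirac (D.dirac P) D.e₀ = ∑ l, D.C (D.F D.e₀) (D.frame l D.e₀)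
      (∑ i, D.C (D.F D.e₀) (D.frame i D.e₀) (D.hessian P l i)) := by
    simp only [← D.proj_cov_dirac hP]
    simp [dirac, D.gram_inv_base, D.normalPart_base]
  have hshape := D.frame_cov_of_normal hP hn
  rw [h0]
  have hcross : ∀ l k i m : Fin 3, D.C (D.F D.e₀) (D.frame k D.e₀) (D.frame i D.e₀)
      = D.frame m D.e₀ → D.secondForm l m
      = D.C (D.F D.e₀) (D.secondForm l k) (D.frame i D.e₀)
        + D.C (D.F D.e₀) (D.frame k D.e₀) (D.secondForm l i) := by
    intro l k i m h
    rw [← D.sum_secondForm_cross, h]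
    simp [hfr.ortho]
  -- What remains is algebra at the base point, once the skew part of the Hessian is identified.
  refine hfr.sum_cross_cross_hessian
    (K := fun i z => coordCurvature D.Γ (D.F D.e₀) (D.frame i D.e₀) (P D.e₀) z)
    (p := fun l i => coordCurvature D.Γ (D.F D.e₀) (D.frame l D.e₀) (D.frame i D.e₀) (P D.e₀))
    (D.frame_hessian P) ?_ ?_ ?_ D.secondForm_comm (fun l => hcross l _ _ _ hfr.cross_one_two)
    (fun l => hcross l _ _ _ hfr.cross_two_zero) (fun l => hcross l _ _ _ hfr.cross_zero_one)
  · intro l i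
    have hc := congrArg D.proj (D.cov_cov_sub hP (D.b l) (D.b i))
    rw [map_sub] at hc
    change _ = D.proj _ + _
    change _ = D.proj (coordCurvature D.Γ (D.F D.e₀) (D.frame l D.e₀) (D.frame i D.e₀)
      (P D.e₀)) at hc
    rw [← hc, hessian, hessian, D.proj_cov_normalPart (hP.cov _), D.proj_cov_normalPart (hP.cov _),
      D.cov_frame_comm l i]
    simp only [hshape, neg_smul, Finset.sum_neg_distrib, Finset.sum_sub_distrib]
    abel
  · exact fun l i => D.isParallelCross.bianchi D.map_mem _ _ _
  · exact fun l i j => D.isParallelCross.curvature_cross D.map_mem _ _ _ _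

end AssociativeGerm

/-! ### Vector fields along a map, in coordinates -/

section Along

variable {H : Type*} [TopologicalSpace H] {I : ModelWithCorners ℝ (Eu 3) H}
  {Y : Type*} [TopologicalSpace Y] [ChartedSpace H Y] [IsManifold I ∞ Y]
  {n : ℕ} {M : Type*} [TopologicalSpace M] [ChartedSpace (Eu n) M] [IsManifold (𝓡 n) ∞ M]

variable (I) in
/-- The vector field on `Y` with constant components `a` in the chart around `y₀`. -/
def chartField (y₀ : Y) (a : Eu 3) (y : Y) : TangentSpace I y :=
  (trivializationAt (Eu 3) (TangentSpace I : Y → Type _) y₀).symmL ℝ y a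

variable (I) in
/-- The components of a tangent vector of `Y` in the chart around `y₀`. -/
def chartCoord (y₀ y : Y) : TangentSpace I y →L[ℝ] Eu 3 :=
  (trivializationAt (Eu 3) (TangentSpace I : Y → Type _) y₀).continuousLinearMapAt ℝ y

theorem chartField_chartCoord {y₀ y : Y} (hy : y ∈ (extChartAt I y₀).source)
    (v : TangentSpace I y) : chartField I y₀ (chartCoord I y₀ y v) y = v :=
  Trivialization.symmL_continuousLinearMapAt _ (by simpa using hy) v

theorem chartCoord_chartField {y₀ y : Y} (hy : y ∈ (extChartAt I y₀).source)
    (a : Eu 3) : chartCoord I y₀ y (chartField I y₀ a y) = a :=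
  Trivialization.continuousLinearMapAt_symmL _ (by simpa using hy) a

theorem extend_eq_chartField {y₀ : Y} (v : TangentSpace I y₀) {y : Y}
    (hy : y ∈ (extChartAt I y₀).source) :
    FiberBundle.extend (Eu 3) v y = chartField I y₀ (chartCoord I y₀ y₀ v) y := by
  have hb : y ∈ (trivializationAt (Eu 3) (TangentSpace I : Y → Type _) y₀).baseSet := by
    simpa using hy
  rw [FiberBundle.extend, chartField, chartCoord,
    Trivialization.continuousLinearMapAt_apply, Trivialization.linearMapAt_apply,
    if_pos (FiberBundle.mem_baseSet_trivializationAt' y₀)]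
  exact (Trivialization.symmL_apply (R := ℝ) _ hb _).symm

/-- The derivative of a map on `Y` along a field with constant components. -/
theorem mvfderiv_chartField {W : Type*} [NormedAddCommGroup W] [NormedSpace ℝ W] {h : Y → W}
    {y₀ : Y} {e : Eu 3} (he : e ∈ (extChartAt I y₀).target)
    (hd : DifferentiableWithinAt ℝ (h ∘ (extChartAt I y₀).symm) (Set.range I) e) (a : Eu 3) :
    mvfderiv I h ((extChartAt I y₀).symm e) (chartField I y₀ a ((extChartAt I y₀).symm e))
      = fderivWithin ℝ (h ∘ (extChartAt I y₀).symm) (Set.range I) e a := by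
  set y := (extChartAt I y₀).symm e with hy
  have hys : y ∈ (extChartAt I y₀).source := (extChartAt I y₀).map_target he
  have hye : extChartAt I y₀ y = e := (extChartAt I y₀).right_inv he
  have h1 : HasMFDerivWithinAt 𝓘(ℝ, Eu 3) 𝓘(ℝ, W) (h ∘ (extChartAt I y₀).symm) (Set.range I)
      (extChartAt I y₀ y) (fderivWithin ℝ (h ∘ (extChartAt I y₀).symm) (Set.range I) e) := by
    rw [hye]
    exact HasFDerivWithinAt.hasMFDerivWithinAt hd.hasFDerivWithinAt
  have h2 : HasMFDerivAt I 𝓘(ℝ, Eu 3) (extChartAt I y₀) y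
      (mfderiv I 𝓘(ℝ, Eu 3) (extChartAt I y₀) y) :=
    (mdifferentiableAt_extChartAt (by simpa using hys)).hasMFDerivAt
  have h3 := HasMFDerivWithinAt.comp y h1 (hasMFDerivWithinAt_univ.2 h2)
    (fun z _ => by exact Set.mem_range_self _)
  rw [hasMFDerivWithinAt_univ] at h3
  have h4 : h =ᶠ[nhds y] (h ∘ (extChartAt I y₀).symm) ∘ extChartAt I y₀ := by
    filter_upwards [(isOpen_extChartAt_source y₀).mem_nhds hys] with z hz
    simp only [Function.comp_apply]
    rw [(extChartAt I y₀).left_inv hz]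
  have h5 := h3.congr_of_eventuallyEq h4
  -- The differential of the chart maps the field to its components.
  have h6 : mfderiv I 𝓘(ℝ, Eu 3) (extChartAt I y₀) y (chartField I y₀ a y) = a := by
    have := TangentBundle.continuousLinearMapAt_trivializationAt (I := I) (x₀ := y₀) (x := y)
      (by simpa using hys)
    have h7 := chartCoord_chartField (I := I) hys a
    rw [chartCoord, this] at h7
    exact h7
  rw [mvfderiv, h5.mfderiv]
  change fderivWithin ℝ (h ∘ (extChartAt I y₀).symm) (Set.range I) e _ = _
  exact congrArg _ h6

variable (I) in
/-- The map `f` in the charts around `y₀` and `f y₀`. -/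
def coordMap (f : Y → M) (y₀ : Y) (e : Eu 3) : Eu n :=
  extChartAt (𝓡 n) (f y₀) (f ((extChartAt I y₀).symm e))

variable (I) in
/-- The components of a vector field along `f` in the charts around `y₀` and `f y₀`. -/
def coordField (f : Y → M) (y₀ : Y) (ψ : ∀ y : Y, TangentSpace (𝓡 n) (f y)) (e : Eu 3) : Eu n :=
  toCoords (f y₀) (f ((extChartAt I y₀).symm e)) (ψ ((extChartAt I y₀).symm e))

variable (I) in
/-- The points of the chart around `y₀` which `f` maps to the chart around `f y₀`; elsewhere
`coordMap` and `coordField` have no meaning. -/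
def coordDomain (f : Y → M) (y₀ : Y) : Set (Eu 3) :=
  (extChartAt I y₀).target ∩
    (fun e => f ((extChartAt I y₀).symm e)) ⁻¹' (extChartAt (𝓡 n) (f y₀)).source

variable {f : Y → M} {y₀ : Y}

theorem base_mem_coordDomain : extChartAt I y₀ y₀ ∈ coordDomain (n := n) I f y₀ := by
  refine ⟨mem_extChartAt_target y₀, ?_⟩
  rw [Set.mem_preimage, extChartAt_to_inv]
  exact mem_extChartAt_source _

theorem coordDomain_mem_nhdsWithin (hf : Continuous f) {e : Eu 3}
    (he : e ∈ coordDomain (n := n) I f y₀) :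
    coordDomain (n := n) I f y₀ ∈ nhdsWithin e (Set.range I) := by
  refine Filter.inter_mem (extChartAt_target_mem_nhdsWithin_of_mem he.1) ?_
  have h1 : ContinuousWithinAt (extChartAt I y₀).symm (Set.range I) e :=
    ((continuousOn_extChartAt_symm y₀) e he.1).mono_of_mem_nhdsWithin
      (extChartAt_target_mem_nhdsWithin_of_mem he.1)
  exact (hf.continuousAt.comp_continuousWithinAt h1)
    ((isOpen_extChartAt_source (f y₀)).mem_nhds he.2)

theorem coordMap_mem_target {e : Eu 3} (he : e ∈ coordDomain (n := n) I f y₀) :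
    coordMap I f y₀ e ∈ (extChartAt (𝓡 n) (f y₀)).target :=
  (extChartAt (𝓡 n) (f y₀)).map_source he.2

theorem extChartAt_symm_coordMap {e : Eu 3} (he : e ∈ coordDomain (n := n) I f y₀) :
    (extChartAt (𝓡 n) (f y₀)).symm (coordMap I f y₀ e) = f ((extChartAt I y₀).symm e) :=
  (extChartAt (𝓡 n) (f y₀)).left_inv he.2

theorem contDiffWithinAt_of_contMDiffAt {W : Type*} [NormedAddCommGroup W] [NormedSpace ℝ W]
    {h : Y → W} {e : Eu 3} (he : e ∈ (extChartAt I y₀).target)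
    (hh : ContMDiffAt I 𝓘(ℝ, W) ∞ h ((extChartAt I y₀).symm e)) :
    ContDiffWithinAt ℝ ∞ (h ∘ (extChartAt I y₀).symm) (Set.range I) e := by
  have h1 : ContMDiffWithinAt 𝓘(ℝ, Eu 3) I ∞ (extChartAt I y₀).symm (Set.range I) e :=
    (contMDiffOn_extChartAt_symm y₀ e he).mono_of_mem_nhdsWithin
      (extChartAt_target_mem_nhdsWithin_of_mem he)
  exact (hh.comp_contMDiffWithinAt e h1).contDiffWithinAt

theorem contMDiffAt_coordMap (hf : ContMDiff I (𝓡 n) ∞ f) {y : Y}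
    (hy : f y ∈ (extChartAt (𝓡 n) (f y₀)).source) :
    ContMDiffAt I 𝓘(ℝ, Eu n) ∞ (fun y => extChartAt (𝓡 n) (f y₀) (f y)) y :=
  (contMDiffAt_extChartAt' (by simpa using hy)).comp y hf.contMDiffAt

theorem contDiffWithinAt_coordMap (hf : ContMDiff I (𝓡 n) ∞ f) {e : Eu 3}
    (he : e ∈ coordDomain (n := n) I f y₀) :
    ContDiffWithinAt ℝ ∞ (coordMap (n := n) I f y₀) (Set.range I) e :=
  contDiffWithinAt_of_contMDiffAt he.1 (contMDiffAt_coordMap hf he.2)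

/-- A vector field along `f` is smooth at a point iff its components are. -/
theorem contMDiffAt_along_iff (hf : ContMDiff I (𝓡 n) ∞ f)
    {ψ : ∀ y : Y, TangentSpace (𝓡 n) (f y)} {x₀ : M} {y : Y}
    (hy : f y ∈ (extChartAt (𝓡 n) x₀).source) :
    ContMDiffAt I (𝓡 n).tangent ∞ (fun y => (⟨f y, ψ y⟩ : TangentBundle (𝓡 n) M)) y ↔
      ContMDiffAt I 𝓘(ℝ, Eu n) ∞ (fun y => toCoords x₀ (f y) (ψ y)) y := by
  have hb : f y ∈ (trivializationAt (Eu n) (TangentSpace (𝓡 n) : M → Type _) x₀).baseSet := by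
    simpa using hy
  rw [Bundle.Trivialization.contMDiffAt_iff
    (e := trivializationAt (Eu n) (TangentSpace (𝓡 n) : M → Type _) x₀)
    (by rw [Trivialization.mem_source]; exact hb)]
  have h1 : ∀ᶠ z in nhds y, toCoords x₀ (f z) (ψ z)
      = (trivializationAt (Eu n) (TangentSpace (𝓡 n) : M → Type _) x₀ ⟨f z, ψ z⟩).2 := by
    filter_upwards [hf.continuous.continuousAt.preimage_mem_nhds
      ((trivializationAt (Eu n) (TangentSpace (𝓡 n) : M → Type _) x₀).open_baseSet.mem_nhds hb)]
      with z hz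
    rw [toCoords, Trivialization.continuousLinearMapAt_apply,
      Trivialization.linearMapAt_apply, if_pos (Set.mem_preimage.1 hz)]
  constructor
  · exact fun h => h.2.congr_of_eventuallyEq h1
  · exact fun h => ⟨hf.contMDiffAt, h.congr_of_eventuallyEq (h1.mono fun z hz => hz.symm)⟩

theorem contDiffWithinAt_coordField (hf : ContMDiff I (𝓡 n) ∞ f)
    {ψ : ∀ y : Y, TangentSpace (𝓡 n) (f y)} {e : Eu 3} (he : e ∈ coordDomain (n := n) I f y₀)
    (hψ : ContMDiffAt I (𝓡 n).tangent ∞ (fun y => (⟨f y, ψ y⟩ : TangentBundle (𝓡 n) M))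
      ((extChartAt I y₀).symm e)) :
    ContDiffWithinAt ℝ ∞ (coordField (n := n) I f y₀ ψ) (Set.range I) e :=
  contDiffWithinAt_of_contMDiffAt he.1 ((contMDiffAt_along_iff hf he.2).1 hψ)

theorem contMDiffAt_of_coordField (hf : ContMDiff I (𝓡 n) ∞ f)
    {ψ : ∀ y : Y, TangentSpace (𝓡 n) (f y)}
    (hψ : ContDiffWithinAt ℝ ∞ (coordField (n := n) I f y₀ ψ) (Set.range I) (extChartAt I y₀ y₀)) :
    ContMDiffAt I (𝓡 n).tangent ∞ (fun y => (⟨f y, ψ y⟩ : TangentBundle (𝓡 n) M)) y₀ := by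
  rw [contMDiffAt_along_iff hf (mem_extChartAt_source (f y₀))]
  have h1 : ContMDiffAt I 𝓘(ℝ, Eu n) ∞
      (coordField (n := n) I f y₀ ψ ∘ extChartAt I y₀) y₀ :=
    ContMDiffWithinAt.comp y₀ hψ.contMDiffWithinAt contMDiffAt_extChartAt
      (fun z _ => by exact Set.mem_range_self _)
  refine h1.congr_of_eventuallyEq ?_
  filter_upwards [(isOpen_extChartAt_source (I := I) y₀).mem_nhds (mem_extChartAt_source y₀)]
    with z hz
  simp only [Function.comp_apply, coordField]
  rw [(extChartAt I y₀).left_inv hz]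

end Along

/-! ### Differential and covariant derivative along a map, in coordinates -/

section AlongDeriv

variable {H : Type*} [TopologicalSpace H] {I : ModelWithCorners ℝ (Eu 3) H}
  {Y : Type*} [TopologicalSpace Y] [ChartedSpace H Y] [IsManifold I ∞ Y]
  {n : ℕ} {M : Type*} [TopologicalSpace M] [ChartedSpace (Eu n) M] [IsManifold (𝓡 n) ∞ M]
  {f : Y → M} {y₀ : Y} {e : Eu 3}

theorem toCoords_mfderiv_chartField (hf : ContMDiff I (𝓡 n) ∞ f)
    (he : e ∈ coordDomain (n := n) I f y₀) (a : Eu 3) :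
    toCoords (f y₀) (f ((extChartAt I y₀).symm e))
      (mfderiv I (𝓡 n) f ((extChartAt I y₀).symm e)
        (chartField I y₀ a ((extChartAt I y₀).symm e)))
      = fderivWithin ℝ (coordMap (n := n) I f y₀) (Set.range I) e a := by
  have h1 := mvfderiv_chartField (h := fun y => extChartAt (𝓡 n) (f y₀) (f y)) he.1
    ((contDiffWithinAt_coordMap hf he).differentiableWithinAt (by simp)) a
  have h2 : MDifferentiableAt (𝓡 n) 𝓘(ℝ, Eu n) (extChartAt (𝓡 n) (f y₀))
      (f ((extChartAt I y₀).symm e)) := mdifferentiableAt_extChartAt (by simpa using he.2)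
  have h3 := mfderiv_comp ((extChartAt I y₀).symm e) h2
    (hf.mdifferentiableAt (by simp) : MDifferentiableAt I (𝓡 n) f _)
  have h4 := TangentBundle.continuousLinearMapAt_trivializationAt (I := 𝓡 n) (x₀ := f y₀)
      (x := f ((extChartAt I y₀).symm e)) (by simpa using he.2)
  refine Eq.trans ?_ h1
  rw [toCoords, h4, mvfderiv]
  change _ = mfderiv I 𝓘(ℝ, Eu n) (extChartAt (𝓡 n) (f y₀) ∘ f) ((extChartAt I y₀).symm e) _
  rw [h3]
  rfl

theorem mfderiv_chartField (hf : ContMDiff I (𝓡 n) ∞ f)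
    (he : e ∈ coordDomain (n := n) I f y₀) (a : Eu 3) :
    mfderiv I (𝓡 n) f ((extChartAt I y₀).symm e) (chartField I y₀ a ((extChartAt I y₀).symm e))
      = fromCoords (f y₀) (f ((extChartAt I y₀).symm e))
        (fderivWithin ℝ (coordMap (n := n) I f y₀) (Set.range I) e a) := by
  rw [← toCoords_mfderiv_chartField hf he, fromCoords_toCoords he.2]

theorem fromCoords_coordField (he : e ∈ coordDomain (n := n) I f y₀)
    (ψ : ∀ y : Y, TangentSpace (𝓡 n) (f y)) :
    fromCoords (f y₀) (f ((extChartAt I y₀).symm e)) (coordField I f y₀ ψ e)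
      = ψ ((extChartAt I y₀).symm e) :=
  fromCoords_toCoords he.2 _

theorem toCoords_eq_fderiv_transition {x₀ x₁ x : M} (h0 : x ∈ (extChartAt (𝓡 n) x₀).source)
    (h1 : x ∈ (extChartAt (𝓡 n) x₁).source) (v : TangentSpace (𝓡 n) x) :
    toCoords x₁ x v
      = fderiv ℝ (transition x₀ x₁) (extChartAt (𝓡 n) x₀ x) (toCoords x₀ x v) := by
  obtain ⟨u, hu, rfl⟩ : ∃ u ∈ (extChartAt (𝓡 n) x₀).target, (extChartAt (𝓡 n) x₀).symm u = x :=
    ⟨extChartAt (𝓡 n) x₀ x, (extChartAt (𝓡 n) x₀).map_source h0,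
      (extChartAt (𝓡 n) x₀).left_inv h0⟩
  rw [(extChartAt (𝓡 n) x₀).right_inv hu, ← toCoords_fromCoords_eq_fderiv ⟨hu, h1⟩,
    fromCoords_toCoords h0]

variable [RiemannianBundle (fun x : M => TangentSpace (𝓡 n) x)]
variable [IsContMDiffRiemannianBundle (𝓡 n) ∞ (Eu n) (fun x : M => TangentSpace (𝓡 n) x)]

/-- The covariant derivative along `f`, which is defined at each point in the chart around this
point, is given by the same formula in any other chart. -/
theorem covDeriv_chartField (hf : ContMDiff I (𝓡 n) ∞ f) (he : e ∈ coordDomain (n := n) I f y₀)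
    {ψ : ∀ y : Y, TangentSpace (𝓡 n) (f y)}
    (hψ : DifferentiableWithinAt ℝ (coordField (n := n) I f y₀ ψ) (Set.range I) e) (a : Eu 3) :
    covDeriv I f ψ ((extChartAt I y₀).symm e) (chartField I y₀ a ((extChartAt I y₀).symm e))
      = fromCoords (f y₀) (f ((extChartAt I y₀).symm e))
        (fderivWithin ℝ (coordField (n := n) I f y₀ ψ) (Set.range I) e a
          + chartChristoffel (f y₀) (coordMap I f y₀ e)
            (fderivWithin ℝ (coordMap (n := n) I f y₀) (Set.range I) e a)
            (coordField I f y₀ ψ e)) := by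
  set y := (extChartAt I y₀).symm e with hy
  set F := coordMap (n := n) I f y₀ with hF
  set P := coordField (n := n) I f y₀ ψ with hP
  set τ : Eu n → Eu n := transition (f y₀) (f y) with hτ
  have hu : ∀ e' ∈ coordDomain (n := n) I f y₀,
      f ((extChartAt I y₀).symm e') ∈ (extChartAt (𝓡 n) (f y)).source →
      F e' ∈ (transitionDomain (f y₀) (f y) : Set (Eu n)) := fun e' h1 h2 => by
    refine ⟨coordMap_mem_target h1, ?_⟩
    rw [Set.mem_preimage, extChartAt_symm_coordMap h1]
    exact h2
  have hue : F e ∈ (transitionDomain (f y₀) (f y) : Set (Eu n)) :=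
    hu e he (mem_extChartAt_source (f y))
  have hFd : DifferentiableWithinAt ℝ F (Set.range I) e :=
    (contDiffWithinAt_coordMap hf he).differentiableWithinAt (by simp)
  have hτd : DifferentiableAt ℝ (fderiv ℝ τ) (F e) :=
    ((contDiffAt_transition hue).fderiv_right (m := 1) (by
      exact one_add_one_le_infty)).differentiableAt (by simp)
  have hU : UniqueDiffWithinAt ℝ (Set.range I) e :=
    I.uniqueDiffOn _ (extChartAt_target_subset_range y₀ he.1)
  have hτF : DifferentiableWithinAt ℝ (fun e' => fderiv ℝ τ (F e')) (Set.range I) e :=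
    DifferentiableAt.comp_differentiableWithinAt e hτd hFd
  -- In the chart around `f y`, the components of `ψ` are `dτ(F) P`.
  have h1 : (fun y' => toCoords (f y) (f y') (ψ y')) ∘ (extChartAt I y₀).symm
      =ᶠ[nhdsWithin e (Set.range I)] fun e' => fderiv ℝ τ (F e') (P e') := by
    have hc : Filter.Tendsto (fun e' => f ((extChartAt I y₀).symm e')) (nhdsWithin e (Set.range I))
        (nhds (f y)) := by
      have h1 : ContinuousWithinAt (extChartAt I y₀).symm (Set.range I) e :=
        ((continuousOn_extChartAt_symm y₀) e he.1).mono_of_mem_nhdsWithin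
          (extChartAt_target_mem_nhdsWithin_of_mem he.1)
      exact hf.continuous.continuousAt.comp_continuousWithinAt h1
    filter_upwards [coordDomain_mem_nhdsWithin hf.continuous he,
      hc ((isOpen_extChartAt_source (I := 𝓡 n) (f y)).mem_nhds (mem_extChartAt_source (f y)))]
      with e' h2 h3
    exact toCoords_eq_fderiv_transition h2.2 h3 _
  have h1e : toCoords (f y) (f y) (ψ y) = fderiv ℝ τ (F e) (P e) :=
    h1.self_of_nhdsWithin (extChartAt_target_subset_range y₀ he.1)
  have h2 : mvfderiv I (fun y' => toCoords (f y) (f y') (ψ y')) y (chartField I y₀ a y)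
      = fderiv ℝ (fderiv ℝ τ) (F e) (fderivWithin ℝ F (Set.range I) e a) (P e)
        + fderiv ℝ τ (F e) (fderivWithin ℝ P (Set.range I) e a) := by
    rw [hy, mvfderiv_chartField he.1 ((hτF.clm_apply hψ).congr_of_eventuallyEq h1 h1e),
      h1.fderivWithin_eq (𝕜 := ℝ) h1e, fderivWithin_clm_apply hU hτF hψ]
    have h3 := fderiv_comp_fderivWithin e hτd hFd hU
    rw [Function.comp_def] at h3
    rw [h3]
    simp only [add_apply, ContinuousLinearMap.coe_comp, Function.comp_apply,
      ContinuousLinearMap.flip_apply]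
    abel
  have h4 : toCoords (f y) (f y) (mfderiv I (𝓡 n) f y (chartField I y₀ a y))
      = fderiv ℝ τ (F e) (fderivWithin ℝ F (Set.range I) e a) := by
    rw [← toCoords_mfderiv_chartField hf he a]
    exact toCoords_eq_fderiv_transition he.2 (mem_extChartAt_source (f y)) _
  have h5 : extChartAt (𝓡 n) (f y) (f y) = τ (F e) := by
    rw [hτ, transition, Function.comp_apply, extChartAt_symm_coordMap he]
  -- The term `D²τ` is absorbed by the transformation law of the Christoffel symbols.
  rw [covDeriv, h2, h4, h1e, christoffelVec_eq, h5, add_comm (fderiv ℝ (fderiv ℝ τ) (F e) _ _),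
    add_assoc, ← fderiv_transition_chartChristoffel hue, ← map_add]
  have h6 : ∀ z : Eu n, fromCoords (f y) (f y) (fderiv ℝ τ (F e) z)
      = fromCoords (f y₀) (f y) z := by
    intro z
    have := toCoords_eq_fderiv_transition he.2 (mem_extChartAt_source (f y))
      (fromCoords (f y₀) (f y) z)
    rw [toCoords_fromCoords he.2] at this
    change _ = fderiv ℝ τ (F e) z at this
    rw [← this, fromCoords_toCoords (mem_extChartAt_source (f y))]
  exact h6 _

end AlongDeriv

/-! ### Projections and traces in terms of a basis of a subspace -/

section Subspace

variable {V W : Type*} [NormedAddCommGroup V] [InnerProductSpace ℝ V] [FiniteDimensional ℝ V]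
  [AddCommGroup W] [Module ℝ W] {T : Submodule ℝ V} {ι : Type*} [Fintype ι] [DecidableEq ι]
  {w : ι → V} {Q : Matrix ι ι ℝ}

/-- The orthogonal projection in terms of a basis with Gram matrix `Q`. -/
theorem orthoProj_of_span (hw : Submodule.span ℝ (Set.range w) = T)
    (hQ : ∀ i j, Q i j = inner ℝ (w i) (w j)) (hd : Q.det ≠ 0) (z : V) :
    orthoProj T z = ∑ j, (∑ i, Q⁻¹ j i * inner ℝ (w i) z) • w j := by
  have hwT : ∀ i, w i ∈ T := fun i => hw ▸ Submodule.subset_span (Set.mem_range_self i)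
  refine (Submodule.eq_starProjection_of_mem_orthogonal
    (T.sum_mem fun j _ => T.smul_mem _ (hwT j)) ?_)
  rw [← hw, Submodule.mem_orthogonal]
  intro u hu
  induction hu using Submodule.span_induction with
  | mem x hx =>
    obtain ⟨k, rfl⟩ := hx
    have h1 : ∑ j, (Q k j) * (∑ i, Q⁻¹ j i * inner ℝ (w i) z) = inner ℝ (w k) z := by
      have h2 : Q.mulVec (Q⁻¹.mulVec fun i => inner ℝ (w i) z) = fun i => inner ℝ (w i) z := by
        rw [Matrix.mulVec_mulVec, Matrix.mul_nonsing_inv Q (isUnit_iff_ne_zero.2 hd),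
          Matrix.one_mulVec]
      exact congrFun h2 k
    rw [inner_sub_right, inner_sum, ← h1, sub_eq_zero]
    exact Finset.sum_congr rfl fun j _ => by rw [inner_smul_right, hQ, mul_comm]
  | zero => simp
  | add x y _ _ hx hy => rw [inner_add_left, hx, hy, add_zero]
  | smul r x _ hx => rw [inner_smul_left, hx, mul_zero]

theorem orthoProj_orthogonal (z : V) : orthoProj Tᗮ z = z - orthoProj T z := by
  rw [orthoProj, orthoProj, Submodule.starProjection_orthogonal_val]

theorem orthoProj_of_mem {z : V} (hz : z ∈ T) : orthoProj T z = z :=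
  Submodule.starProjection_eq_self_iff.2 hz

/-- The trace of a bilinear form on a subspace, in terms of an arbitrary basis of the subspace. -/
theorem frameSum_bilin (hw : Submodule.span ℝ (Set.range w) = T)
    (hQ : ∀ i j, Q i j = inner ℝ (w i) (w j)) (hd : Q.det ≠ 0) (β : V →ₗ[ℝ] V →ₗ[ℝ] W) :
    frameSum T (fun t => β t t) = ∑ i, ∑ j, Q⁻¹ i j • β (w i) (w j) := by
  have hwT : ∀ i, w i ∈ T := fun i => hw ▸ Submodule.subset_span (Set.mem_range_self i)
  set t := stdOrthonormalBasis ℝ T with ht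
  set c : ι → V → ℝ := fun j z => ∑ i, Q⁻¹ j i * inner ℝ (w i) z with hc
  have h1 : ∀ k, (t k : V) = ∑ j, c j (t k) • w j := fun k => by
    rw [← orthoProj_of_span hw hQ hd, orthoProj_of_mem (t k).2]
  have h2 : ∀ i m, ∑ k, (inner ℝ (w i) (t k : V) : ℝ) * inner ℝ (w m) (t k : V) = Q i m := by
    intro i m
    have := t.sum_inner_mul_inner ⟨w i, hwT i⟩ ⟨w m, hwT m⟩
    simp only [Submodule.coe_inner] at this
    rw [hQ, ← this]
    exact Finset.sum_congr rfl fun k _ => by rw [real_inner_comm (w m)]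
  have hsymm : Q.transpose = Q := by
    ext i j
    rw [Matrix.transpose_apply, hQ, hQ, real_inner_comm]
  have h3 : ∀ j l, ∑ k, c j (t k) * c l (t k) = Q⁻¹ j l := by
    intro j l
    have h4 : ∀ k, c j (t k) * c l (t k) = ∑ i, ∑ m, Q⁻¹ j i * Q⁻¹ l m *
        ((inner ℝ (w i) (t k : V) : ℝ) * inner ℝ (w m) (t k : V)) := fun k => by
      rw [hc, Finset.sum_mul_sum]
      exact Finset.sum_congr rfl fun i _ => Finset.sum_congr rfl fun m _ => by ring
    simp only [h4]
    rw [Finset.sum_comm]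
    have h5 : ∀ i, ∑ k, ∑ m, Q⁻¹ j i * Q⁻¹ l m *
        ((inner ℝ (w i) (t k : V) : ℝ) * inner ℝ (w m) (t k : V)) = Q⁻¹ j i * (Q * Q⁻¹) i l := by
      intro i
      rw [Finset.sum_comm, Matrix.mul_apply, Finset.mul_sum]
      refine Finset.sum_congr rfl fun m _ => ?_
      rw [← Finset.mul_sum, h2]
      have : Q⁻¹ l m = Q⁻¹ m l := by
        conv_lhs => rw [← hsymm, ← Matrix.transpose_nonsing_inv, Matrix.transpose_apply]
      rw [this]; ring
    simp only [h5]
    rw [Matrix.mul_nonsing_inv Q (isUnit_iff_ne_zero.2 hd)]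
    simp [Matrix.one_apply]
  have h6 : ∀ k, β (t k) (t k) = ∑ i, ∑ j, (c i (t k) * c j (t k)) • β (w i) (w j) := fun k => by
    conv_lhs => rw [h1 k]
    simp only [map_sum, map_smul, LinearMap.sum_apply, LinearMap.smul_apply, Finset.smul_sum,
      smul_smul]
    rw [Finset.sum_comm]
    exact Finset.sum_congr rfl fun i _ => Finset.sum_congr rfl fun j _ => by rw [mul_comm]
  rw [frameSum, Finset.sum_congr rfl fun k _ => h6 k, Finset.sum_comm]
  refine Finset.sum_congr rfl fun i _ => ?_
  rw [Finset.sum_comm]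
  refine Finset.sum_congr rfl fun j _ => ?_
  rw [← Finset.sum_smul, h3]

/-- The expansion of a vector of the subspace in an orthonormal basis of the subspace. -/
theorem frameSum_inner_smul {z : V} (hz : z ∈ T) :
    frameSum T (fun t => (inner ℝ z t : ℝ) • t) = z := by
  have := (stdOrthonormalBasis ℝ T).sum_repr' ⟨z, hz⟩
  have h2 := congrArg (Submodule.subtype T) this
  simp only [map_sum, map_smul, Submodule.subtype_apply, Submodule.coe_inner] at h2
  conv_rhs => rw [← h2]
  exact Finset.sum_congr rfl fun i _ => by rw [real_inner_comm]

end Subspace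

/-! ### Tangential and normal parts -/

section TangentPart

variable {H : Type*} [TopologicalSpace H] {I : ModelWithCorners ℝ (Eu 3) H}
  {Y : Type*} [TopologicalSpace Y] [ChartedSpace H Y] [IsManifold I ∞ Y]
  {n : ℕ} {M : Type*} [TopologicalSpace M] [ChartedSpace (Eu n) M] [IsManifold (𝓡 n) ∞ M]
  [RiemannianBundle (fun x : M => TangentSpace (𝓡 n) x)] {f : Y → M} {y : Y}

theorem projTan_of_mem {z : TangentSpace (𝓡 n) (f y)} (hz : z ∈ tangentSub I f y) :
    projTan I f y z = z := orthoProj_of_mem (V := TangentSpace (𝓡 n) (f y)) hz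

theorem projNor_of_mem {z : TangentSpace (𝓡 n) (f y)} (hz : z ∈ normalSub I f y) :
    projNor I f y z = z := orthoProj_of_mem (V := TangentSpace (𝓡 n) (f y)) hz

theorem projNor_mem (z : TangentSpace (𝓡 n) (f y)) : projNor I f y z ∈ normalSub I f y :=
  orthoProj_mem (V := TangentSpace (𝓡 n) (f y)) _ z

theorem projNor_eq_sub (z : TangentSpace (𝓡 n) (f y)) :
    projNor I f y z = z - projTan I f y z :=
  orthoProj_orthogonal (V := TangentSpace (𝓡 n) (f y)) z

theorem projNor_add (z z' : TangentSpace (𝓡 n) (f y)) :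
    projNor I f y (z + z') = projNor I f y z + projNor I f y z' := by
  simp [projNor, orthoProj]

theorem projNor_smul (r : ℝ) (z : TangentSpace (𝓡 n) (f y)) :
    projNor I f y (r • z) = r • projNor I f y z := by
  simp [projNor, orthoProj]

theorem mem_normalSub_iff {z : TangentSpace (𝓡 n) (f y)} :
    z ∈ normalSub I f y ↔ ∀ t ∈ tangentSub I f y, inner ℝ t z = 0 :=
  Submodule.mem_orthogonal _ _

theorem tangentPart_add (hi : Function.Injective (mfderiv I (𝓡 n) f y))
    (z z' : TangentSpace (𝓡 n) (f y)) :
    tangentPart I f y (z + z') = tangentPart I f y z + tangentPart I f y z' := by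
  apply hi
  rw [map_add, mfderiv_tangentPart, mfderiv_tangentPart, mfderiv_tangentPart]
  simp [projTan, orthoProj]

theorem tangentPart_smul (hi : Function.Injective (mfderiv I (𝓡 n) f y))
    (r : ℝ) (z : TangentSpace (𝓡 n) (f y)) :
    tangentPart I f y (r • z) = r • tangentPart I f y z := by
  apply hi
  rw [map_smul, mfderiv_tangentPart, mfderiv_tangentPart]
  simp [projTan, orthoProj]

theorem mfderiv_mem (v : TangentSpace I y) : mfderiv I (𝓡 n) f y v ∈ tangentSub I f y :=
  LinearMap.mem_range_self _ v

theorem tangentPart_mfderiv (hi : Function.Injective (mfderiv I (𝓡 n) f y))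
    (v : TangentSpace I y) : tangentPart I f y (mfderiv I (𝓡 n) f y v) = v := by
  apply hi
  rw [mfderiv_tangentPart, projTan_of_mem (mfderiv_mem v)]

theorem mfderiv_tangentPart_of_mem {z : TangentSpace (𝓡 n) (f y)} (hz : z ∈ tangentSub I f y) :
    mfderiv I (𝓡 n) f y (tangentPart I f y z) = z := by
  rw [mfderiv_tangentPart, projTan_of_mem hz]

variable [IsContMDiffRiemannianBundle (𝓡 n) ∞ (Eu n) (fun x : M => TangentSpace (𝓡 n) x)]

theorem covDeriv_add (ψ : ∀ y : Y, TangentSpace (𝓡 n) (f y)) (v v' : TangentSpace I y) :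
    covDeriv I f ψ y (v + v') = covDeriv I f ψ y v + covDeriv I f ψ y v' := by
  simp only [covDeriv, christoffelVec_eq, map_add, add_apply]
  abel

theorem covDeriv_smul (ψ : ∀ y : Y, TangentSpace (𝓡 n) (f y)) (r : ℝ) (v : TangentSpace I y) :
    covDeriv I f ψ y (r • v) = r • covDeriv I f ψ y v := by
  simp only [covDeriv, christoffelVec_eq, map_add, map_smul, smul_apply, smul_add]

/-- The normal derivative as a linear map. -/
def normalDerivLinear (f : Y → M) (ψ : ∀ y : Y, TangentSpace (𝓡 n) (f y)) (y : Y) :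
    TangentSpace I y →ₗ[ℝ] TangentSpace (𝓡 n) (f y) where
  toFun := normalDeriv I f ψ y
  map_add' v v' := by rw [normalDeriv, covDeriv_add, projNor_add]; rfl
  map_smul' r v := by rw [normalDeriv, covDeriv_smul, projNor_smul]; rfl

/-- The tangential part as a linear map. -/
def tangentPartLinear (hi : Function.Injective (mfderiv I (𝓡 n) f y)) :
    TangentSpace (𝓡 n) (f y) →ₗ[ℝ] TangentSpace I y where
  toFun := tangentPart I f y
  map_add' := tangentPart_add hi
  map_smul' := tangentPart_smul hi

end TangentPart

/-! ### Oriented orthonormal bases of associative subspaces -/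

section OrientedBasis

variable {V : Type*} [NormedAddCommGroup V] [InnerProductSpace ℝ V] [FiniteDimensional ℝ V]

/-- An orthonormal basis `(t₀, t₁, t₂)` of an associative subspace `T` with `t₀ × t₁ = t₂`. Up to
the order it is the one with which traces over `T` are defined. -/
structure OrientedBasis (T : Submodule ℝ V) (c : V →ₗ[ℝ] V →ₗ[ℝ] V) where
  /-- the order of the basis -/
  order : Fin 3 ≃ Fin (Module.finrank ℝ T)
  cross_zero_one : c (stdOrthonormalBasis ℝ T (order 0)) (stdOrthonormalBasis ℝ T (order 1))
    = stdOrthonormalBasis ℝ T (order 2)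

namespace OrientedBasis

variable {T : Submodule ℝ V} {c : V →ₗ[ℝ] V →ₗ[ℝ] V} (B : OrientedBasis T c)

/-- The vectors of an oriented basis. -/
def vec (i : Fin 3) : V := stdOrthonormalBasis ℝ T (B.order i)

theorem vec_mem (i : Fin 3) : B.vec i ∈ T := (stdOrthonormalBasis ℝ T (B.order i)).2

theorem frameSum_eq {W : Type*} [AddCommMonoid W] (F : V → W) :
    frameSum T F = ∑ i, F (B.vec i) :=
  (B.order.sum_comp fun k => F (stdOrthonormalBasis ℝ T k : V)).symm

theorem inner_vec (i j : Fin 3) : inner ℝ (B.vec i) (B.vec j) = if i = j then (1 : ℝ) else 0 := by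
  have := orthonormal_iff_ite.1 (stdOrthonormalBasis ℝ T).orthonormal (B.order i) (B.order j)
  rw [Submodule.coe_inner] at this
  rw [vec, vec, this]
  simp

theorem linearIndependent : LinearIndependent ℝ B.vec := by
  have : Orthonormal ℝ B.vec := orthonormal_iff_ite.2 B.inner_vec
  exact this.linearIndependent

theorem orthoProj_eq (z : V) : orthoProj T z = ∑ k, (inner ℝ (B.vec k) z : ℝ) • B.vec k := by
  have h1 := frameSum_inner_smul (orthoProj_mem T z)
  rw [← h1, B.frameSum_eq]
  refine Finset.sum_congr rfl fun k _ => ?_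
  rw [real_inner_comm]
  congr 1
  rw [orthoProj, ← Submodule.inner_starProjection_left_eq_right]
  exact congrArg (fun w => (inner ℝ w z : ℝ)) (orthoProj_of_mem (B.vec_mem k))

end OrientedBasis

/-- For any orthonormal basis `(t₀, t₁, t₂)`, the product `t₀ × t₁` is `t₂` or `-t₂`, and the sign
is changed by exchanging `t₀` and `t₁`. -/
theorem nonempty_orientedBasis {T : Submodule ℝ V} {c : V →ₗ[ℝ] V →ₗ[ℝ] V}
    (hT : Module.finrank ℝ T = 3) (hskew : ∀ a b, c a b = -c b a)
    (hmetric : ∀ a b d, inner ℝ (c a b) d = -(inner ℝ b (c a d) : ℝ))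
    (hcross : ∀ a b, c a (c a b) = (inner ℝ a b : ℝ) • a - (inner ℝ a a : ℝ) • b)
    (hc : ∀ a ∈ T, ∀ b ∈ T, c a b ∈ T) : Nonempty (OrientedBasis T c) := by
  set t := stdOrthonormalBasis ℝ T with ht
  set σ : Fin 3 ≃ Fin (Module.finrank ℝ T) := finCongr hT.symm with hσ
  have ho : ∀ i j, inner ℝ (t (σ i) : V) (t (σ j)) = if i = j then (1 : ℝ) else 0 := fun i j => by
    have := orthonormal_iff_ite.1 t.orthonormal (σ i) (σ j)
    rw [Submodule.coe_inner] at this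
    simpa using this
  have hself : ∀ a, c a a = 0 := fun a => by
    have := hskew a a
    rw [← sub_eq_zero, sub_neg_eq_add, ← two_smul ℝ] at this
    simpa using this
  set x : V := (t (σ 0) : V)
  set y : V := (t (σ 1) : V)
  have hxT : c x y ∈ T := hc _ (t (σ 0)).2 _ (t (σ 1)).2
  have h0 : inner ℝ x (c x y) = (0 : ℝ) := by
    rw [real_inner_comm, hmetric, hself, inner_zero_right, neg_zero]
  have h1 : inner ℝ y (c x y) = (0 : ℝ) := by
    rw [hskew, inner_neg_right, real_inner_comm, hmetric, hself, inner_zero_right, neg_zero,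
      neg_zero]
  have hcc : inner ℝ (c x y) (c x y) = (1 : ℝ) := by
    have hxx : inner ℝ x x = (1 : ℝ) := (ho 0 0).trans (if_pos rfl)
    have hyy : inner ℝ y y = (1 : ℝ) := (ho 1 1).trans (if_pos rfl)
    have hxy : inner ℝ x y = (0 : ℝ) := (ho 0 1).trans (if_neg (by decide))
    rw [hmetric, hcross, hxx, hxy, inner_sub_right, inner_smul_right, inner_smul_right, hyy]
    norm_num
  have hsum : (inner ℝ (t (σ 2) : V) (c x y) : ℝ) • (t (σ 2) : V) = c x y := by
    have h3 := congrArg (Submodule.subtype T) (t.sum_repr' ⟨c x y, hxT⟩)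
    simp only [map_sum, map_smul, Submodule.subtype_apply, Submodule.coe_inner] at h3
    rw [← σ.sum_comp, Fin.sum_univ_three, h0, h1, zero_smul, zero_smul, zero_add, zero_add] at h3
    exact h3
  set r : ℝ := inner ℝ (t (σ 2) : V) (c x y) with hr
  have hr2 : r * r = 1 := by
    rw [← hsum, inner_smul_left, inner_smul_right, ho] at hcc
    simpa using hcc
  rcases mul_self_eq_one_iff.1 hr2 with h | h
  · exact ⟨σ, by rw [← one_smul ℝ (t (σ 2) : V), ← h, hsum]⟩
  · refine ⟨(Equiv.swap 0 1).trans σ, ?_⟩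
    have h2 : (Equiv.swap (0 : Fin 3) 1) 2 = 2 := by decide
    simp only [Equiv.trans_apply, Equiv.swap_apply_left, Equiv.swap_apply_right, h2]
    change c y x = _
    rw [hskew, ← hsum, h, neg_smul, one_smul, neg_neg]

end OrientedBasis

/-! ### The germ of an associative submanifold -/

section ToGerm

variable {H : Type*} [TopologicalSpace H] {I : ModelWithCorners ℝ (Eu 3) H}
  {Y : Type*} [TopologicalSpace Y] [ChartedSpace H Y] [IsManifold I ∞ Y]

theorem span_mfderiv_chartField {n : ℕ} {M : Type*} [TopologicalSpace M] [ChartedSpace (Eu n) M]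
    [IsManifold (𝓡 n) ∞ M] {f : Y → M} {y₀ y : Y} (hy : y ∈ (extChartAt I y₀).source)
    {b : Fin 3 → Eu 3} (hb : Submodule.span ℝ (Set.range b) = ⊤) :
    Submodule.span ℝ (Set.range fun i => mfderiv I (𝓡 n) f y (chartField I y₀ (b i) y))
      = tangentSub I f y := by
  set L : Eu 3 →ₗ[ℝ] TangentSpace (𝓡 n) (f y) := (mfderiv I (𝓡 n) f y).toLinearMap ∘ₗ
    ((trivializationAt (Eu 3) (TangentSpace I : Y → Type _) y₀).symmL ℝ y).toLinearMap with hL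
  have h1 : (Set.range fun i => mfderiv I (𝓡 n) f y (chartField I y₀ (b i) y))
      = L '' Set.range b := by
    rw [← Set.range_comp]; rfl
  rw [h1, ← Submodule.map_span, hb, Submodule.map_top, hL, LinearMap.range_comp_of_range_eq_top]
  · rfl
  · rw [LinearMap.range_eq_top]
    exact fun v => ⟨chartCoord I y₀ y v, chartField_chartCoord hy v⟩

variable {M : Type*} [TopologicalSpace M] [ChartedSpace (Eu 7) M] [IsManifold (𝓡 7) ∞ M]
  [RiemannianBundle (fun x : M => TangentSpace (𝓡 7) x)]
  {φ : ∀ x : M, TangentSpace (𝓡 7) x [⋀^Fin 3]→ₗ[ℝ] ℝ} {f : Y → M}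

theorem finrank_tangentSub (hf : IsAssociative I φ f) (y : Y) :
    Module.finrank ℝ (tangentSub (n := 7) I f y) = 3 := by
  rw [tangentSub, LinearMap.finrank_range_of_inj (hf.2.1 y)]
  exact finrank_euclideanSpace_fin

variable [IsContMDiffRiemannianBundle (𝓡 7) ∞ (Eu 7) (fun x : M => TangentSpace (𝓡 7) x)]

/-- An oriented orthonormal basis of the tangent space of an associative submanifold. -/
def orientedBasis (hφ : IsParallelG2Form φ) (hf : IsAssociative I φ f) (y : Y) :
    OrientedBasis (V := TangentSpace (𝓡 7) (f y)) (tangentSub I f y) (crossBilin φ (f y)) :=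
  (nonempty_orientedBasis (V := TangentSpace (𝓡 7) (f y)) (finrank_tangentSub hf y)
    (cross_skew φ (f y)) (inner_cross_skew φ (f y)) (cross_cross hφ (f y))
    (fun a ha b hb => hf.2.2 y a b ha hb)).some

/-- The tangent vectors of `Y` which form an oriented orthonormal basis. -/
def baseVec (hφ : IsParallelG2Form φ) (hf : IsAssociative I φ f) (y : Y) (i : Fin 3) :
    TangentSpace I y := tangentPart I f y ((orientedBasis hφ hf y).vec i)

variable (hφ : IsParallelG2Form φ) (hf : IsAssociative I φ f)

theorem mfderiv_baseVec (y : Y) (i : Fin 3) :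
    mfderiv I (𝓡 7) f y (baseVec hφ hf y i) = (orientedBasis hφ hf y).vec i :=
  mfderiv_tangentPart_of_mem ((orientedBasis hφ hf y).vec_mem i)

/-- The components of the vectors `baseVec`. -/
def baseCoord (y₀ : Y) (i : Fin 3) : Eu 3 := chartCoord I y₀ y₀ (baseVec hφ hf y₀ i)

theorem chartField_baseCoord (y₀ : Y) (i : Fin 3) :
    chartField I y₀ (baseCoord hφ hf y₀ i) y₀ = baseVec hφ hf y₀ i :=
  chartField_chartCoord (mem_extChartAt_source y₀) _

theorem span_baseCoord (y₀ : Y) : Submodule.span ℝ (Set.range (baseCoord hφ hf y₀)) = ⊤ := by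
  refine LinearIndependent.span_eq_top_of_card_eq_finrank ?_ (by simp)
  refine LinearIndependent.of_comp ((mfderiv I (𝓡 7) f y₀).toLinearMap ∘ₗ
    ((trivializationAt (Eu 3) (TangentSpace I : Y → Type _) y₀).symmL ℝ y₀).toLinearMap) ?_
  have h : ((mfderiv I (𝓡 7) f y₀).toLinearMap ∘ₗ
      ((trivializationAt (Eu 3) (TangentSpace I : Y → Type _) y₀).symmL ℝ y₀).toLinearMap)
        ∘ baseCoord hφ hf y₀ = (orientedBasis hφ hf y₀).vec := by
    funext i
    change mfderiv I (𝓡 7) f y₀ (chartField I y₀ (baseCoord hφ hf y₀ i) y₀) = _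
    rw [chartField_baseCoord, mfderiv_baseVec]
  rw [h]
  exact (orientedBasis hφ hf y₀).linearIndependent

/-- The vector field `∂f/∂(bᵢ)` along `f`. -/
def tangentField (y₀ : Y) (i : Fin 3) (y : Y) : TangentSpace (𝓡 7) (f y) :=
  mfderiv I (𝓡 7) f y (chartField I y₀ (baseCoord hφ hf y₀ i) y)

theorem tangentField_base (y₀ : Y) (i : Fin 3) :
    tangentField hφ hf y₀ i y₀ = (orientedBasis hφ hf y₀).vec i := by
  rw [tangentField, chartField_baseCoord, mfderiv_baseVec]

theorem span_tangentField {y₀ y : Y} (hy : y ∈ (extChartAt I y₀).source) :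
    Submodule.span ℝ (Set.range fun i => tangentField hφ hf y₀ i y) = tangentSub I f y :=
  span_mfderiv_chartField hy (span_baseCoord hφ hf y₀)

theorem chartMetric_coordMap {y₀ : Y} {e : Eu 3} (he : e ∈ coordDomain (n := 7) I f y₀)
    (a b : Eu 7) : chartMetric (f y₀) (coordMap I f y₀ e) a b
      = inner ℝ (fromCoords (f y₀) (f ((extChartAt I y₀).symm e)) a)
        (fromCoords (f y₀) (f ((extChartAt I y₀).symm e)) b) := by
  rw [chartMetric_apply, extChartAt_symm_coordMap he]

theorem fromCoords_chartCross_coordMap {y₀ : Y} {e : Eu 3} (he : e ∈ coordDomain (n := 7) I f y₀)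
    (a b : Eu 7) : fromCoords (f y₀) (f ((extChartAt I y₀).symm e))
      (chartCross φ (f y₀) (coordMap I f y₀ e) a b)
      = cross φ (f ((extChartAt I y₀).symm e))
        (fromCoords (f y₀) (f ((extChartAt I y₀).symm e)) a)
        (fromCoords (f y₀) (f ((extChartAt I y₀).symm e)) b) := by
  have := fromCoords_chartCross (φ := φ) (coordMap_mem_target he) a b
  rwa [extChartAt_symm_coordMap he] at this

theorem tangentField_eq {y₀ : Y} {e : Eu 3} (he : e ∈ coordDomain (n := 7) I f y₀) (i : Fin 3) :
    tangentField hφ hf y₀ i ((extChartAt I y₀).symm e)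
      = fromCoords (f y₀) (f ((extChartAt I y₀).symm e))
        (fderivWithin ℝ (coordMap (n := 7) I f y₀) (Set.range I) e (baseCoord hφ hf y₀ i)) :=
  mfderiv_chartField hf.1 he _

/-- The germ of an associative submanifold at a point, in coordinates. -/
def germ (y₀ : Y) : AssociativeGerm (Eu 3) (Eu 7) where
  Ω := (extChartAt (𝓡 7) (f y₀)).target
  G := chartMetric (f y₀)
  Γ := chartChristoffel (f y₀)
  C := chartCross φ (f y₀)
  S := Set.range I
  F := coordMap I f y₀
  e₀ := extChartAt I y₀ y₀
  b := baseCoord hφ hf y₀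
  isParallelCross := isParallelCross_chart hφ (f y₀)
  finrank_eq := finrank_euclideanSpace_fin
  uniqueDiffOn := I.uniqueDiffOn
  mem_closure := I.range_subset_closure_interior
    ((extChartAt_target_subset_range y₀ (mem_extChartAt_target y₀)))
  mem := extChartAt_target_subset_range y₀ (mem_extChartAt_target y₀)
  contDiffWithinAt := contDiffWithinAt_coordMap hf.1 base_mem_coordDomain
  map_mem := coordMap_mem_target base_mem_coordDomain
  ortho i j := by
    rw [chartMetric_coordMap base_mem_coordDomain, ← tangentField_eq hφ hf base_mem_coordDomain,
      ← tangentField_eq hφ hf base_mem_coordDomain, extChartAt_to_inv, tangentField_base,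
      tangentField_base]
    exact (orientedBasis hφ hf y₀).inner_vec i j
  cross_zero_one := by
    have he := base_mem_coordDomain (n := 7) (I := I) (f := f) (y₀ := y₀)
    apply fromCoords_injective he.2
    rw [fromCoords_chartCross_coordMap he, ← tangentField_eq hφ hf he,
      ← tangentField_eq hφ hf he, ← tangentField_eq hφ hf he, extChartAt_to_inv, tangentField_base,
      tangentField_base, tangentField_base]
    exact (orientedBasis hφ hf y₀).cross_zero_one
  cross_mem := by
    filter_upwards [coordDomain_mem_nhdsWithin hf.1.continuous
      (base_mem_coordDomain (n := 7))] with e he i j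
    have h1 := hf.2.2 ((extChartAt I y₀).symm e)
      (tangentField hφ hf y₀ i ((extChartAt I y₀).symm e))
      (tangentField hφ hf y₀ j ((extChartAt I y₀).symm e)) (mfderiv_mem _) (mfderiv_mem _)
    rw [← span_tangentField hφ hf ((extChartAt I y₀).map_target he.1),
      Submodule.mem_span_range_iff_exists_fun] at h1
    obtain ⟨c, hc⟩ := h1
    rw [Submodule.mem_span_range_iff_exists_fun]
    refine ⟨c, fromCoords_injective he.2 ?_⟩
    rw [fromCoords_chartCross_coordMap he, ← tangentField_eq hφ hf he, ← tangentField_eq hφ hf he,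
      ← hc, map_sum]
    exact Finset.sum_congr rfl fun k _ => by rw [map_smul, ← tangentField_eq hφ hf he]

end ToGerm

/-! ### The operators in terms of the germ -/

section Bridge

variable {H : Type*} [TopologicalSpace H] {I : ModelWithCorners ℝ (Eu 3) H}
  {Y : Type*} [TopologicalSpace Y] [ChartedSpace H Y] [IsManifold I ∞ Y]
  {M : Type*} [TopologicalSpace M] [ChartedSpace (Eu 7) M] [IsManifold (𝓡 7) ∞ M]
  [RiemannianBundle (fun x : M => TangentSpace (𝓡 7) x)]
  [IsContMDiffRiemannianBundle (𝓡 7) ∞ (Eu 7) (fun x : M => TangentSpace (𝓡 7) x)]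
  {φ : ∀ x : M, TangentSpace (𝓡 7) x [⋀^Fin 3]→ₗ[ℝ] ℝ} {f : Y → M}
  (hφ : IsParallelG2Form φ) (hf : IsAssociative I φ f) {y₀ : Y} {e : Eu 3}

theorem fromCoords_frame (he : e ∈ coordDomain (n := 7) I f y₀) (i : Fin 3) :
    fromCoords (f y₀) (f ((extChartAt I y₀).symm e)) ((germ hφ hf y₀).frame i e)
      = tangentField hφ hf y₀ i ((extChartAt I y₀).symm e) :=
  (tangentField_eq hφ hf he i).symm

theorem germ_metric (he : e ∈ coordDomain (n := 7) I f y₀) (a b : Eu 7) :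
    (germ hφ hf y₀).G ((germ hφ hf y₀).F e) a b
      = inner ℝ (fromCoords (f y₀) (f ((extChartAt I y₀).symm e)) a)
        (fromCoords (f y₀) (f ((extChartAt I y₀).symm e)) b) :=
  chartMetric_coordMap he a b

theorem germ_gram (he : e ∈ coordDomain (n := 7) I f y₀) (i j : Fin 3) :
    (germ hφ hf y₀).gram e i j = inner ℝ (tangentField hφ hf y₀ i ((extChartAt I y₀).symm e))
      (tangentField hφ hf y₀ j ((extChartAt I y₀).symm e)) := by
  rw [AssociativeGerm.gram, Matrix.of_apply, germ_metric hφ hf he, fromCoords_frame hφ hf he,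
    fromCoords_frame hφ hf he]

theorem projNor_fromCoords (he : e ∈ coordDomain (n := 7) I f y₀)
    (hd : ((germ hφ hf y₀).gram e).det ≠ 0) (Z : Eu 3 → Eu 7) :
    projNor I f ((extChartAt I y₀).symm e)
        (fromCoords (f y₀) (f ((extChartAt I y₀).symm e)) (Z e))
      = fromCoords (f y₀) (f ((extChartAt I y₀).symm e)) ((germ hφ hf y₀).normalPart Z e) := by
  have h1 := orthoProj_of_span (V := TangentSpace (𝓡 7) (f ((extChartAt I y₀).symm e)))
    (span_tangentField hφ hf ((extChartAt I y₀).map_target he.1)) (germ_gram hφ hf he) hd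
    (fromCoords (f y₀) (f ((extChartAt I y₀).symm e)) (Z e))
  rw [projNor_eq_sub, projTan, h1, AssociativeGerm.normalPart, map_sub, map_sum]
  congr 1
  refine Finset.sum_congr rfl fun j _ => ?_
  rw [map_smul, fromCoords_frame hφ hf he, AssociativeGerm.tangentCoeff]
  congr 1
  refine Finset.sum_congr rfl fun i _ => ?_
  rw [germ_metric hφ hf he, fromCoords_frame hφ hf he]

theorem covDeriv_eq_cov (he : e ∈ coordDomain (n := 7) I f y₀)
    {ψ : ∀ y : Y, TangentSpace (𝓡 7) (f y)}
    (hψ : DifferentiableWithinAt ℝ (coordField (n := 7) I f y₀ ψ) (Set.range I) e) (a : Eu 3) :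
    covDeriv I f ψ ((extChartAt I y₀).symm e) (chartField I y₀ a ((extChartAt I y₀).symm e))
      = fromCoords (f y₀) (f ((extChartAt I y₀).symm e))
        ((germ hφ hf y₀).cov a (coordField I f y₀ ψ) e) :=
  covDeriv_chartField hf.1 he hψ a

theorem normalDeriv_eq_normalPart (he : e ∈ coordDomain (n := 7) I f y₀)
    (hd : ((germ hφ hf y₀).gram e).det ≠ 0) {ψ : ∀ y : Y, TangentSpace (𝓡 7) (f y)}
    (hψ : DifferentiableWithinAt ℝ (coordField (n := 7) I f y₀ ψ) (Set.range I) e) (a : Eu 3) :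
    normalDeriv I f ψ ((extChartAt I y₀).symm e) (chartField I y₀ a ((extChartAt I y₀).symm e))
      = fromCoords (f y₀) (f ((extChartAt I y₀).symm e))
        ((germ hφ hf y₀).normalPart ((germ hφ hf y₀).cov a (coordField I f y₀ ψ)) e) := by
  rw [normalDeriv, covDeriv_eq_cov hφ hf he hψ, projNor_fromCoords hφ hf he hd]

/-- The Dirac operator, a trace in an orthonormal frame, in terms of the coordinate frame. -/
theorem diracOp_eq_dirac (he : e ∈ coordDomain (n := 7) I f y₀)
    (hd : ((germ hφ hf y₀).gram e).det ≠ 0) {ψ : ∀ y : Y, TangentSpace (𝓡 7) (f y)}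
    (hψ : DifferentiableWithinAt ℝ (coordField (n := 7) I f y₀ ψ) (Set.range I) e) :
    diracOp I φ f ψ ((extChartAt I y₀).symm e)
      = fromCoords (f y₀) (f ((extChartAt I y₀).symm e))
        ((germ hφ hf y₀).dirac (coordField I f y₀ ψ) e) := by
  set y := (extChartAt I y₀).symm e with hy
  have hi := hf.2.1 y
  set β := (crossBilin φ (f y)).compl₂
    (normalDerivLinear f ψ y ∘ₗ tangentPartLinear (I := I) hi) with hβ
  have hβ2 : ∀ u w, β u w = cross φ (f y) u (normalDeriv I f ψ y (tangentPart I f y w)) :=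
    fun u w => rfl
  have h1 : diracOp I φ f ψ y = frameSum (V := TangentSpace (𝓡 7) (f y)) (tangentSub I f y)
      fun t => β t t := by
    rw [diracOp, traceTan, frameSum, frameSum]
    refine Finset.sum_congr rfl fun k _ => ?_
    rw [hβ2, mfderiv_tangentPart_of_mem (Subtype.property _)]
  rw [h1, frameSum_bilin (V := TangentSpace (𝓡 7) (f y))
    (span_tangentField hφ hf ((extChartAt I y₀).map_target he.1)) (germ_gram hφ hf he) hd,
    AssociativeGerm.dirac, map_sum]
  refine Finset.sum_congr rfl fun i _ => ?_
  rw [map_sum]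
  refine Finset.sum_congr rfl fun j _ => ?_
  rw [map_smul, hβ2]
  congr 1
  rw [tangentField, tangentField, tangentPart_mfderiv hi]
  have h2 := normalDeriv_eq_normalPart hφ hf he hd hψ (baseCoord hφ hf y₀ j)
  rw [h2, ← tangentField, ← fromCoords_frame hφ hf he]
  exact (fromCoords_chartCross_coordMap he _ _).symm

/-- The points at which the germ describes the submanifold. -/
theorem eventually_regular : ∀ᶠ e in nhdsWithin (extChartAt I y₀ y₀) (Set.range I),
    e ∈ coordDomain (n := 7) I f y₀ ∧ ((germ hφ hf y₀).gram e).det ≠ 0 :=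
  Filter.Eventually.and (coordDomain_mem_nhdsWithin hf.1.continuous base_mem_coordDomain)
    (germ hφ hf y₀).eventually_det_ne_zero

theorem base_regular : ((germ hφ hf y₀).gram (extChartAt I y₀ y₀)).det ≠ 0 :=
  ((eventually_regular hφ hf).self_of_nhdsWithin (germ hφ hf y₀).mem).2

variable {ψ : ∀ y : Y, TangentSpace (𝓡 7) (f y)}

theorem IsSmoothAlong.differentiable_coordField (hf : ContMDiff I (𝓡 7) ∞ f)
    (hψ : IsSmoothAlong I f ψ)
    (he : e ∈ coordDomain (n := 7) I f y₀) :
    DifferentiableWithinAt ℝ (coordField (n := 7) I f y₀ ψ) (Set.range I) e :=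
  (contDiffWithinAt_coordField hf he (hψ _)).differentiableWithinAt (by simp)

theorem IsSmoothAlong.smooth_coordField (hψ : IsSmoothAlong I f ψ) :
    (germ hφ hf y₀).Smooth (coordField (n := 7) I f y₀ ψ) :=
  contDiffWithinAt_coordField hf.1 base_mem_coordDomain (hψ _)

theorem coordField_diracOp (hψ : IsSmoothAlong I f ψ) :
    coordField I f y₀ (diracOp I φ f ψ) =ᶠ[nhdsWithin (extChartAt I y₀ y₀) (Set.range I)]
      (germ hφ hf y₀).dirac (coordField I f y₀ ψ) := by
  filter_upwards [eventually_regular hφ hf] with e he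
  rw [coordField, diracOp_eq_dirac hφ hf he.1 he.2 (hψ.differentiable_coordField hf.1 he.1),
    toCoords_fromCoords he.1.2]

/-- The Dirac operator maps smooth normal fields to smooth normal fields. -/
theorem isNormalSection_diracOp (hφ : IsParallelG2Form φ) (hf : IsAssociative I φ f)
    (hψ : IsSmoothAlong I f ψ) :
    IsNormalSection I f (diracOp I φ f ψ) := by
  refine ⟨fun y => ?_, fun y => ?_⟩
  · rw [diracOp, traceTan, (orientedBasis hφ hf y).frameSum_eq]
    refine Submodule.sum_mem _ fun k _ => ?_
    rw [mem_normalSub_iff, mfderiv_tangentPart_of_mem ((orientedBasis hφ hf y).vec_mem k)]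
    intro s hs
    have h1 := hf.2.2 y _ s ((orientedBasis hφ hf y).vec_mem k) hs
    rw [real_inner_comm, inner_cross_skew, real_inner_comm, normalDeriv,
      mem_normalSub_iff.1 (projNor_mem _) _ h1, neg_zero]
  · exact contMDiffAt_of_coordField hf.1
      (((germ hφ hf y).smooth_dirac (hψ.smooth_coordField hφ hf)).congr
        (coordField_diracOp hφ hf hψ))

end Bridge

/-! ### The curvature tensor in a chart -/

section Curvature

variable {n : ℕ} {M : Type*} [TopologicalSpace M] [ChartedSpace (Eu n) M] [IsManifold (𝓡 n) ∞ M]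
  [RiemannianBundle (fun x : M => TangentSpace (𝓡 n) x)]
  [IsContMDiffRiemannianBundle (𝓡 n) ∞ (Eu n) (fun x : M => TangentSpace (𝓡 n) x)]

theorem fderiv_eq_sum_partialDeriv (h : Eu n → ℝ) (u a : Eu n) :
    fderiv ℝ h u a = ∑ i, a i * partialDeriv i h u := by
  conv_lhs => rw [← sum_smul_stdVec a]
  simp [partialDeriv]

theorem fderiv_chartChristoffel {x₀ : M} {u : Eu n} (hu : u ∈ (extChartAt (𝓡 n) x₀).target)
    (a b c : Eu n) : fderiv ℝ (chartChristoffel x₀) u a b c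
      = ∑ k, (∑ m, ∑ i, ∑ j, partialDeriv m (christoffel x₀ k i j) u * a m * b i * c j) •
        stdVec k := by
  have hd : ∀ k i j, DifferentiableAt ℝ (christoffel x₀ k i j) u := fun k i j =>
    ((contDiffOn_christoffel x₀ k i j).contDiffAt ((isOpen_extChartAt_target x₀).mem_nhds hu)
      ).differentiableAt (by simp)
  have hD : DifferentiableAt ℝ (chartChristoffel x₀) u :=
    ((contDiffOn_chartChristoffel x₀).contDiffAt ((isOpen_extChartAt_target x₀).mem_nhds hu)
      ).differentiableAt (by simp)
  rw [← fderiv_bilin_apply hD]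
  have h1 : (fun u => chartChristoffel x₀ u b c)
      = fun u => ∑ k, (∑ i, ∑ j, christoffel x₀ k i j u * b i * c j) • stdVec k :=
    funext fun u => chartChristoffel_apply x₀ u b c
  have h2 : HasFDerivAt (fun u => ∑ k, (∑ i, ∑ j, christoffel x₀ k i j u * b i * c j) • stdVec k)
      (∑ k, (∑ i, ∑ j, c j • b i • fderiv ℝ (christoffel x₀ k i j) u).smulRight (stdVec k)) u := by
    refine HasFDerivAt.fun_sum fun k _ => ?_
    refine HasFDerivAt.smul_const ?_ _
    refine HasFDerivAt.fun_sum fun i _ => HasFDerivAt.fun_sum fun j _ => ?_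
    exact ((hd k i j).hasFDerivAt.mul_const (b i)).mul_const (c j)
  rw [h1, h2.fderiv]
  simp only [sum_apply, ContinuousLinearMap.smulRight_apply, smul_apply, smul_eq_mul,
    fderiv_eq_sum_partialDeriv]
  refine Finset.sum_congr rfl fun k _ => ?_
  congr 1
  have h3 : ∀ i j, c j * (b i * ∑ m, a m * partialDeriv m (christoffel x₀ k i j) u)
      = ∑ m, partialDeriv m (christoffel x₀ k i j) u * a m * b i * c j := fun i j => by
    rw [Finset.mul_sum, Finset.mul_sum]
    exact Finset.sum_congr rfl fun m _ => by ring
  simp only [h3]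
  symm
  rw [Finset.sum_comm]
  exact Finset.sum_congr rfl fun i _ => Finset.sum_comm

theorem sum_smul_stdVec_apply (c : Fin n → ℝ) (k : Fin n) :
    (∑ i, c i • stdVec i : Eu n) k = c k := by
  simp [stdVec, Pi.single_apply]

theorem chartChristoffel_apply_coord (x₀ : M) (u a b : Eu n) (k : Fin n) :
    chartChristoffel x₀ u a b k = ∑ i, ∑ j, christoffel x₀ k i j u * a i * b j := by
  rw [chartChristoffel_apply, sum_smul_stdVec_apply]

theorem curvature_eq (x : M) (a b c : TangentSpace (𝓡 n) x) :
    curvature x a b c = fromCoords x x (coordCurvature (chartChristoffel x) (extChartAt (𝓡 n) x x)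
      (toCoords x x a) (toCoords x x b) (toCoords x x c)) := by
  rw [curvature]
  congr 1
  rw [coordCurvature, fderiv_chartChristoffel (mem_extChartAt_target x),
    fderiv_chartChristoffel (mem_extChartAt_target x)]
  ext l
  rw [PiLp.add_apply, PiLp.sub_apply, PiLp.sub_apply]
  simp only [sum_smul_stdVec_apply, chartChristoffel_apply_coord]
  generalize toCoords x x a = A
  generalize toCoords x x b = B
  generalize toCoords x x c = C
  generalize extChartAt (𝓡 n) x x = u
  have h1 : ∑ m, ∑ i, ∑ j, partialDeriv m (christoffel x l i j) u * B m * A i * C j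
      = ∑ i, ∑ j, ∑ k, partialDeriv j (christoffel x l i k) u * A i * B j * C k := by
    rw [Finset.sum_comm]
    exact Finset.sum_congr rfl fun i _ => Finset.sum_congr rfl fun j _ =>
      Finset.sum_congr rfl fun k _ => by ring
  have h2 : ∀ A B : Eu n, ∑ i, ∑ m, christoffel x l i m u * A i *
      (∑ j, ∑ k, christoffel x m j k u * B j * C k)
      = ∑ i, ∑ j, ∑ k, (∑ m, christoffel x l i m u * christoffel x m j k u) * A i * B j * C k := by
    intro A B
    refine Finset.sum_congr rfl fun i _ => ?_
    simp only [Finset.mul_sum, Finset.sum_mul]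
    rw [Finset.sum_comm]
    refine Finset.sum_congr rfl fun j _ => ?_
    rw [Finset.sum_comm]
    exact Finset.sum_congr rfl fun k _ => Finset.sum_congr rfl fun m _ => by ring
  have h3 : ∑ i, ∑ j, ∑ k, (∑ m, christoffel x l i m u * christoffel x m j k u) * B i * A j * C k
      = ∑ i, ∑ j, ∑ k, (∑ m, christoffel x l j m u * christoffel x m i k u) * A i * B j * C k := by
    rw [Finset.sum_comm]
    exact Finset.sum_congr rfl fun i _ => Finset.sum_congr rfl fun j _ =>
      Finset.sum_congr rfl fun k _ => by ring
  rw [h1, h2, h2, h3]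
  simp only [← Finset.sum_sub_distrib, ← Finset.sum_add_distrib, curvatureCoeff]
  refine Finset.sum_congr rfl fun i _ => Finset.sum_congr rfl fun j _ =>
      Finset.sum_congr rfl fun k _ => ?_
  rw [Finset.sum_sub_distrib]
  ring

end Curvature

/-! ### The Weitzenböck formula -/

section Weitzenbock

variable {H : Type*} [TopologicalSpace H] {I : ModelWithCorners ℝ (Eu 3) H}
  {Y : Type*} [TopologicalSpace Y] [ChartedSpace H Y] [IsManifold I ∞ Y]
  {M : Type*} [TopologicalSpace M] [ChartedSpace (Eu 7) M] [IsManifold (𝓡 7) ∞ M]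
  [RiemannianBundle (fun x : M => TangentSpace (𝓡 7) x)]
  [IsContMDiffRiemannianBundle (𝓡 7) ∞ (Eu 7) (fun x : M => TangentSpace (𝓡 7) x)]
  {φ : ∀ x : M, TangentSpace (𝓡 7) x [⋀^Fin 3]→ₗ[ℝ] ℝ} {f : Y → M}
  (hφ : IsParallelG2Form φ) (hf : IsAssociative I φ f) {y : Y}
  {ψ : ∀ y : Y, TangentSpace (𝓡 7) (f y)}

theorem coordMap_base :
    coordMap (n := 7) I f y (extChartAt I y y) = extChartAt (𝓡 7) (f y) (f y) := by
  rw [coordMap, extChartAt_to_inv]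

theorem coordField_base (ψ : ∀ y : Y, TangentSpace (𝓡 7) (f y)) :
    coordField I f y ψ (extChartAt I y y) = toCoords (f y) (f y) (ψ y) := by
  rw [coordField, extChartAt_to_inv]

theorem fromCoords_coordField_base (ψ : ∀ y : Y, TangentSpace (𝓡 7) (f y)) :
    fromCoords (f y) (f y) (coordField I f y ψ (extChartAt I y y)) = ψ y := by
  rw [coordField_base, fromCoords_toCoords (mem_extChartAt_source (f y))]

theorem germ_metric_base (a b : Eu 7) :
    (germ hφ hf y).G ((germ hφ hf y).F (germ hφ hf y).e₀) a b
      = inner ℝ (fromCoords (f y) (f y) a) (fromCoords (f y) (f y) b) := by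
  have := germ_metric hφ hf (base_mem_coordDomain (n := 7) (I := I) (f := f) (y₀ := y)) a b
  rwa [extChartAt_to_inv] at this

theorem fromCoords_frame_base (i : Fin 3) :
    fromCoords (f y) (f y) ((germ hφ hf y).frame i (germ hφ hf y).e₀)
      = (orientedBasis hφ hf y).vec i := by
  have := fromCoords_frame hφ hf (base_mem_coordDomain (n := 7) (I := I) (f := f) (y₀ := y)) i
  rwa [extChartAt_to_inv, tangentField_base] at this

theorem projNor_fromCoords_base (z : Eu 7) :
    projNor I f y (fromCoords (f y) (f y) z) = fromCoords (f y) (f y) ((germ hφ hf y).proj z) := by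
  have := projNor_fromCoords hφ hf (base_mem_coordDomain (n := 7) (I := I) (f := f) (y₀ := y))
    (base_regular hφ hf) fun _ => z
  rw [extChartAt_to_inv] at this
  rw [this]
  exact congrArg _ ((germ hφ hf y).normalPart_base _)

theorem covDeriv_base (hψ : (germ hφ hf y).Smooth (coordField (n := 7) I f y ψ)) (i : Fin 3) :
    covDeriv I f ψ y (baseVec hφ hf y i) = fromCoords (f y) (f y)
      ((germ hφ hf y).cov ((germ hφ hf y).b i) (coordField I f y ψ) (germ hφ hf y).e₀) := by
  have := covDeriv_eq_cov hφ hf (base_mem_coordDomain (n := 7) (I := I) (f := f) (y₀ := y))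
    hψ.differentiableWithinAt (baseCoord hφ hf y i)
  rw [extChartAt_to_inv, chartField_baseCoord] at this
  exact this

theorem normalDeriv_base (hψ : (germ hφ hf y).Smooth (coordField (n := 7) I f y ψ)) (i : Fin 3) :
    normalDeriv I f ψ y (baseVec hφ hf y i) = fromCoords (f y) (f y) ((germ hφ hf y).proj
      ((germ hφ hf y).cov ((germ hφ hf y).b i) (coordField I f y ψ) (germ hφ hf y).e₀)) := by
  rw [normalDeriv, covDeriv_base hφ hf hψ, projNor_fromCoords_base hφ hf]

theorem traceTan_eq (B : TangentSpace I y → TangentSpace I y → TangentSpace (𝓡 7) (f y)) :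
    traceTan I f y B = ∑ i, B (baseVec hφ hf y i) (baseVec hφ hf y i) :=
  (orientedBasis hφ hf y).frameSum_eq _

theorem tangentPart_eq (z : TangentSpace (𝓡 7) (f y)) :
    tangentPart I f y z
      = ∑ k, (inner ℝ ((orientedBasis hφ hf y).vec k) z : ℝ) • baseVec hφ hf y k := by
  apply hf.2.1 y
  rw [mfderiv_tangentPart, map_sum, projTan]
  refine ((orientedBasis hφ hf y).orthoProj_eq z).trans ?_
  exact Finset.sum_congr rfl fun k _ => by rw [map_smul, mfderiv_baseVec]

theorem extend_baseVec {i : Fin 3} {y' : Y} (hy : y' ∈ (extChartAt I y).source) :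
    FiberBundle.extend (Eu 3) (baseVec hφ hf y i) y'
      = chartField I y (baseCoord hφ hf y i) y' := extend_eq_chartField _ hy

theorem extend_baseVec_base (i : Fin 3) :
    FiberBundle.extend (Eu 3) (baseVec hφ hf y i) y = baseVec hφ hf y i := by
  rw [extend_baseVec hφ hf (mem_extChartAt_source y), chartField_baseCoord]

theorem coordField_normalDeriv_extend (hψ : IsSmoothAlong I f ψ) (i : Fin 3) :
    coordField (n := 7) I f y
      (fun y' => normalDeriv I f ψ y' (FiberBundle.extend (Eu 3) (baseVec hφ hf y i) y'))
      =ᶠ[nhdsWithin (germ hφ hf y).e₀ (germ hφ hf y).S]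
      (germ hφ hf y).normalPart ((germ hφ hf y).cov ((germ hφ hf y).b i) (coordField I f y ψ)) := by
  filter_upwards [eventually_regular hφ hf] with e he
  have h := normalDeriv_eq_normalPart hφ hf he.1 he.2 (hψ.differentiable_coordField hf.1 he.1)
    (baseCoord hφ hf y i)
  rw [coordField, extend_baseVec hφ hf ((extChartAt I y).map_target he.1.1), h,
    toCoords_fromCoords he.1.2]
  rfl

theorem coordField_mfderiv_extend (i : Fin 3) :
    coordField (n := 7) I f y
      (fun y' => mfderiv I (𝓡 7) f y' (FiberBundle.extend (Eu 3) (baseVec hφ hf y i) y'))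
      =ᶠ[nhdsWithin (germ hφ hf y).e₀ (germ hφ hf y).S] (germ hφ hf y).frame i := by
  filter_upwards [eventually_regular hφ hf] with e he
  rw [coordField, extend_baseVec hφ hf ((extChartAt I y).map_target he.1.1)]
  exact toCoords_mfderiv_chartField hf.1 he.1 _

theorem normalHessian_eq_hessian (hψ : IsSmoothAlong I f ψ) (l i : Fin 3) :
    normalHessian f (FiberBundle.extend (Eu 3) (baseVec hφ hf y l))
      (FiberBundle.extend (Eu 3) (baseVec hφ hf y i)) ψ y
      = fromCoords (f y) (f y) ((germ hφ hf y).hessian (coordField I f y ψ) l i) := by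
  have h1 := coordField_normalDeriv_extend hφ hf (y := y) hψ i
  have h2 := coordField_mfderiv_extend hφ hf (y := y) i
  have hP := hψ.smooth_coordField hφ hf (y₀ := y)
  rw [normalHessian, extend_baseVec_base,
    normalDeriv_base hφ hf (((germ hφ hf y).smooth_normalPart (hP.cov _)).congr h1),
    (germ hφ hf y).cov_congr h1, tangentDeriv,
    covDeriv_base hφ hf (((germ hφ hf y).smooth_frame i).congr h2), (germ hφ hf y).cov_congr h2,
    tangentPart_eq hφ hf, AssociativeGerm.hessian, map_sub, map_sum]
  congr 1
  refine (map_sum (normalDerivLinear f ψ y) _ _).trans (Finset.sum_congr rfl fun k _ => ?_)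
  rw [map_smul, map_smul, germ_metric_base, fromCoords_frame_base, ← normalDeriv_base hφ hf hP]
  rfl

theorem connLaplacian_eq (hψ : IsSmoothAlong I f ψ) :
    connLaplacian I f ψ y = fromCoords (f y) (f y)
      (-∑ i, (germ hφ hf y).hessian (coordField I f y ψ) i i) := by
  rw [connLaplacian, traceTan_eq hφ hf, map_neg, map_sum]
  congr 1
  exact Finset.sum_congr rfl fun i _ => normalHessian_eq_hessian hφ hf hψ i i

theorem partialRicci_eq (ψ : ∀ y : Y, TangentSpace (𝓡 7) (f y)) :
    partialRicci I f ψ y = fromCoords (f y) (f y) ((germ hφ hf y).proj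
      (∑ i, coordCurvature (germ hφ hf y).Γ ((germ hφ hf y).F (germ hφ hf y).e₀)
        ((germ hφ hf y).frame i (germ hφ hf y).e₀) (coordField I f y ψ (germ hφ hf y).e₀)
        ((germ hφ hf y).frame i (germ hφ hf y).e₀))) := by
  rw [partialRicci, traceTan_eq hφ hf, ← projNor_fromCoords_base hφ hf, map_sum]
  congr 1
  refine Finset.sum_congr rfl fun i _ => ?_
  rw [curvature_eq, mfderiv_baseVec, ← fromCoords_frame_base,
    toCoords_fromCoords (mem_extChartAt_source (f y)), ← coordMap_base (I := I),
    ← coordField_base (I := I)]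
  rfl

/-- The components of a normal field are normal for the metric in the chart. -/
theorem eventually_normal (hψ : ∀ y, ψ y ∈ normalSub I f y) :
    ∀ᶠ e in nhdsWithin (germ hφ hf y).e₀ (germ hφ hf y).S, ∀ i,
      (germ hφ hf y).G ((germ hφ hf y).F e) ((germ hφ hf y).frame i e)
        (coordField I f y ψ e) = 0 := by
  filter_upwards [eventually_regular hφ hf] with e he i
  rw [germ_metric hφ hf he.1, fromCoords_frame hφ hf he.1, fromCoords_coordField he.1]
  exact mem_normalSub_iff.1 (hψ _) _ (mfderiv_mem _)

/-- The second fundamental form `π_ν ∇_{tᵢ} tⱼ` on the oriented basis. -/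
def secondFormVec (y : Y) (i j : Fin 3) : TangentSpace (𝓡 7) (f y) :=
  fromCoords (f y) (f y) ((germ hφ hf y).secondForm i j)

theorem secondFormVec_mem (i j : Fin 3) : secondFormVec hφ hf y i j ∈ normalSub I f y := by
  rw [secondFormVec, AssociativeGerm.secondForm, ← projNor_fromCoords_base]
  exact projNor_mem _

theorem coordField_normalExtend (η : TangentSpace (𝓡 7) (f y)) :
    coordField (n := 7) I f y (normalExtend I f y η)
      =ᶠ[nhdsWithin (germ hφ hf y).e₀ (germ hφ hf y).S]
      (germ hφ hf y).normalPart fun _ => toCoords (f y) (f y) η := by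
  filter_upwards [eventually_regular hφ hf] with e he
  have h := projNor_fromCoords hφ hf he.1 he.2 fun _ => toCoords (f y) (f y) η
  rw [coordField, normalExtend, h, toCoords_fromCoords he.1.2]

/-- The shape operator is dual to the second fundamental form. -/
theorem mfderiv_shape {η : TangentSpace (𝓡 7) (f y)} (hη : η ∈ normalSub I f y) (i : Fin 3) :
    mfderiv I (𝓡 7) f y (shape I f y η (baseVec hφ hf y i))
      = ∑ j, (inner ℝ η (secondFormVec hφ hf y i j) : ℝ) • (orientedBasis hφ hf y).vec j := by
  have hS : (germ hφ hf y).Smooth (coordField (n := 7) I f y (normalExtend I f y η)) :=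
    ((germ hφ hf y).smooth_normalPart contDiffWithinAt_const).congr
      (coordField_normalExtend hφ hf η)
  have hn := eventually_normal hφ hf (y := y) (ψ := normalExtend I f y η) fun _ => projNor_mem _
  have hb : normalExtend I f y η y = η := by
    rw [normalExtend, fromCoords_toCoords (mem_extChartAt_source (f y)), projNor_of_mem hη]
  rw [shape, tangentPart_eq hφ hf, map_neg, map_sum, ← Finset.sum_neg_distrib]
  refine Finset.sum_congr rfl fun j _ => ?_
  rw [map_smul, mfderiv_baseVec, ← neg_smul, covDeriv_base hφ hf hS, ← fromCoords_frame_base,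
    ← germ_metric_base hφ hf, (germ hφ hf y).frame_cov_of_normal hS hn, neg_neg, germ_metric_base]
  congr 2
  exact (fromCoords_coordField_base (I := I) _).trans hb

theorem endInner_shape {η ζ : TangentSpace (𝓡 7) (f y)} (hη : η ∈ normalSub I f y)
    (hζ : ζ ∈ normalSub I f y) :
    endInner (n := 7) f y (shape I f y η) (shape I f y ζ)
      = ∑ i, ∑ j, (inner ℝ η (secondFormVec hφ hf y i j) : ℝ)
        * inner ℝ (secondFormVec hφ hf y i j) ζ := by
  rw [endInner, (orientedBasis hφ hf y).frameSum_eq]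
  refine Finset.sum_congr rfl fun i _ => ?_
  have h1 := mfderiv_shape hφ hf hη i
  have h2 := mfderiv_shape hφ hf hζ i
  rw [baseVec] at h1 h2
  rw [h1, h2, sum_inner]
  refine Finset.sum_congr rfl fun j _ => ?_
  rw [inner_smul_left, inner_sum, Finset.sum_eq_single j]
  · rw [inner_smul_right, (orientedBasis hφ hf y).inner_vec, if_pos rfl, mul_one, real_inner_comm ζ]
    rfl
  · intro k _ hk
    rw [inner_smul_right, (orientedBasis hφ hf y).inner_vec, if_neg hk.symm, mul_zero]
  · exact fun h => absurd (Finset.mem_univ j) h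

/-- Simons' operator is `ψ ↦ ∑ ⟨ψ, Bᵢⱼ⟩ Bᵢⱼ`: the orthonormal frame of the normal space drops out,
as the second fundamental form `B` is normal. -/
theorem simonsOp_eq (hψ : ψ y ∈ normalSub I f y) :
    simonsOp I f ψ y = ∑ i, ∑ j, (inner ℝ (ψ y) (secondFormVec hφ hf y i j) : ℝ) •
      secondFormVec hφ hf y i j := by
  have h1 : ∀ i j, frameSum (V := TangentSpace (𝓡 7) (f y)) (normalSub I f y)
      (fun ζ => (inner ℝ (secondFormVec hφ hf y i j) ζ : ℝ) • ζ) = secondFormVec hφ hf y i j :=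
    fun i j => frameSum_inner_smul (V := TangentSpace (𝓡 7) (f y)) (secondFormVec_mem hφ hf i j)
  refine Eq.trans (b := ∑ i, ∑ j, (inner ℝ (ψ y) (secondFormVec hφ hf y i j) : ℝ) •
    frameSum (V := TangentSpace (𝓡 7) (f y)) (normalSub I f y)
      (fun ζ => (inner ℝ (secondFormVec hφ hf y i j) ζ : ℝ) • ζ)) ?_ (by simp only [h1])
  rw [simonsOp, shapeTranspose]
  simp only [frameSum, Finset.smul_sum, smul_smul]
  rw [Finset.sum_congr rfl fun i _ => Finset.sum_comm, Finset.sum_comm]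
  refine Finset.sum_congr rfl fun k _ => ?_
  rw [endInner_shape hφ hf hψ (Subtype.property _), Finset.sum_smul]
  exact Finset.sum_congr rfl fun i _ => Finset.sum_smul

theorem diracOp_base (hψ : IsSmoothAlong I f ψ) :
    diracOp I φ f ψ y = fromCoords (f y) (f y)
      ((germ hφ hf y).dirac (coordField I f y ψ) (germ hφ hf y).e₀) := by
  have h := (coordField_diracOp hφ hf (y₀ := y) hψ).self_of_nhdsWithin (germ hφ hf y).mem
  rw [← fromCoords_coordField_base (I := I) (diracOp I φ f ψ), h]
  rfl

/-- The Weitzenböck formula: all its terms are the coordinate expressions of the terms of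
`AssociativeGerm.dirac_dirac`, applied to the germ of the submanifold at `y`. -/
theorem diracOp_diracOp (hφ : IsParallelG2Form φ) (hf : IsAssociative I φ f)
    (hψ : IsNormalSection I f ψ) (y : Y) :
    diracOp I φ f (diracOp I φ f ψ) y
      = connLaplacian I f ψ y + partialRicci I f ψ y - simonsOp I f ψ y := by
  have h1 := (isNormalSection_diracOp hφ hf hψ.2).2
  rw [diracOp_base hφ hf h1, (germ hφ hf y).dirac_congr (coordField_diracOp hφ hf hψ.2),
    (germ hφ hf y).dirac_dirac (hψ.2.smooth_coordField hφ hf) (eventually_normal hφ hf hψ.1),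
    map_sub, map_add, ← connLaplacian_eq hφ hf hψ.2, ← partialRicci_eq hφ hf,
    simonsOp_eq hφ hf (hψ.1 y)]
  congr 1
  rw [map_sum]
  refine Finset.sum_congr rfl fun i _ => ?_
  rw [map_sum]
  refine Finset.sum_congr rfl fun j _ => ?_
  rw [map_smul, germ_metric_base]
  congr 2
  exact fromCoords_coordField_base (I := I) _

end Weitzenbock
end AssociativeSubmanifold

end

theorem mainTheorem2
    {M : Type*} [TopologicalSpace M] [ChartedSpace (AssociativeSubmanifold.Eu 7) M]
    [IsManifold (𝓡 7) ∞ M]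
    [RiemannianBundle (fun x : M => TangentSpace (𝓡 7) x)]
    [IsContMDiffRiemannianBundle (𝓡 7) ∞ (AssociativeSubmanifold.Eu 7)
      (fun x : M => TangentSpace (𝓡 7) x)]
    (φ : ∀ x : M, TangentSpace (𝓡 7) x [⋀^Fin 3]→ₗ[ℝ] ℝ)
    (hφ : AssociativeSubmanifold.IsParallelG2Form φ)
    {H : Type*} [TopologicalSpace H] (I : ModelWithCorners ℝ (AssociativeSubmanifold.Eu 3) H)
    {Y : Type*} [TopologicalSpace Y] [ChartedSpace H Y] [IsManifold I ∞ Y]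
    (f : Y → M) (hf : AssociativeSubmanifold.IsAssociative I φ f)
    (ψ : ∀ y : Y, TangentSpace (𝓡 7) (f y))
    (hψ : AssociativeSubmanifold.IsNormalSection I f ψ) :
    AssociativeSubmanifold.IsNormalSection I f (AssociativeSubmanifold.diracOp I φ f ψ) ∧
    ∀ y : Y,
      AssociativeSubmanifold.diracOp I φ f (AssociativeSubmanifold.diracOp I φ f ψ) y =
        AssociativeSubmanifold.connLaplacian I f ψ y
          + AssociativeSubmanifold.partialRicci I f ψ y
          - AssociativeSubmanifold.simonsOp I f ψ y :=
  ⟨AssociativeSubmanifold.isNormalSection_diracOp hφ hf hψ.2,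
    AssociativeSubmanifold.diracOp_diracOp hφ hf hψ⟩
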